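/- **Setting.** Let $G=(V,E)$ be a finite simple graph. For $t\in[0,t_1)$ consider compatibility functions $\Psi_i(x_i)=\exp(h_i\,\phi_i(x_i))$ $(i\in V)$ and $\Psi_{ij}(x_i,x_j)=\exp\big(J_{ij}\,\phi_{ij}(x_i,x_j)+a_{j\to i}\,\phi_i(x_i)+a_{i\to j}\,\phi_j(x_j)\big)$ $(ij\in E)$, whose real parameters $h=h(t)$, $J=J(t)$, $a=a(t)$ depend continuously on $t$, in one of the two cases * *attractive binary pairwise model*: $x_i\in\{1,-1\}$, the base measure $\nu$ is counting measure, $\phi_i(x)=x$, $\phi_{ij}(x,y)=xy$, and $J_{ij}(t)\ge 0$ for all $ij\in E$ and all $t$; * *fixed-mean Gaussian model*: $x_i\in\mathbb R$, $\nu$ is Lebesgue measure, $\phi_i(x)=(x-m_i)^2$, $\phi_{ij}(x,y)=(x-m_i)(y-m_j)$ for a fixed vector $(m_i)\in\mathbb R^V$. An LBP state is a vector $\mu=(\mu_{j\to i})$ indexed by the directed edges of $G$; it stands for the messages $m_{j\to i}(x_i)=\exp(\mu_{j\to i}\phi_i(x_i))$. The parallel LBP update $T$ replaces them by $$m'_{j\to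 i}(x_i)\ \propto\ \int \Psi_{ij}(x_i,x_j)\,\Psi_j(x_j)\prod_{k\sim j,\ k\ne i}m_{k\to j}(x_j)\,d\nu(x_j).$$ A fixed point $\mu$ of $T$ has beliefs $b_i\propto\Psi_i\prod_{k\sim i}m_{k\to i}$ and $b_{ij}\propto\Psi_{ij}\Psi_i\Psi_j\prod_{k\sim i,k\neq j}m_{k\to i}\prod_{k\sim j,k\ne i}m_{k\to j}$, which are required to be normalizable; its expectation parameters are $\eta_i=\mathbb E_{b_i}[\phi_i]$ and $\eta_{ij}=\mathbb E_{b_{ij}}[\phi_{ij}]$. The fixed point is *locally stable* if LBP started sufficiently close to it converges to it, and *unstable* otherwise. Let $L$ be the set of all $\eta=((\eta_i)_{i\in V},(\eta_{ij})_{ij\in E})$ such that $\eta_i$ is an expectation parameter of the exponential family with statistic $\phi_i$, and $(\eta_{ij},\eta_i,\eta_j)$ is one of the exponential family with statistic $(\phi_{ij},\phi_i,\phi_j)$. With $\varphi_i$ and $\varphi_{ij}$ the Legendre transforms of the log-partition functions of these families and $d_i$ the degree of $i$, the Bethe free energy on $L$ is $$F_t(\eta)=-\sum_i h_i\eta_i-\sum_{ij\in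 E}\big(J_{ij}\eta_{ij}+a_{j\to i}\eta_i+a_{i\to j}\eta_j\big)+\sum_{ij\in E}\varphi_{ij}(\eta_{ij},\eta_i,\eta_j)+\sum_i(1-d_i)\varphi_i(\eta_i).$$ **Theorem.** Let $0<t_0<t_1$ and let $t\mapsto\mu(t)$, $t\in[0,t_1)$, be a continuous trajectory of LBP fixed points with corresponding points $\eta(t)\in L$. Suppose that for $t\neq t_0$ the number $1$ is not an eigenvalue of the linearization $T'(\mu(t))$ of the LBP update. If the fixed point becomes unstable across $t=t_0$ for the first time, that is, $\mu(t)$ is locally stable for $0\le t<t_0$ and unstable for $t_0<t<t_1$, then $\eta(t)$ is a local minimum of $F_t$ on $L$ for every $0\le t<t_0$, and it is a saddle point of $F_t$ (a stationary point that is neither a local minimum nor a local maximum) for every $t_0<t<t_1$. -/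

import Mathlib

open MeasureTheory Filter Topology Set

noncomputable section

namespace PairwiseLBP

/-- A pairwise collection of exponential families whose vertex and edge statistics are scalar.
Every vertex variable is real and has base measure `ν`; the family at the vertex `i` has the
sufficient statistic `φ i`, and the family at an edge `ij` has base measure `ν × ν` and the
sufficient statistic `(ψ i j, φ i, φ j)`. -/
structure Family (V : Type*) where
  ν : Measure ℝ
  φ : V → ℝ → ℝ
  ψ : V → V → ℝ → ℝ → ℝ

/-- Binary pairwise family: variables in `{1, -1}` with counting measure, `φ i x = x` and
`ψ i j x y = x y`. -/
def binary (V : Type*) : Family V where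
  ν := Measure.dirac 1 + Measure.dirac (-1)
  φ := fun _ x => x
  ψ := fun _ _ x y => x * y

/-- Fixed-mean Gaussian family with mean vector `m`. -/
def fixedMeanGaussian {V : Type*} (m : V → ℝ) : Family V where
  ν := volume
  φ := fun i x => (x - m i) ^ 2
  ψ := fun i j x y => (x - m i) * (y - m j)

namespace Family

variable {V : Type*} (I : Family V)

/-! ### Vertex families -/

/-- Natural parameters of the vertex family. -/
def vertexParam (i : V) : Set ℝ :=
  interior {θ | Integrable (fun x => Real.exp (θ * I.φ i x)) I.ν}

/-- Log-partition function of the vertex family. -/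
def vertexLogPart (i : V) (θ : ℝ) : ℝ :=
  Real.log (∫ x, Real.exp (θ * I.φ i x) ∂I.ν)

/-- The expectation of the statistic as a function of the natural parameter. -/
def vertexMean (i : V) (θ : ℝ) : ℝ :=
  (∫ x, I.φ i x * Real.exp (θ * I.φ i x) ∂I.ν) / ∫ x, Real.exp (θ * I.φ i x) ∂I.ν

/-- Expectation parameters of the vertex family. -/
def vertexDual (i : V) : Set ℝ := I.vertexMean i '' I.vertexParam i

/-- Legendre transform of the log-partition function (the negative entropy). -/
def vertexLegendre (i : V) (η : ℝ) : ℝ :=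
  sSup ((fun θ => θ * η - I.vertexLogPart i θ) '' I.vertexParam i)

/-! ### Edge families; parameters are ordered as (pair, first endpoint, second endpoint) -/

/-- The unnormalized density of the edge family. -/
def edgeDensity (i j : V) (θ : ℝ × ℝ × ℝ) (p : ℝ × ℝ) : ℝ :=
  Real.exp (θ.1 * I.ψ i j p.1 p.2 + θ.2.1 * I.φ i p.1 + θ.2.2 * I.φ j p.2)

/-- Natural parameters of the edge family. -/
def edgeParam (i j : V) : Set (ℝ × ℝ × ℝ) :=
  interior {θ | Integrable (I.edgeDensity i j θ) (I.ν.prod I.ν)}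

/-- Log-partition function of the edge family. -/
def edgeLogPart (i j : V) (θ : ℝ × ℝ × ℝ) : ℝ :=
  Real.log (∫ p, I.edgeDensity i j θ p ∂(I.ν.prod I.ν))

/-- The expectation of the statistic as a function of the natural parameter. -/
def edgeMean (i j : V) (θ : ℝ × ℝ × ℝ) : ℝ × ℝ × ℝ :=
  ((∫ p, I.ψ i j p.1 p.2 * I.edgeDensity i j θ p ∂(I.ν.prod I.ν)) /
      ∫ p, I.edgeDensity i j θ p ∂(I.ν.prod I.ν),
    (∫ p, I.φ i p.1 * I.edgeDensity i j θ p ∂(I.ν.prod I.ν)) /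
      ∫ p, I.edgeDensity i j θ p ∂(I.ν.prod I.ν),
    (∫ p, I.φ j p.2 * I.edgeDensity i j θ p ∂(I.ν.prod I.ν)) /
      ∫ p, I.edgeDensity i j θ p ∂(I.ν.prod I.ν))

/-- Expectation parameters of the edge family. -/
def edgeDual (i j : V) : Set (ℝ × ℝ × ℝ) := I.edgeMean i j '' I.edgeParam i j

/-- Legendre transform of the log-partition function (the negative entropy). -/
def edgeLegendre (i j : V) (η : ℝ × ℝ × ℝ) : ℝ :=
  sSup ((fun θ : ℝ × ℝ × ℝ =>
    θ.1 * η.1 + θ.2.1 * η.2.1 + θ.2.2 * η.2.2 - I.edgeLogPart i j θ) '' I.edgeParam i j)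

end Family

variable {V : Type*} {G : SimpleGraph V}

/-- The undirected edge underlying a dart. -/
def dartEdge (d : G.Dart) : G.edgeSet := ⟨d.edge, d.edge_mem⟩

/-- A choice of orientation of every edge. -/
def edgeDart (e : G.edgeSet) : G.Dart where
  toProd := Quot.out e.1
  adj := by
    have h : s((Quot.out e.1).1, (Quot.out e.1).2) = e.1 := Quot.out_eq e.1
    rw [← G.mem_edgeSet, h]
    exact e.2

/-- Compatibility functions (in exponential form) over the graph `G`:
`Ψ_i(x_i) = exp (h i * φ_i(x_i))` at a vertex `i`, and at an edge `{i, j}`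
`Ψ_ij(x_i, x_j) = exp (J {i,j} * ψ_ij(x_i, x_j) + a (j → i) * φ_i(x_i) + a (i → j) * φ_j(x_j))`.
-/
structure Potential (G : SimpleGraph V) where
  J : G.edgeSet → ℝ
  a : G.Dart → ℝ
  h : V → ℝ

/-- All pair interactions are nonnegative. -/
def Potential.Attractive (P : Potential G) : Prop := ∀ e, 0 ≤ P.J e

/-- The compatibility function of the edge of `d`, with arguments `x` at `d.fst`, `y` at `d.snd`. -/
def edgeFactor (I : Family V) (P : Potential G) (d : G.Dart) (x y : ℝ) : ℝ :=
  Real.exp (P.J (dartEdge d) * I.ψ d.fst d.snd x y + P.a d.symm * I.φ d.fst x +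
    P.a d * I.φ d.snd y)

/-- The compatibility function of the vertex `i`. -/
def vertexFactor (I : Family V) (P : Potential G) (i : V) (x : ℝ) : ℝ :=
  Real.exp (P.h i * I.φ i x)

/-! ### The LBP algorithm

The message of the dart `d` is the message from the edge of `d` to the vertex `d.snd`; it is the
function `exp (μ d * φ)` of the variable at `d.snd`. -/

/-- The message of the dart `d`. -/
def message (I : Family V) (μ : G.Dart → ℝ) (d : G.Dart) (x : ℝ) : ℝ :=
  Real.exp (μ d * I.φ d.snd x)

section Finite

variable [Fintype V] [DecidableEq V] [DecidableRel G.Adj]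

/-- The product of the vertex factor at `d.fst` and of all the messages into `d.fst` except the one
from the edge of `d` itself. -/
def cavity (I : Family V) (P : Potential G) (μ : G.Dart → ℝ) (d : G.Dart) (x : ℝ) : ℝ :=
  vertexFactor I P d.fst x *
    ∏ e : G.Dart with e.snd = d.fst ∧ e ≠ d.symm, message I μ e x

/-- `μ'` is the result of one parallel LBP update of `μ`. (If the integral diverges it has the value
`0`, and then the equation cannot hold.) -/
def IsUpdate (I : Family V) (P : Potential G) (μ μ' : G.Dart → ℝ) : Prop :=
  ∀ d : G.Dart, ∃ ω : ℝ, 0 < ω ∧ ∀ᵐ y ∂I.ν,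
    message I μ' d y = ω * ∫ x, edgeFactor I P d x y * cavity I P μ d x ∂I.ν

open Classical in
/-- The LBP update as a map `T` on the parameters of the messages. -/
def updateMap (I : Family V) (P : Potential G) (μ : G.Dart → ℝ) : G.Dart → ℝ :=
  if h : ∃ μ', IsUpdate I P μ μ' then h.choose else μ

/-- The unnormalized belief at a vertex. -/
def vertexBelief (I : Family V) (P : Potential G) (μ : G.Dart → ℝ) (i : V) (x : ℝ) : ℝ :=
  vertexFactor I P i x * ∏ e : G.Dart with e.snd = i, message I μ e x

/-- The unnormalized belief at the edge of `d`. -/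
def edgeBelief (I : Family V) (P : Potential G) (μ : G.Dart → ℝ) (d : G.Dart) (p : ℝ × ℝ) : ℝ :=
  edgeFactor I P d p.1 p.2 * cavity I P μ d p.1 * cavity I P μ d.symm p.2

/-- `μ` is a fixed point of LBP whose beliefs can be normalized to probability densities. -/
def IsFixedPoint (I : Family V) (P : Potential G) (μ : G.Dart → ℝ) : Prop :=
  IsUpdate I P μ μ ∧
    (∀ i, Integrable (vertexBelief I P μ i) I.ν) ∧
    ∀ d, Integrable (edgeBelief I P μ d) (I.ν.prod I.ν)

/-- Local stability: LBP started at any point sufficiently close to `μ` converges to `μ`. -/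
def IsLocallyStable (I : Family V) (P : Potential G) (μ : G.Dart → ℝ) : Prop :=
  ∀ᶠ μ₀ in 𝓝 μ, ∃ run : ℕ → G.Dart → ℝ,
    run 0 = μ₀ ∧ (∀ n, IsUpdate I P (run n) (run (n + 1))) ∧ Tendsto run atTop (𝓝 μ)

/-- `1` is not an eigenvalue of the linearization of the LBP update at `μ`. -/
def IsNondegenerate (I : Family V) (P : Potential G) (μ : G.Dart → ℝ) : Prop :=
  ∀ v : G.Dart → ℝ, fderiv ℝ (updateMap I P) μ v = v → v = 0

/-! ### The Bethe free energy -/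

/-- The set `L` of pseudomarginals, in the coordinates `(η_i)` and `(η_ij)`; the endpoints of an
edge share the coordinates of the vertices, which is local consistency. -/
def pseudomarginals (G : SimpleGraph V) (I : Family V) : Set ((V → ℝ) × (G.edgeSet → ℝ)) :=
  {η | (∀ i, η.1 i ∈ I.vertexDual i) ∧
    ∀ e : G.edgeSet, (η.2 e, η.1 (edgeDart e).fst, η.1 (edgeDart e).snd) ∈
      I.edgeDual (edgeDart e).fst (edgeDart e).snd}

/-- The Bethe free energy. -/
def bethe (I : Family V) (P : Potential G) (η : (V → ℝ) × (G.edgeSet → ℝ)) : ℝ :=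
  - ∑ i, P.h i * η.1 i
  - ∑ e, (P.J e * η.2 e + P.a (edgeDart e).symm * η.1 (edgeDart e).fst +
      P.a (edgeDart e) * η.1 (edgeDart e).snd)
  + ∑ e, I.edgeLegendre (edgeDart e).fst (edgeDart e).snd
      (η.2 e, η.1 (edgeDart e).fst, η.1 (edgeDart e).snd)
  + ∑ i, (1 - (G.degree i : ℝ)) * I.vertexLegendre i (η.1 i)

/-- The expectation parameters of the beliefs of `μ`. -/
def beliefPoint (I : Family V) (P : Potential G) (μ : G.Dart → ℝ) :
    (V → ℝ) × (G.edgeSet → ℝ) :=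
  (fun i => (∫ x, I.φ i x * vertexBelief I P μ i x ∂I.ν) / ∫ x, vertexBelief I P μ i x ∂I.ν,
   fun e => (∫ p, I.ψ (edgeDart e).fst (edgeDart e).snd p.1 p.2 *
        edgeBelief I P μ (edgeDart e) p ∂(I.ν.prod I.ν)) /
      ∫ p, edgeBelief I P μ (edgeDart e) p ∂(I.ν.prod I.ν))

/-- `η` is a local minimum of the Bethe free energy on the set of pseudomarginals. -/
def IsBetheLocalMin (I : Family V) (P : Potential G) (η : (V → ℝ) × (G.edgeSet → ℝ)) : Prop :=
  η ∈ pseudomarginals G I ∧ IsLocalMinOn (bethe I P) (pseudomarginals G I) η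

/-- `η` is a saddle point of the Bethe free energy: a stationary point in the set of pseudomarginals
that is neither a local minimum nor a local maximum. -/
def IsBetheSaddle (I : Family V) (P : Potential G) (η : (V → ℝ) × (G.edgeSet → ℝ)) : Prop :=
  η ∈ pseudomarginals G I ∧ HasFDerivAt (bethe I P) (0 : (V → ℝ) × (G.edgeSet → ℝ) →L[ℝ] ℝ) η ∧
    ¬ IsLocalMinOn (bethe I P) (pseudomarginals G I) η ∧
    ¬ IsLocalMaxOn (bethe I P) (pseudomarginals G I) η

end Finite

end PairwiseLBP

end

/-! At each fixed `t`, stability of a nondegenerate fixed point and the type of the critical point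
of the Bethe free energy are governed by the same symmetric matrix on `V`. Let `v` be the variances
of the vertex statistics and `c` the covariances of the two vertex statistics on an edge. The
fixed-point equations make the first-order term of the free energy vanish. Completing the square in
the pair variables splits the second-order term into positive squares plus half the quadratic form
of `betheMatrix v c`. The linearized update multiplies the sum of the incoming messages,
backtracking excluded, by the weight `c d / v d.snd`.

Both models have `c ≥ 0`: attractiveness gives it in the binary case, and in the Gaussian case `c`
is twice a square. So the linearized update is entrywise nonnegative, and the Bethe matrix has
nonpositive off-diagonal entries. The bridge is `IsCovariance.cavityVariation_eq`: a linear system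
for the Bethe matrix is the linearized update equation with a source. A kernel vector of the matrix
therefore yields a fixed vector of the linearization, which nondegeneracy excludes.

Two cases remain (`posDef_or_exists_eigenvector`). If the matrix is positive definite, the free
energy has a strict quadratic minimum, and inverse positivity gives a positive vector decreased by
the linearization (`exists_update_lt`), so that shrinking order intervals prove stability. Otherwise
a Perron-Frobenius argument gives a nonnegative eigenvector with negative eigenvalue. It is a
descent direction, and it also gives a nonnegative vector increased by the linearization
(`exists_lt_update`), so monotonicity keeps some orbits away from the fixed point. The pair
directions always have positive curvature, so the critical point is then a saddle.

`HasBetheExpansion.localMin_or_saddle` is this dichotomy; `binary_localMin_or_saddle` and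
`gaussian_localMin_or_saddle` verify its hypotheses by computing means, Legendre transforms and
messages explicitly. -/

namespace PairwiseLBP

/-! ### Second-order expansions and tests for extrema. -/

section QuadraticExpansion

open Asymptotics

variable {E F : Type*} [NormedAddCommGroup E] [NormedAddCommGroup F]

/-- `f (x + v) = f x + l v + q v + o(‖v‖ ^ 2)` as `v` tends to `0`. -/
def HasQuadraticExpansion (f : E → ℝ) (x : E) (l q : E → ℝ) : Prop :=
  (fun v => f (x + v) - f x - l v - q v) =o[𝓝 0] fun v => ‖v‖ ^ 2

namespace HasQuadraticExpansion

variable {f g : E → ℝ} {x : E} {l q l' q' : E → ℝ}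

theorem congr_coeff (h : HasQuadraticExpansion f x l q) (hl : ∀ v, l v = l' v)
    (hq : ∀ v, q v = q' v) : HasQuadraticExpansion f x l' q' := by
  obtain rfl : l = l' := funext hl
  obtain rfl : q = q' := funext hq
  exact h

theorem congr_of_eventuallyEq (h : HasQuadraticExpansion f x l q) (hfg : g =ᶠ[𝓝 x] f) :
    HasQuadraticExpansion g x l q := by
  have h0 : Tendsto (fun v : E => x + v) (𝓝 0) (𝓝 x) := by
    have hc : Continuous fun v : E => x + v := by fun_prop
    simpa using hc.tendsto 0
  refine IsLittleO.congr' h ?_ EventuallyEq.rfl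
  filter_upwards [h0.eventually hfg] with v hv
  rw [hv, hfg.eq_of_nhds]

theorem of_affine (hf : ∀ v, f (x + v) = f x + l v) :
    HasQuadraticExpansion f x l (fun _ => 0) := by
  refine (isLittleO_zero (E' := ℝ) (fun v : E => ‖v‖ ^ 2) (𝓝 0)).congr_left fun v => ?_
  simp [hf]

theorem add (hf : HasQuadraticExpansion f x l q) (hg : HasQuadraticExpansion g x l' q') :
    HasQuadraticExpansion (fun y => f y + g y) x (fun v => l v + l' v) (fun v => q v + q' v) :=
  (IsLittleO.add hf hg).congr_left fun v => by ring

theorem const_mul (c : ℝ) (hf : HasQuadraticExpansion f x l q) :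
    HasQuadraticExpansion (fun y => c * f y) x (fun v => c * l v) (fun v => c * q v) :=
  (IsLittleO.const_mul_left hf c).congr_left fun v => by ring

theorem sum {ι : Type*} {s : Finset ι} {f l q : ι → E → ℝ}
    (h : ∀ i ∈ s, HasQuadraticExpansion (f i) x (l i) (q i)) :
    HasQuadraticExpansion (fun y => ∑ i ∈ s, f i y) x (fun v => ∑ i ∈ s, l i v)
      (fun v => ∑ i ∈ s, q i v) :=
  (IsLittleO.sum h).congr_left fun v => by
    simp only [Finset.sum_apply, Finset.sum_sub_distrib]

theorem neg (h : HasQuadraticExpansion f x l q) :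
    HasQuadraticExpansion (fun y => - f y) x (fun v => - l v) (fun v => - q v) :=
  (IsLittleO.neg_left h).congr_left fun v => by ring

theorem isLocalMin (h : HasQuadraticExpansion f x (fun _ => 0) q) {c : ℝ} (hc : 0 < c)
    (hq : ∀ v, c * ‖v‖ ^ 2 ≤ q v) : IsLocalMin f x := by
  have h0 : Tendsto (fun y : E => y - x) (𝓝 x) (𝓝 0) := by
    have hc : Continuous fun y : E => y - x := by fun_prop
    simpa using hc.tendsto x
  filter_upwards [h0.eventually (h.def hc)] with y hy
  have := hq (y - x)
  simp only [add_sub_cancel, norm_pow, norm_norm, sub_zero] at hy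
  have := (abs_le.1 hy).1
  linarith

variable [NormedSpace ℝ E] [NormedSpace ℝ F]

/-- Allowing `B` a constant term covers probabilities, which are affine in the expectation
parameters. -/
theorem comp_affine {f : F → ℝ} {l q : F → ℝ} {B : E → F} (A : E →L[ℝ] F)
    (hB : ∀ v, B (x + v) = B x + A v) (h : HasQuadraticExpansion f (B x) l q) :
    HasQuadraticExpansion (fun y => f (B y)) x (fun v => l (A v)) (fun v => q (A v)) := by
  have h0 : Tendsto A (𝓝 0) (𝓝 0) := by simpa using A.continuous.tendsto 0
  have h1 := (IsLittleO.comp_tendsto h h0).trans_isBigO ((A.isBigO_id (𝓝 0)).norm_norm.pow 2)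
  refine h1.congr_left fun v => ?_
  simp [hB]

theorem comp {f : F → ℝ} {l q : F → ℝ} (A : E →L[ℝ] F)
    (h : HasQuadraticExpansion f (A x) l q) :
    HasQuadraticExpansion (fun y => f (A y)) x (fun v => l (A v)) (fun v => q (A v)) :=
  comp_affine A (fun v => map_add A x v) h

/-- Composition with a quadratic map `B (x + v) = B x + A v + R v`. -/
theorem comp_quadratic {f : ℝ → ℝ} {α β C : ℝ} {B R : E → ℝ} (A : E →L[ℝ] ℝ)
    (hB : ∀ v, B (x + v) = B x + A v + R v) (hR : ∀ v, |R v| ≤ C * ‖v‖ ^ 2)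
    (h : HasQuadraticExpansion f (B x) (fun w => α * w) (fun w => β * w ^ 2)) :
    HasQuadraticExpansion (fun y => f (B y)) x (fun v => α * A v)
      (fun v => α * R v + β * A v ^ 2) := by
  have hR2 : R =O[𝓝 0] fun v => ‖v‖ ^ 2 := IsBigO.of_bound C (.of_forall fun v => by
    simpa using hR v)
  have hsq : (fun v : E => ‖v‖ ^ 2) =O[𝓝 0] fun v => ‖v‖ := by
    simpa using ((isLittleO_norm_pow_id (E' := E) (n := 2) one_lt_two).isBigO.norm_right)
  have hA : (fun v => A v) =O[𝓝 0] fun v => ‖v‖ := (A.isBigO_id (𝓝 0)).norm_right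
  have hw : (fun v => A v + R v) =O[𝓝 0] fun v => ‖v‖ := hA.add (hR2.trans hsq)
  have hnorm : Tendsto (fun v : E => ‖v‖) (𝓝 0) (𝓝 0) := by
    simpa using (continuous_norm : Continuous fun v : E => ‖v‖).tendsto 0
  have h1 := (IsLittleO.comp_tendsto h (hw.trans_tendsto hnorm)).trans_isBigO (hw.norm_left.pow 2)
  -- Replacing `(A v + R v) ^ 2` by `A v ^ 2` costs `R v * (2 * A v + R v)`, which is `O(‖v‖ ^ 2)`
  -- times `o(1)`.
  have hone : (fun v => 2 * A v + R v) =o[𝓝 0] fun _ => (1 : ℝ) :=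
    (isLittleO_one_iff ℝ).2 (((hA.const_mul_left 2).add (hR2.trans hsq)).trans_tendsto hnorm)
  have h2 : (fun v => β * (R v * (2 * A v + R v))) =o[𝓝 0] fun v => ‖v‖ ^ 2 := by
    simpa using (hR2.mul_isLittleO hone).const_mul_left β
  refine (h1.add h2).congr_left fun v => ?_
  simp only [Function.comp_apply, hB, add_assoc]
  ring

/-- The quadratic remainder has derivative `o(|y - x|)` by differentiability of `f'` at `x`; the
mean value inequality raises the order by one. -/
theorem of_hasDerivAt {f f' : ℝ → ℝ} {x f'' : ℝ} (hf : ∀ᶠ y in 𝓝 x, HasDerivAt f (f' y) y)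
    (hf' : HasDerivAt f' f'' x) :
    HasQuadraticExpansion f x (fun v => f' x * v) (fun v => f'' / 2 * v ^ 2) := by
  obtain ⟨r, hr, hball⟩ := Metric.eventually_nhds_iff_ball.1 hf
  have hs : Metric.ball x r ∈ 𝓝 x := Metric.ball_mem_nhds x hr
  have h1 : (fun y => f' y - f' x - f'' * (y - x)) =o[𝓝[Metric.ball x r] x]
      fun y => (y - x) ^ 1 := by
    simpa [mul_comm] using (hasDerivAt_iff_isLittleO.1 hf').mono nhdsWithin_le_nhds
  have h2 := Convex.isLittleO_pow_succ_real (convex_ball x r) (Metric.mem_ball_self hr)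
    (f := fun y => f y - f' x * (y - x) - f'' / 2 * (y - x) ^ 2)
    (f' := fun y => f' y - f' x - f'' * (y - x)) (n := 1) (fun y hy => by
      have e1 := (hball y hy).hasDerivWithinAt (s := Metric.ball x r)
      have e2 := ((hasDerivAt_id y).sub_const x)
      have e3 := ((hball y hy).sub (e2.const_mul (f' x))).sub ((e2.pow 2).const_mul (f'' / 2))
      refine (e3.congr_deriv ?_).hasDerivWithinAt
      simp; ring) h1
  rw [nhdsWithin_eq_nhds.2 hs] at h2
  have h0 : Tendsto (fun v : ℝ => x + v) (𝓝 0) (𝓝 x) := by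
    have hc : Continuous fun v : ℝ => x + v := by fun_prop
    simpa using hc.tendsto 0
  refine (IsLittleO.norm_right (h2.comp_tendsto h0)).congr (fun v => ?_) fun v => ?_
  · simp; ring
  · simp

theorem hasFDerivAt (h : HasQuadraticExpansion f x (fun _ => 0) q) (C : ℝ)
    (hq : ∀ v, |q v| ≤ C * ‖v‖ ^ 2) : HasFDerivAt f (0 : E →L[ℝ] ℝ) x := by
  rw [hasFDerivAt_iff_isLittleO_nhds_zero]
  have hsq : (fun v : E => ‖v‖ ^ 2) =o[𝓝 0] fun v => v := by
    have := isLittleO_norm_pow_id (E' := E) (n := 2) one_lt_two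
    exact this
  have h1 : q =O[𝓝 0] fun v => ‖v‖ ^ 2 := IsBigO.of_bound C (.of_forall fun v => by
    simpa using hq v)
  refine ((IsLittleO.trans h hsq).add (h1.trans_isLittleO hsq)).congr_left fun v => ?_
  simp

theorem not_isLocalMin (h : HasQuadraticExpansion f x (fun _ => 0) q) {v : E} (hv : q v < 0)
    (hq : ∀ t : ℝ, q (t • v) = t ^ 2 * q v) : ¬ IsLocalMin f x := by
  intro hmin
  have hv0 : 0 < ‖v‖ := norm_pos_iff.2 fun h0 => by
    have := hq 0
    rw [zero_smul, ← h0] at this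
    norm_num at this
    exact hv.ne this
  have h0 : Tendsto (fun t : ℝ => t • v) (𝓝[>] 0) (𝓝 0) := by
    have hc : Continuous fun t : ℝ => t • v := by fun_prop
    simpa using (hc.tendsto 0).mono_left nhdsWithin_le_nhds
  have h1 : Tendsto (fun t : ℝ => x + t • v) (𝓝[>] 0) (𝓝 x) := by
    simpa using h0.const_add x
  -- With this constant the error along the ray `t • v` is at most half of `|q (t • v)|`.
  have hc : 0 < - q v / (2 * ‖v‖ ^ 2) := div_pos (by linarith) (by positivity)
  obtain ⟨t, ht, ht1, ht2⟩ := ((h0.eventually (h.def hc)).and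
    ((h1.eventually hmin).and self_mem_nhdsWithin)).exists
  have ht2 : 0 < t := ht2
  simp only [norm_pow, sub_zero, hq, norm_smul, Real.norm_eq_abs, abs_mul, abs_abs, abs_norm] at ht
  have h3 := (abs_le.1 ht).2
  have h4 : - q v / (2 * ‖v‖ ^ 2) * (|t| * ‖v‖) ^ 2 = - q v / 2 * t ^ 2 := by
    rw [mul_pow, sq_abs]; field_simp
  rw [h4] at h3
  nlinarith [mul_pos (pow_pos ht2 2) (neg_pos.2 hv)]

theorem not_isLocalMax (h : HasQuadraticExpansion f x (fun _ => 0) q) {v : E} (hv : 0 < q v)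
    (hq : ∀ t : ℝ, q (t • v) = t ^ 2 * q v) : ¬ IsLocalMax f x := fun hmax =>
  (h.neg.congr_coeff (by simp) fun _ => rfl).not_isLocalMin (neg_lt_zero.2 hv)
    (fun t => by rw [hq]; ring) hmax.neg

end HasQuadraticExpansion

/-- A continuous homogeneous function of degree two is bounded by a multiple of `‖v‖ ^ 2`. -/
theorem exists_abs_le_mul_norm_sq [NormedSpace ℝ E] [FiniteDimensional ℝ E] {q : E → ℝ}
    (hc : Continuous q)
    (hq : ∀ (t : ℝ) v, q (t • v) = t ^ 2 * q v) : ∃ C : ℝ, ∀ v, |q v| ≤ C * ‖v‖ ^ 2 := by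
  obtain ⟨C, hC⟩ := (isCompact_sphere (0 : E) 1).exists_bound_of_continuousOn hc.continuousOn
  refine ⟨C, fun v => ?_⟩
  rcases eq_or_ne v 0 with rfl | hv
  · have := hq 0 0
    simp_all
  have hv' : 0 < ‖v‖ := norm_pos_iff.2 hv
  have h1 := hC (‖v‖⁻¹ • v) (by simp [norm_smul, hv'.ne'])
  rw [hq, Real.norm_eq_abs, abs_mul, abs_of_nonneg (by positivity)] at h1
  calc |q v| = (‖v‖⁻¹ ^ 2 * |q v|) * ‖v‖ ^ 2 := by field_simp
    _ ≤ C * ‖v‖ ^ 2 := by gcongr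

/-- A continuous positive definite homogeneous function of degree two dominates a multiple of
`‖v‖ ^ 2`. -/
theorem exists_mul_norm_sq_le [NormedSpace ℝ E] [FiniteDimensional ℝ E] {q : E → ℝ}
    (hc : Continuous q)
    (hq : ∀ (t : ℝ) v, q (t • v) = t ^ 2 * q v) (hpos : ∀ v ≠ 0, 0 < q v) :
    ∃ c : ℝ, 0 < c ∧ ∀ v, c * ‖v‖ ^ 2 ≤ q v := by
  have h0 : q 0 = 0 := by simpa using hq 0 0
  rcases subsingleton_or_nontrivial E with hE | hE
  · exact ⟨1, one_pos, fun v => by simp [Subsingleton.elim v 0, h0]⟩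
  obtain ⟨w, hw, hmin⟩ := (isCompact_sphere (0 : E) 1).exists_isMinOn
    ((NormedSpace.sphere_nonempty (E := E)).2 zero_le_one) hc.continuousOn
  have hw1 : ‖w‖ = 1 := by simpa using hw
  refine ⟨q w, hpos w fun h => by simp [h] at hw1, fun v => ?_⟩
  rcases eq_or_ne v 0 with rfl | hv
  · simp [h0]
  have hv' : 0 < ‖v‖ := norm_pos_iff.2 hv
  have h1 : q w ≤ q (‖v‖⁻¹ • v) := hmin (by simp [norm_smul, hv'.ne'])
  rw [hq] at h1
  calc q w * ‖v‖ ^ 2 ≤ (‖v‖⁻¹ ^ 2 * q v) * ‖v‖ ^ 2 := by gcongr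
    _ = q v := by field_simp

theorem hasQuadraticExpansion_mul_log {x : ℝ} (hx : 0 < x) :
    HasQuadraticExpansion (fun y => y * Real.log y) x (fun v => (Real.log x + 1) * v)
      (fun v => x⁻¹ / 2 * v ^ 2) := by
  refine HasQuadraticExpansion.of_hasDerivAt (f' := fun y => Real.log y + 1) ?_
    ((Real.hasDerivAt_log hx.ne').add_const 1)
  filter_upwards [lt_mem_nhds hx] with y hy
  exact Real.hasDerivAt_mul_log hy.ne'

theorem hasQuadraticExpansion_log {x : ℝ} (hx : 0 < x) :
    HasQuadraticExpansion Real.log x (fun v => x⁻¹ * v) (fun v => -(x ^ 2)⁻¹ / 2 * v ^ 2) := by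
  refine HasQuadraticExpansion.of_hasDerivAt (f' := fun y => y⁻¹) ?_ (hasDerivAt_inv hx.ne')
  filter_upwards [lt_mem_nhds hx] with y hy
  exact Real.hasDerivAt_log hy.ne'

end QuadraticExpansion

/-! ### Symmetric matrices with nonpositive off-diagonal entries. -/

section Stieltjes

open Matrix

variable {V : Type*} [Fintype V] {A : Matrix V V ℝ}

/-- Taking absolute values fixes the diagonal terms and can only lower the off-diagonal ones. -/
theorem dotProduct_mulVec_abs_le (hA : ∀ i j, i ≠ j → A i j ≤ 0) (x : V → ℝ) :
    (fun i => |x i|) ⬝ᵥ (A *ᵥ fun i => |x i|) ≤ x ⬝ᵥ (A *ᵥ x) := by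
  simp only [dotProduct, mulVec, Finset.mul_sum]
  refine Finset.sum_le_sum fun i _ => Finset.sum_le_sum fun j _ => ?_
  rcases eq_or_ne i j with rfl | hij
  · have : |x i| * |x i| = x i * x i := abs_mul_abs_self _
    exact le_of_eq (by linear_combination A i i * this)
  · have h1 := le_abs_self (x i * x j)
    rw [abs_mul] at h1
    nlinarith [hA i j hij]

/-- A symmetric matrix with nonpositive off-diagonal entries that is not positive definite has a
nonnegative eigenvector with nonpositive eigenvalue. -/
theorem exists_nonneg_eigenvector_of_not_posDef [DecidableEq V] (hsymm : A.IsHermitian)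
    (hA : ∀ i j, i ≠ j → A i j ≤ 0) (hpd : ¬ A.PosDef) :
    ∃ (x : V → ℝ) (r : ℝ), r ≤ 0 ∧ 0 ≤ x ∧ x ≠ 0 ∧ A *ᵥ x = r • x := by
  have hpos : ∀ y : V → ℝ, y ≠ 0 → 0 < y ⬝ᵥ y := fun y hy =>
    (Finset.sum_nonneg fun i _ => mul_self_nonneg (y i)).lt_of_ne'
      (dotProduct_self_eq_zero.not.2 hy)
  have hex : ∃ y : V → ℝ, y ≠ 0 ∧ y ⬝ᵥ (A *ᵥ y) ≤ 0 := by
    by_contra! h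
    exact hpd (.of_dotProduct_mulVec_pos hsymm fun {x} hx => by simpa using h x hx)
  obtain ⟨y, hy0, hy⟩ := hex
  set S : Set (V → ℝ) := {x | x ⬝ᵥ x = 1}
  have hnorm : ∀ y : V → ℝ, y ≠ 0 → (√(y ⬝ᵥ y))⁻¹ • y ∈ S := fun y hy => by
    have := hpos y hy
    change _ = _
    simp only [smul_dotProduct, dotProduct_smul, smul_eq_mul]
    rw [← mul_assoc, ← mul_inv, Real.mul_self_sqrt this.le, inv_mul_cancel₀ this.ne']
  have hcont : Continuous fun x : V → ℝ => x ⬝ᵥ (A *ᵥ x) := by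
    simp only [dotProduct, mulVec]; fun_prop
  -- `V → ℝ` carries the sup norm, so `S` is not a metric sphere; it is a closed subset of a cube.
  have hcomp : IsCompact S := by
    have hI : IsCompact (Set.univ.pi fun _ : V => Set.Icc (-1 : ℝ) 1) :=
      isCompact_univ_pi fun _ => isCompact_Icc
    refine hI.of_isClosed_subset (isClosed_eq (by simp only [dotProduct]; fun_prop)
      continuous_const) fun x hx i _ => ?_
    have h1 : x i * x i ≤ x ⬝ᵥ x :=
      Finset.single_le_sum (f := fun i => x i * x i) (fun j _ => mul_self_nonneg (x j))
        (Finset.mem_univ i)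
    rw [show x ⬝ᵥ x = 1 from hx] at h1
    exact ⟨by nlinarith, by nlinarith⟩
  obtain ⟨x, hxS, hmin⟩ := hcomp.exists_isMinOn ⟨_, hnorm y hy0⟩ hcont.continuousOn
  set r := x ⬝ᵥ (A *ᵥ x)
  have hbound : ∀ z : V → ℝ, r * (z ⬝ᵥ z) ≤ z ⬝ᵥ (A *ᵥ z) := fun z => by
    rcases eq_or_ne z 0 with rfl | hz
    · simp
    have h1 : r ≤ _ := hmin (hnorm z hz)
    have h2 := hpos z hz
    simp only [smul_dotProduct, mulVec_smul, dotProduct_smul, smul_eq_mul] at h1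
    rw [← mul_assoc, ← mul_inv, Real.mul_self_sqrt h2.le] at h1
    rwa [← div_eq_inv_mul, le_div_iff₀ h2] at h1
  have habs : (fun i => |x i|) ⬝ᵥ (fun i => |x i|) = 1 := by
    rw [← show x ⬝ᵥ x = 1 from hxS]
    simp [dotProduct]
  have hr : r ≤ 0 := by
    have h1 := hbound y
    have := hpos y hy0
    by_contra! h
    nlinarith
  have hpsd : (A - r • (1 : Matrix V V ℝ)).PosSemidef := by
    refine .of_dotProduct_mulVec_nonneg (hsymm.sub ?_) fun z => ?_
    · simp [IsHermitian]
    · have := hbound z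
      simp only [star_trivial, sub_mulVec, smul_mulVec, one_mulVec, dotProduct_sub,
        dotProduct_smul, smul_eq_mul]
      linarith
  -- `|x|` also minimizes the Rayleigh quotient, and a null vector of the form of the positive
  -- semidefinite matrix `A - r` lies in its kernel.
  have hzero : (fun i => |x i|) ⬝ᵥ ((A - r • (1 : Matrix V V ℝ)) *ᵥ fun i => |x i|) = 0 := by
    simp only [sub_mulVec, smul_mulVec, one_mulVec, dotProduct_sub, dotProduct_smul, smul_eq_mul,
      habs, mul_one]
    refine le_antisymm (by linarith [dotProduct_mulVec_abs_le hA x]) ?_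
    have := hbound fun i => |x i|
    rw [habs] at this
    linarith
  have hker := (hpsd.dotProduct_mulVec_zero_iff fun i => |x i|).1 (by simpa using hzero)
  refine ⟨fun i => |x i|, r, hr, fun i => abs_nonneg _, fun h => ?_, ?_⟩
  · rw [h] at habs
    simp at habs
  · simpa [sub_mulVec, smul_mulVec, sub_eq_zero] using hker

/-- Inverse positivity of Stieltjes matrices. -/
theorem nonneg_of_mulVec_nonneg (hpd : A.PosDef) (hA : ∀ i j, i ≠ j → A i j ≤ 0) {x : V → ℝ}
    (hx : 0 ≤ A *ᵥ x) : 0 ≤ x := by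
  set n : V → ℝ := fun i => max (- x i) 0
  have hn : 0 ≤ n := fun i => le_max_right _ _
  have h1 : 0 ≤ n ⬝ᵥ (A *ᵥ x) := Finset.sum_nonneg fun i _ => mul_nonneg (hn i) (hx i)
  -- `n` and `x + n` are the negative and positive parts of `x`. Their supports are disjoint, so
  -- only off-diagonal entries contribute. Subtracting `h1` gives `n ⬝ᵥ (A *ᵥ n) ≤ 0`, hence `n =
  -- 0`.
  have h2 : n ⬝ᵥ (A *ᵥ (x + n)) ≤ 0 := by
    simp only [dotProduct, mulVec, Finset.mul_sum]
    refine Finset.sum_nonpos fun i _ => Finset.sum_nonpos fun j _ => ?_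
    have hj : 0 ≤ (x + n) j := by
      have := le_max_left (- x j) 0
      simp only [n, Pi.add_apply]; linarith
    rcases eq_or_ne i j with rfl | hij
    · have : n i * (x + n) i = 0 := by
        simp only [n, Pi.add_apply]
        rcases le_total (- x i) 0 with h | h
        · simp [max_eq_right h]
        · simp [max_eq_left h]
      exact le_of_eq (by linear_combination A i i * this)
    · have := mul_nonneg (hn i) hj
      nlinarith [hA i j hij]
  rw [mulVec_add, dotProduct_add] at h2
  have h3 : n = 0 := by
    by_contra h
    have := hpd.dotProduct_mulVec_pos h
    rw [star_trivial] at this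
    linarith
  intro i
  have := congrFun h3 i
  simpa [n] using this

end Stieltjes

/-! ### The Bethe matrix and the linearized update. -/

section BetheMatrix

open Matrix

variable {V : Type*} [Fintype V] [DecidableEq V] {G : SimpleGraph V} [DecidableRel G.Adj]

/-- The sum over the darts pointing to the source of `d`, except for the reversal of `d`. -/
def cavitySum (u : G.Dart → ℝ) (d : G.Dart) : ℝ :=
  ∑ e : G.Dart with e.snd = d.fst ∧ e ≠ d.symm, u e

/-- The determinant of the covariance matrix of the statistics at the endpoints of `d`. -/
def dartDet (v : V → ℝ) (c : G.Dart → ℝ) (d : G.Dart) : ℝ := v d.fst * v d.snd - c d ^ 2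

/-- The variation of the cavity parameter at the source of `d` that is due to the variation `ξ` of
the vertex means, for vertex variances `v` and edge covariances `c`. -/
noncomputable def cavityVariation (v : V → ℝ) (c : G.Dart → ℝ) (ξ : V → ℝ) (d : G.Dart) : ℝ :=
  (v d.snd * ξ d.fst - c d * ξ d.snd) / dartDet v c d

/-- The Hessian of the Bethe free energy as a function of the vertex means, the pair variables being
eliminated. -/
noncomputable def betheMatrix (v : V → ℝ) (c : G.Dart → ℝ) : Matrix V V ℝ :=
  Matrix.of fun i j =>
    (if i = j then (v i)⁻¹ + ∑ d : G.Dart with d.fst = i, (v d.snd / dartDet v c d - (v i)⁻¹)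
      else 0) - ∑ d : G.Dart with d.fst = i ∧ d.snd = j, c d / dartDet v c d

/-- Conditions on vertex variances `v` and edge covariances `c`. -/
structure IsCovariance (v : V → ℝ) (c : G.Dart → ℝ) : Prop where
  pos : ∀ i, 0 < v i
  nonneg : ∀ d, 0 ≤ c d
  symm : ∀ d, c d.symm = c d
  lt : ∀ d, c d ^ 2 < v d.fst * v d.snd

namespace IsCovariance

variable {V : Type*} {G : SimpleGraph V} {v : V → ℝ} {c : G.Dart → ℝ}

theorem dartDet_pos (h : IsCovariance v c) (d : G.Dart) : 0 < dartDet v c d := sub_pos.2 (h.lt d)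

theorem dartDet_symm (h : IsCovariance v c) (d : G.Dart) : dartDet v c d.symm = dartDet v c d := by
  simp only [dartDet, h.symm]
  simp [SimpleGraph.Dart.symm, mul_comm]

/-- This is `eq_add_cavityVariation` at the reversed dart, divided by `v d.snd`: the message
variation carried by `d` is, up to sign, the correction that the edge contributes to row `d.snd` of
the Bethe matrix. -/
theorem weight_mul_cavityVariation (h : IsCovariance v c) (ξ : V → ℝ) (d : G.Dart) :
    c d / v d.snd * cavityVariation v c ξ d =
      ξ d.snd / v d.snd - cavityVariation v c ξ d.symm := by
  have h1 := (h.dartDet_pos d).ne'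
  have h2 := (h.pos d.snd).ne'
  rw [cavityVariation, cavityVariation, h.dartDet_symm, h.symm]
  simp only [SimpleGraph.Dart.symm, Prod.fst_swap, Prod.snd_swap]
  rw [eq_sub_iff_add_eq, div_mul_div_comm, div_add_div _ _ (mul_ne_zero h2 h1) h1,
    div_eq_div_iff (mul_ne_zero (mul_ne_zero h2 h1) h1) h2]
  simp only [dartDet]
  ring

/-- The cavity variations of `d` and `d.symm` are the inverse of the 2 × 2 covariance matrix applied
to the values of `ξ` at the endpoints; this undoes the inversion. -/
theorem eq_add_cavityVariation (h : IsCovariance v c) (ξ : V → ℝ) (d : G.Dart) :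
    ξ d.fst = v d.fst * cavityVariation v c ξ d + c d * cavityVariation v c ξ d.symm := by
  have h1 := (h.dartDet_pos d).ne'
  rw [cavityVariation, cavityVariation, h.dartDet_symm, h.symm]
  simp only [SimpleGraph.Dart.symm, Prod.fst_swap, Prod.snd_swap]
  field_simp
  simp only [dartDet]
  ring

end IsCovariance

theorem betheMatrix_mulVec (v : V → ℝ) (c : G.Dart → ℝ) (ξ : V → ℝ) (i : V) :
    (betheMatrix v c *ᵥ ξ) i =
      ξ i / v i + ∑ d : G.Dart with d.fst = i, (cavityVariation v c ξ d - ξ i / v i) := by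
  -- The darts leaving `i` are grouped by their targets.
  have h1 : ∑ j, (∑ d : G.Dart with d.fst = i ∧ d.snd = j, c d / dartDet v c d) * ξ j =
      ∑ d : G.Dart with d.fst = i, c d / dartDet v c d * ξ d.snd := by
    rw [← Finset.sum_fiberwise (Finset.univ.filter fun d : G.Dart => d.fst = i) (fun d => d.snd)]
    refine Finset.sum_congr rfl fun j _ => ?_
    rw [Finset.sum_mul, Finset.filter_filter]
    refine Finset.sum_congr rfl fun d hd => ?_
    rw [(Finset.mem_filter.1 hd).2.2]
  simp only [betheMatrix, mulVec, dotProduct, of_apply, sub_mul, Finset.sum_sub_distrib, h1,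
    ite_mul, zero_mul, Finset.sum_ite_eq, Finset.mem_univ, if_true]
  rw [← Finset.sum_sub_distrib, ← Finset.sum_sub_distrib, add_mul, Finset.sum_mul, add_sub_assoc,
    ← Finset.sum_sub_distrib]
  congr 1
  · rw [div_eq_inv_mul]
  · refine Finset.sum_congr rfl fun d hd => ?_
    rw [cavityVariation, (Finset.mem_filter.1 hd).2]
    ring

/-- No message sees an isolated vertex, so arguments that recover `ξ` from cavity variations need
this case separately. -/
theorem betheMatrix_mulVec_of_isolated (v : V → ℝ) (c : G.Dart → ℝ) (ξ : V → ℝ) (i : V)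
    (hi : ∀ d : G.Dart, d.fst ≠ i) : (betheMatrix v c *ᵥ ξ) i = ξ i / v i := by
  rw [betheMatrix_mulVec, Finset.filter_false_of_mem fun d _ => hi d]
  simp

namespace IsCovariance

variable {v : V → ℝ} {c : G.Dart → ℝ}

theorem isHermitian (h : IsCovariance v c) : (betheMatrix v c).IsHermitian := by
  ext i j
  simp only [betheMatrix, conjTranspose_apply, of_apply, star_trivial]
  congr 1
  · rcases eq_or_ne i j with rfl | hij
    · rfl
    · simp [hij, hij.symm]
  · refine Finset.sum_bij' (fun d _ => d.symm) (fun d _ => d.symm) ?_ ?_ ?_ ?_ ?_ <;>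
      simp +contextual [h.symm, h.dartDet_symm, SimpleGraph.Dart.symm_symm]

theorem offDiag_nonpos (h : IsCovariance v c) (i j : V) (hij : i ≠ j) :
    betheMatrix v c i j ≤ 0 := by
  simp only [betheMatrix, of_apply, hij, if_false, zero_sub, neg_nonpos]
  exact Finset.sum_nonneg fun d _ => div_nonneg (h.nonneg d) (h.dartDet_pos d).le

/-- Linear systems for the Bethe matrix are linearized message passing equations with sources. -/
theorem cavityVariation_eq (h : IsCovariance v c) (ξ : V → ℝ) (d : G.Dart) :
    cavityVariation v c ξ d = (betheMatrix v c *ᵥ ξ) d.fst +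
      cavitySum (fun e => c e / v e.snd * cavityVariation v c ξ e) d := by
  -- Reversal turns the darts into `d.fst` other than `d.symm` into the darts out of `d.fst` other
  -- than `d`. These are all the terms of row `d.fst` of the Bethe matrix except the one of `d`.
  have h1 : cavitySum (fun e => c e / v e.snd * cavityVariation v c ξ e) d =
      ∑ e : G.Dart with e.fst = d.fst ∧ e ≠ d, (ξ d.fst / v d.fst - cavityVariation v c ξ e) := by
    refine Finset.sum_bij' (fun d _ => d.symm) (fun d _ => d.symm) ?_ ?_ ?_ ?_ ?_
    · intro e he
      simp only [Finset.mem_filter, Finset.mem_univ, true_and] at he ⊢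
      exact ⟨he.1, fun h0 => he.2 (by rw [← h0, SimpleGraph.Dart.symm_symm])⟩
    · intro e he
      simp only [Finset.mem_filter, Finset.mem_univ, true_and] at he ⊢
      exact ⟨he.1, fun h0 => he.2 (by
        rw [← SimpleGraph.Dart.symm_symm e, h0, SimpleGraph.Dart.symm_symm])⟩
    · simp
    · simp
    · intro e he
      simp only [Finset.mem_filter, Finset.mem_univ, true_and] at he
      rw [h.weight_mul_cavityVariation, he.1]
  have h2 : (Finset.univ.filter fun e : G.Dart => e.fst = d.fst ∧ e ≠ d) =
      (Finset.univ.filter fun e : G.Dart => e.fst = d.fst).erase d := by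
    ext e; simp [and_comm]
  have h3 := Finset.add_sum_erase (Finset.univ.filter fun e : G.Dart => e.fst = d.fst)
    (fun e => cavityVariation v c ξ e - ξ d.fst / v d.fst) (a := d) (by simp)
  rw [h1, h2, betheMatrix_mulVec, ← h3]
  have h4 : ∀ s : Finset G.Dart, ∑ e ∈ s, (ξ d.fst / v d.fst - cavityVariation v c ξ e) =
      - ∑ e ∈ s, (cavityVariation v c ξ e - ξ d.fst / v d.fst) := fun s => by
    rw [← Finset.sum_neg_distrib]; exact Finset.sum_congr rfl fun _ _ => by ring
  rw [h4]
  ring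

/-- If the linearized update does not have the eigenvalue `1`, then the Bethe matrix is positive
definite, or it has a nonnegative eigenvector with negative eigenvalue. -/
theorem posDef_or_exists_eigenvector (h : IsCovariance v c)
    (hnd : ∀ u : G.Dart → ℝ, (∀ d, c d / v d.snd * cavitySum u d = u d) → u = 0) :
    (betheMatrix v c).PosDef ∨ ∃ (x : V → ℝ) (r : ℝ), r < 0 ∧ 0 ≤ x ∧ x ≠ 0 ∧
      betheMatrix v c *ᵥ x = r • x := by
  refine or_iff_not_imp_left.2 fun hpd => ?_
  obtain ⟨x, r, hr, hx, hx0, hA⟩ :=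
    exists_nonneg_eigenvector_of_not_posDef h.isHermitian h.offDiag_nonpos hpd
  refine ⟨x, r, hr.lt_of_ne ?_, hx, hx0, hA⟩
  -- A kernel vector gives weighted cavity variations fixed by the linearized update. They vanish by
  -- `hnd`, then so do the cavity variations themselves, and finally `x`.
  rintro rfl
  rw [zero_smul] at hA
  refine hx0 (funext fun i => ?_)
  have hz : ∀ d, cavityVariation v c x d =
      cavitySum (fun e => c e / v e.snd * cavityVariation v c x e) d := fun d => by
    conv_lhs => rw [h.cavityVariation_eq, hA]
    simp
  have hu := hnd (fun e => c e / v e.snd * cavityVariation v c x e) fun d => by rw [← hz]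
  by_cases hi : ∃ d : G.Dart, d.fst = i
  · obtain ⟨d, rfl⟩ := hi
    have hz0 : ∀ d, cavityVariation v c x d = 0 := fun d => by rw [hz, hu]; simp [cavitySum]
    rw [h.eq_add_cavityVariation x d, hz0, hz0]; simp
  · have h1 := betheMatrix_mulVec_of_isolated v c x i (not_exists.1 hi)
    rw [hA] at h1
    exact (div_eq_zero_iff.1 h1.symm).resolve_right (h.pos i).ne'

/-- A nonnegative eigenvector of the Bethe matrix with negative eigenvalue gives messages that are
increased by the linearized update. -/
theorem exists_lt_update (h : IsCovariance v c) {x : V → ℝ} {r : ℝ} (hr : r < 0)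
    (hx : 0 ≤ x) (hx0 : x ≠ 0) (hA : betheMatrix v c *ᵥ x = r • x) :
    ∃ u : G.Dart → ℝ, 0 ≤ u ∧ u ≠ 0 ∧ ∀ d, 0 < u d → u d < c d / v d.snd * cavitySum u d := by
  have hw : ∀ d : G.Dart, 0 ≤ c d / v d.snd := fun d => div_nonneg (h.nonneg d) (h.pos _).le
  set y : G.Dart → ℝ := fun e => c e / v e.snd * cavityVariation v c x e with hy
  have hz : ∀ d, cavityVariation v c x d = r * x d.fst + cavitySum y d := fun d => by
    conv_lhs => rw [h.cavityVariation_eq, hA]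
    rfl
  have hle : ∀ d, cavitySum y d ≤ cavitySum (fun e => max (y e) 0) d := fun d =>
    Finset.sum_le_sum fun e _ => le_max_left _ _
  -- The witness is the positive part of `y`. Were it zero, every cavity variation would be
  -- nonpositive, forcing `x ≤ 0`.
  refine ⟨fun d => max (y d) 0, fun d => le_max_right _ _, fun h0 => ?_, fun d hd => ?_⟩
  · have hsum : ∀ d, cavitySum y d ≤ 0 := fun d => (hle d).trans (by simp [h0, cavitySum])
    have hzn : ∀ d, cavityVariation v c x d ≤ 0 := fun d => by
      rw [hz]; exact add_nonpos (mul_nonpos_of_nonpos_of_nonneg hr.le (hx _)) (hsum d)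
    refine hx0 (funext fun i => le_antisymm ?_ (hx i))
    by_cases hi : ∃ d : G.Dart, d.fst = i
    · obtain ⟨d, rfl⟩ := hi
      rw [h.eq_add_cavityVariation x d]
      have := mul_nonpos_of_nonneg_of_nonpos (h.pos d.fst).le (hzn d)
      have := mul_nonpos_of_nonneg_of_nonpos (h.nonneg d) (hzn d.symm)
      simp; linarith
    · have h1 := betheMatrix_mulVec_of_isolated v c x i (not_exists.1 hi)
      rw [hA] at h1
      have h2 : 0 ≤ x i / v i := div_nonneg (hx i) (h.pos i).le
      rw [← h1] at h2
      simp only [Pi.smul_apply, smul_eq_mul] at h2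
      simp; nlinarith
  -- Where `y d > 0` the cavity variation is positive, which needs `x d.fst > 0`. The source `r * x
  -- d.fst` is then strictly negative, so `y d` is strictly below the updated value.
  · have hyd : 0 < y d := by simpa using hd
    have hwd : 0 < c d / v d.snd := (hw d).lt_of_ne' fun h0 => by simp [hy, h0] at hyd
    have hzd : 0 < cavityVariation v c x d := (mul_pos_iff_of_pos_left hwd).1 hyd
    have hxd : 0 < x d.fst := by
      have h1 : 0 < v d.snd * x d.fst - c d * x d.snd :=
        (div_pos_iff_of_pos_right (h.dartDet_pos d)).1 hzd
      have h2 := mul_nonneg (h.nonneg d) (hx d.snd)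
      change 0 ≤ _ at h2
      exact (mul_pos_iff_of_pos_left (h.pos d.snd)).1 (by linarith)
    change max (y d) 0 < _
    rw [max_eq_left hyd.le]
    refine mul_lt_mul_of_pos_left ?_ hwd
    rw [hz]
    nlinarith [hle d]

/-- If the Bethe matrix is positive definite, then some positive messages are decreased by the
linearized update. -/
theorem exists_update_lt (h : IsCovariance v c) (hpd : (betheMatrix v c).PosDef) :
    ∃ u : G.Dart → ℝ, ∀ d, 0 < u d ∧ c d / v d.snd * cavitySum u d < u d := by
  have hw : ∀ d : G.Dart, 0 ≤ c d / v d.snd := fun d => div_nonneg (h.nonneg d) (h.pos _).le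
  -- The constant source `1` leaves a uniform margin in every linearized equation.
  obtain ⟨x, hA⟩ : ∃ x, betheMatrix v c *ᵥ x = 1 :=
    (Matrix.mulVec_surjective_iff_isUnit.2 hpd.isUnit) 1
  have hx : 0 ≤ x := nonneg_of_mulVec_nonneg hpd h.offDiag_nonpos (by
    rw [hA]; exact zero_le_one)
  set y : G.Dart → ℝ := fun e => c e / v e.snd * cavityVariation v c x e with hy
  have hz : ∀ d, cavityVariation v c x d = 1 + cavitySum y d := fun d => by
    conv_lhs => rw [h.cavityVariation_eq, hA]
    rfl
  -- Extremal argument: a negative cavity variation at `d` needs one at some incoming dart `e`,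
  -- since the source is positive. Negativity at `e` together with `c e ^ 2 < v e.fst * v e.snd`
  -- makes `x ^ 2 / v` strictly smaller at `e.fst` than at `e.snd = d.fst`, against minimality of
  -- `d`.
  have hnonneg : ∀ d, 0 ≤ cavityVariation v c x d := by
    by_contra! hneg
    obtain ⟨d, hd, hmin⟩ := Set.exists_min_image {d | cavityVariation v c x d < 0}
      (fun d => x d.fst ^ 2 / v d.fst) (Set.toFinite _) hneg
    have hex : ∃ e : G.Dart, (e.snd = d.fst ∧ e ≠ d.symm) ∧ y e < 0 := by
      by_contra! hall
      have h1 : 0 ≤ cavitySum y d := Finset.sum_nonneg fun e he =>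
        hall e (Finset.mem_filter.1 he).2
      have h2 := hz d
      have h3 : cavityVariation v c x d < 0 := hd
      linarith
    obtain ⟨e, ⟨hed, -⟩, hye⟩ := hex
    have hze : cavityVariation v c x e < 0 := by
      by_contra! h0
      exact hye.not_ge (mul_nonneg (hw e) h0)
    have h1 := hmin e hze
    rw [← hed] at h1
    have h2 : v e.snd * x e.fst - c e * x e.snd < 0 := by
      by_contra! h0
      exact hze.not_ge (div_nonneg h0 (h.dartDet_pos e).le)
    have h3 : (v e.snd * x e.fst) ^ 2 < (c e * x e.snd) ^ 2 :=
      pow_lt_pow_left₀ (by linarith) (mul_nonneg (h.pos _).le (hx _)) two_ne_zero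
    have h4 : (c e * x e.snd) ^ 2 ≤ v e.fst * v e.snd * x e.snd ^ 2 := by
      rw [mul_pow]; exact mul_le_mul_of_nonneg_right (h.lt e).le (sq_nonneg _)
    have h5 := h.pos e.fst
    have h6 := h.pos e.snd
    rw [div_le_div_iff₀ h6 h5] at h1
    have h7 : v e.snd * (v e.snd * x e.fst ^ 2) < v e.snd * (v e.fst * x e.snd ^ 2) := by
      calc _ = (v e.snd * x e.fst) ^ 2 := by ring
        _ < _ := h3.trans_le h4
        _ = _ := by ring
    have h8 := lt_of_mul_lt_mul_left h7 h6.le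
    linarith
  -- Adding `τ` to all messages makes them strictly positive and raises each cavity sum by at most
  -- `1`, the size of the source.
  set τ : ℝ := ((Fintype.card G.Dart : ℝ) + 1)⁻¹
  have hτ : 0 < τ := by positivity
  have hsum : ∀ d, cavitySum (fun e => y e + τ) d ≤ cavitySum y d + 1 := fun d => by
    simp only [cavitySum, Finset.sum_add_distrib, Finset.sum_const, nsmul_eq_mul]
    gcongr
    calc _ ≤ ((Fintype.card G.Dart : ℝ) + 1) * τ := by
          gcongr
          exact (Nat.cast_le.2 (Finset.card_le_univ _)).trans (by simp)
      _ = 1 := mul_inv_cancel₀ (by positivity)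
  refine ⟨fun e => y e + τ, fun d => ⟨?_, ?_⟩⟩
  · have := mul_nonneg (hw d) (hnonneg d)
    positivity
  · have h1 := mul_le_mul_of_nonneg_left (hsum d) (hw d)
    have h2 : c d / v d.snd * (cavitySum y d + 1) = y d := by simp only [hy]; rw [hz d, add_comm]
    rw [h2] at h1
    linarith

end IsCovariance

end BetheMatrix

/-! ### Stability of fixed points of monotone updates. -/

section Dynamics

variable {V : Type*} [Fintype V] [DecidableEq V] {G : SimpleGraph V} [DecidableRel G.Adj]

/-- The natural parameter, at the source of `d`, of the belief at the edge of `d`. -/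
def cavityParam (P : Potential G) (μ : G.Dart → ℝ) (d : G.Dart) : ℝ :=
  P.a d.symm + P.h d.fst + cavitySum μ d

theorem cavitySum_add (u u' : G.Dart → ℝ) (d : G.Dart) :
    cavitySum (fun e => u e + u' e) d = cavitySum u d + cavitySum u' d :=
  Finset.sum_add_distrib

theorem cavitySum_mul (s : ℝ) (u : G.Dart → ℝ) (d : G.Dart) :
    cavitySum (fun e => s * u e) d = s * cavitySum u d :=
  (Finset.mul_sum _ _ _).symm

theorem cavitySum_mono {u u' : G.Dart → ℝ} (h : ∀ e, u e ≤ u' e) (d : G.Dart) :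
    cavitySum u d ≤ cavitySum u' d :=
  Finset.sum_le_sum fun e _ => h e

theorem cavityParam_add_mul (P : Potential G) (μ u : G.Dart → ℝ) (s : ℝ) (d : G.Dart) :
    cavityParam P (fun e => μ e + s * u e) d = cavityParam P μ d + s * cavitySum u d := by
  rw [cavityParam, cavitySum_add, cavitySum_mul, cavityParam]; ring

theorem cavityParam_mono (P : Potential G) {μ μ' : G.Dart → ℝ} (h : ∀ e, μ e ≤ μ' e)
    (d : G.Dart) : cavityParam P μ d ≤ cavityParam P μ' d :=
  add_le_add_right (cavitySum_mono h d) _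

/-- The LBP update is `μ' d = a d + g d (θ d)`, where `θ` is the vector of cavity parameters, which
have to be in `D`, and the functions `g d` are monotone. -/
structure HasMonotoneUpdate (I : Family V) (P : Potential G) (D : Set ℝ)
    (g : G.Dart → ℝ → ℝ) : Prop where
  isOpen : IsOpen D
  ordConnected : D.OrdConnected
  isUpdate_iff : ∀ μ μ', IsUpdate I P μ μ' ↔
    ∀ d, cavityParam P μ d ∈ D ∧ μ' d = P.a d + g d (cavityParam P μ d)
  monotoneOn : ∀ d, MonotoneOn (g d) D

namespace HasMonotoneUpdate

variable {I : Family V} {P : Potential G} {D : Set ℝ} {g : G.Dart → ℝ → ℝ} {μ : G.Dart → ℝ}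
  {w : G.Dart → ℝ}

/-- Near `μ` all cavity parameters stay in the open set `D`. There an update exists and is unique,
so the default branch and the choice in `updateMap` play no role. -/
theorem hasFDerivAt_updateMap (h : HasMonotoneUpdate I P D g) (hμ : IsUpdate I P μ μ)
    (hw : ∀ d, HasDerivAt (g d) (w d) (cavityParam P μ d)) :
    HasFDerivAt (updateMap I P) (ContinuousLinearMap.pi fun d => w d •
      ∑ e : G.Dart with e.snd = d.fst ∧ e ≠ d.symm,
        ContinuousLinearMap.proj (R := ℝ) (φ := fun _ => ℝ) e) μ := by
  set S : G.Dart → (G.Dart → ℝ) →L[ℝ] ℝ := fun d =>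
    ∑ e : G.Dart with e.snd = d.fst ∧ e ≠ d.symm,
      ContinuousLinearMap.proj (R := ℝ) (φ := fun _ => ℝ) e
  have hS : ∀ d, (fun ν => cavityParam P ν d) =
      fun ν => P.a d.symm + P.h d.fst + S d ν := fun d => by
    funext ν
    simp [S, cavityParam, cavitySum]
  have hder : ∀ d, HasFDerivAt (fun ν => cavityParam P ν d) (S d) μ := fun d => by
    rw [hS]; exact (S d).hasFDerivAt.const_add _
  have hT : HasFDerivAt (fun ν d => P.a d + g d (cavityParam P ν d))
      (ContinuousLinearMap.pi fun d => w d • S d) μ := by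
    refine hasFDerivAt_pi.2 fun d => ?_
    exact ((hw d).comp_hasFDerivAt μ (hder d)).const_add _
  refine hT.congr_of_eventuallyEq ?_
  have hev : ∀ᶠ ν in 𝓝 μ, ∀ d, cavityParam P ν d ∈ D := eventually_all.2 fun d =>
    (hder d).continuousAt.eventually (h.isOpen.mem_nhds ((h.isUpdate_iff μ μ).1 hμ d).1)
  filter_upwards [hev] with ν hν
  have hex : ∃ ν', IsUpdate I P ν ν' :=
    ⟨fun d => P.a d + g d (cavityParam P ν d), (h.isUpdate_iff _ _).2 fun d => ⟨hν d, rfl⟩⟩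
  rw [updateMap, dif_pos hex]
  exact funext fun d => ((h.isUpdate_iff _ _).1 hex.choose_spec d).2

theorem eq_zero_of_isNondegenerate (h : HasMonotoneUpdate I P D g) (hμ : IsUpdate I P μ μ)
    (hw : ∀ d, HasDerivAt (g d) (w d) (cavityParam P μ d)) (hnd : IsNondegenerate I P μ)
    (u : G.Dart → ℝ) (hu : ∀ d, w d * cavitySum u d = u d) : u = 0 := by
  refine hnd u ?_
  rw [(h.hasFDerivAt_updateMap hμ hw).fderiv]
  funext d
  simpa [cavitySum] using hu d

/-- For small `s > 0` the point `μ + s u` lies below its update. By monotonicity a run started there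
stays above `μ + s u`, so it cannot converge to `μ`. -/
theorem not_isLocallyStable (h : HasMonotoneUpdate I P D g) (hμ : IsUpdate I P μ μ)
    (hw : ∀ d, HasDerivAt (g d) (w d) (cavityParam P μ d)) {u : G.Dart → ℝ} (hu : 0 ≤ u)
    (hu0 : u ≠ 0) (hlt : ∀ d, 0 < u d → u d < w d * cavitySum u d) :
    ¬ IsLocallyStable I P μ := by
  intro hst
  have hfix := (h.isUpdate_iff μ μ).1 hμ
  have hU : ∀ d, 0 ≤ cavitySum u d := fun d => Finset.sum_nonneg fun e _ => hu e
  have hD : ∀ d, ∀ᶠ s : ℝ in 𝓝[>] 0, cavityParam P μ d + s * cavitySum u d ∈ D := fun d => by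
    have hc : ContinuousAt (fun s : ℝ => cavityParam P μ d + s * cavitySum u d) 0 := by fun_prop
    refine nhdsWithin_le_nhds (hc.eventually (h.isOpen.mem_nhds ?_))
    simpa using (hfix d).1
  -- Where `u d > 0` the strict first-order inequality absorbs the error; where `u d = 0`
  -- monotonicity alone suffices.
  have hinc : ∀ d, ∀ᶠ s : ℝ in 𝓝[>] 0,
      μ d + s * u d ≤ P.a d + g d (cavityParam P μ d + s * cavitySum u d) := fun d => by
    rcases (hu d).lt_or_eq with hd | hd
    · have hder : HasDerivAt (fun s : ℝ => g d (cavityParam P μ d + s * cavitySum u d))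
          (w d * cavitySum u d) 0 := by
        have h1 : HasDerivAt (fun s : ℝ => cavityParam P μ d + s * cavitySum u d)
            (cavitySum u d) 0 := by
          simpa using ((hasDerivAt_id (0 : ℝ)).mul_const (cavitySum u d)).const_add
            (cavityParam P μ d)
        exact HasDerivAt.comp (0 : ℝ) (by simpa using hw d) h1
      have h2 := (hasDerivAt_iff_isLittleO_nhds_zero.1 hder).def (sub_pos.2 (hlt d hd))
      filter_upwards [nhdsWithin_le_nhds h2, self_mem_nhdsWithin] with s hs hs0
      have hs0 : 0 < s := hs0
      simp only [zero_add, zero_mul, add_zero, smul_eq_mul, Real.norm_eq_abs, abs_of_pos hs0] at hs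
      have h3 := (abs_le.1 hs).1
      have h4 := (hfix d).2
      nlinarith
    · filter_upwards [hD d, self_mem_nhdsWithin] with s hs hs0
      have hs0 : 0 < s := hs0
      have h1 := h.monotoneOn d (hfix d).1 hs (le_add_of_nonneg_right (mul_nonneg hs0.le (hU d)))
      rw [← hd, Pi.zero_apply, mul_zero, add_zero]
      linarith [(hfix d).2]
  have htend : Tendsto (fun (s : ℝ) (e : G.Dart) => μ e + s * u e) (𝓝[>] 0) (𝓝 μ) := by
    have hc : Continuous fun (s : ℝ) (e : G.Dart) => μ e + s * u e := by fun_prop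
    simpa using (hc.tendsto 0).mono_left nhdsWithin_le_nhds
  obtain ⟨s, ⟨run, hrun0, hrun, hlim⟩, hsD, hsinc, hs0⟩ := ((htend.eventually hst).and
    ((eventually_all.2 hD).and ((eventually_all.2 hinc).and self_mem_nhdsWithin))).exists
  have hs0 : 0 < s := hs0
  have hle : ∀ n d, μ d + s * u d ≤ run n d := by
    intro n
    induction n with
    | zero => intro d; rw [hrun0]
    | succ n ih =>
      intro d
      obtain ⟨hm, he⟩ := (h.isUpdate_iff _ _).1 (hrun n) d
      have h1 := cavityParam_mono P ih d
      rw [cavityParam_add_mul] at h1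
      rw [he]
      linarith [h.monotoneOn d (hsD d) hm h1, hsinc d]
  refine hu0 (funext fun d => le_antisymm ?_ (hu d))
  have h1 := ge_of_tendsto' (tendsto_pi_nhds.1 hlim d) fun n => hle n d
  simp only [Pi.zero_apply]
  nlinarith

/-- The vector `u` serves as the scale of a weighted sup norm: for small `s` the update maps the box
`|ν - μ| ≤ s u` into the box of size `ρ s`. By monotonicity only the two extreme corners have to be
checked. -/
theorem isLocallyStable (h : HasMonotoneUpdate I P D g) (hμ : IsUpdate I P μ μ)
    (hw : ∀ d, HasDerivAt (g d) (w d) (cavityParam P μ d)) (hw0 : ∀ d, 0 ≤ w d)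
    {u : G.Dart → ℝ} (hu : ∀ d, 0 < u d ∧ w d * cavitySum u d < u d) :
    IsLocallyStable I P μ := by
  have hfix := (h.isUpdate_iff μ μ).1 hμ
  have hU : ∀ d, 0 ≤ cavitySum u d := fun d => Finset.sum_nonneg fun e _ => (hu e).1.le
  obtain ⟨ρ, hρ, hρ0, hρ1⟩ : ∃ ρ : ℝ, (∀ d, w d * cavitySum u d < ρ * u d) ∧ 0 < ρ ∧ ρ < 1 := by
    have h1 : ∀ d, ∀ᶠ ρ : ℝ in 𝓝[<] 1, w d * cavitySum u d < ρ * u d := fun d => by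
      have hc : ContinuousAt (fun ρ : ℝ => ρ * u d) 1 := by fun_prop
      exact nhdsWithin_le_nhds (hc.eventually (lt_mem_nhds (by simpa using (hu d).2)))
    exact ((eventually_all.2 h1).and (Ioo_mem_nhdsLT one_pos)).exists
  have hD : ∀ d, ∀ᶠ s : ℝ in 𝓝 0, cavityParam P μ d + s * cavitySum u d ∈ D := fun d => by
    have hc : ContinuousAt (fun s : ℝ => cavityParam P μ d + s * cavitySum u d) 0 := by fun_prop
    exact hc.eventually (h.isOpen.mem_nhds (by simpa using (hfix d).1))
  have hg : ∀ d, ∀ᶠ s : ℝ in 𝓝 0, |g d (cavityParam P μ d + s * cavitySum u d) -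
      g d (cavityParam P μ d)| ≤ ρ * u d * |s| := fun d => by
    have hder : HasDerivAt (fun s : ℝ => g d (cavityParam P μ d + s * cavitySum u d))
        (w d * cavitySum u d) 0 := by
      have h1 : HasDerivAt (fun s : ℝ => cavityParam P μ d + s * cavitySum u d)
          (cavitySum u d) 0 := by
        simpa using ((hasDerivAt_id (0 : ℝ)).mul_const (cavitySum u d)).const_add
          (cavityParam P μ d)
      exact HasDerivAt.comp (0 : ℝ) (by simpa using hw d) h1
    filter_upwards [(hasDerivAt_iff_isLittleO_nhds_zero.1 hder).def (sub_pos.2 (hρ d))] with s hs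
    simp only [zero_add, zero_mul, add_zero, smul_eq_mul, Real.norm_eq_abs] at hs
    calc _ = |(g d (cavityParam P μ d + s * cavitySum u d) - g d (cavityParam P μ d) -
          s * (w d * cavitySum u d)) + s * (w d * cavitySum u d)| := by rw [sub_add_cancel]
      _ ≤ _ := abs_add_le _ _
      _ ≤ (ρ * u d - w d * cavitySum u d) * |s| + |s| * (w d * cavitySum u d) := by
        rw [abs_mul s, abs_of_nonneg (mul_nonneg (hw0 d) (hU d))]
        exact add_le_add_left hs _
      _ = _ := by ring
  obtain ⟨δ, hδ, hball⟩ := Metric.eventually_nhds_iff_ball.1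
    ((eventually_all.2 hD).and (eventually_all.2 hg))
  set T : (G.Dart → ℝ) → G.Dart → ℝ := fun ν d => P.a d + g d (cavityParam P ν d)
  have hstep : ∀ (ν : G.Dart → ℝ) (s : ℝ), 0 ≤ s → s < δ → (∀ d, |ν d - μ d| ≤ s * u d) →
      IsUpdate I P ν (T ν) ∧ ∀ d, |T ν d - μ d| ≤ ρ * s * u d := by
    intro ν s hs0 hsδ hν
    obtain ⟨hp, hp'⟩ := hball s (by simpa [abs_of_nonneg hs0] using hsδ)
    obtain ⟨hm, hm'⟩ := hball (-s) (by simpa [abs_of_nonneg hs0] using hsδ)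
    have hle : ∀ d, cavityParam P ν d ≤ cavityParam P μ d + s * cavitySum u d := fun d => by
      rw [← cavityParam_add_mul]
      exact cavityParam_mono P (fun e => by linarith [(abs_le.1 (hν e)).2]) d
    have hge : ∀ d, cavityParam P μ d + -s * cavitySum u d ≤ cavityParam P ν d := fun d => by
      rw [← cavityParam_add_mul]
      exact cavityParam_mono P (fun e => by linarith [(abs_le.1 (hν e)).1]) d
    -- Both corners have their parameters in `D`, and `D` is order connected.
    have hmem : ∀ d, cavityParam P ν d ∈ D := fun d => h.ordConnected.out (hm d) (hp d)
      ⟨hge d, hle d⟩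
    refine ⟨(h.isUpdate_iff _ _).2 fun d => ⟨hmem d, rfl⟩, fun d => ?_⟩
    have h1 := h.monotoneOn d (hmem d) (hp d) (hle d)
    have h2 := h.monotoneOn d (hm d) (hmem d) (hge d)
    have h3 := hp' d
    have h4 := hm' d
    rw [abs_neg, abs_of_nonneg hs0] at h4
    rw [abs_of_nonneg hs0] at h3
    have h5 := (abs_le.1 h3).2
    have h6 := (abs_le.1 h4).1
    have h7 := (hfix d).2
    simp only [T]
    rw [abs_le]
    constructor <;> linarith
  have hnear : ∀ᶠ ν in 𝓝 μ, ∀ d, |ν d - μ d| ≤ δ / 2 * u d := eventually_all.2 fun d => by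
    have hc : ContinuousAt (fun ν : G.Dart → ℝ => |ν d - μ d|) μ :=
      ((continuous_apply d).sub continuous_const).abs.continuousAt
    refine (hc.eventually (gt_mem_nhds ?_)).mono fun ν hν => le_of_lt hν
    simpa using mul_pos (half_pos hδ) (hu d).1
  filter_upwards [hnear] with ν hν
  have hinv : ∀ n d, |(T^[n] ν) d - μ d| ≤ ρ ^ n * (δ / 2) * u d := by
    intro n
    induction n with
    | zero => simpa using hν
    | succ n ih =>
      intro d
      have hsm : ρ ^ n * (δ / 2) < δ := by
        have := pow_le_one₀ (n := n) hρ0.le hρ1.le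
        nlinarith
      rw [Function.iterate_succ_apply', pow_succ']
      simpa [mul_assoc] using (hstep _ _ (by positivity) hsm ih).2 d
  refine ⟨fun n => T^[n] ν, rfl, fun n => ?_, ?_⟩
  · have hsm : ρ ^ n * (δ / 2) < δ := by
      have := pow_le_one₀ (n := n) hρ0.le hρ1.le
      nlinarith
    simp only [Function.iterate_succ_apply']
    exact (hstep _ _ (by positivity) hsm (hinv n)).1
  · refine tendsto_pi_nhds.2 fun d => ?_
    rw [tendsto_iff_norm_sub_tendsto_zero]
    refine squeeze_zero (fun n => norm_nonneg _) (fun n => hinv n d) ?_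
    have := ((tendsto_pow_atTop_nhds_zero_of_lt_one hρ0.le hρ1).mul_const (δ / 2)).mul_const (u d)
    simpa using this

end HasMonotoneUpdate

end Dynamics

/-! ### The second-order expansion of the Bethe free energy. -/

section BetheExpansion

open Matrix

variable {V : Type*} {G : SimpleGraph V}

theorem dartEdge_eq_iff (d : G.Dart) (e : G.edgeSet) :
    dartEdge d = e ↔ d = edgeDart e ∨ d = (edgeDart e).symm := by
  have h : (edgeDart e).edge = e.1 := Quot.out_eq e.1
  rw [← SimpleGraph.dart_edge_eq_iff, h, dartEdge, Subtype.ext_iff]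

variable [Fintype V] [DecidableEq V] [DecidableRel G.Adj]

theorem sum_edge_eq_sum_dart (f : G.Dart → ℝ) :
    ∑ e : G.edgeSet, (f (edgeDart e) + f (edgeDart e).symm) = ∑ d, f d := by
  rw [← Finset.sum_fiberwise Finset.univ dartEdge f]
  refine Finset.sum_congr rfl fun e _ => ?_
  have h : (Finset.univ.filter fun d => dartEdge d = e) = {edgeDart e, (edgeDart e).symm} := by
    ext d
    simp [dartEdge_eq_iff]
  rw [h, Finset.sum_pair (SimpleGraph.Dart.symm_ne _).symm]

/-- The natural parameter of the belief at a vertex. -/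
def beliefParam (P : Potential G) (μ : G.Dart → ℝ) (i : V) : ℝ :=
  P.h i + ∑ e : G.Dart with e.snd = i, μ e

/-- The cavity omits exactly one incoming message, that of `d.symm`. -/
theorem beliefParam_fst (P : Potential G) (μ : G.Dart → ℝ) (d : G.Dart) :
    beliefParam P μ d.fst = cavityParam P μ d - P.a d.symm + μ d.symm := by
  have h : (Finset.univ.filter fun e : G.Dart => e.snd = d.fst ∧ e ≠ d.symm) =
      (Finset.univ.filter fun e : G.Dart => e.snd = d.fst).erase d.symm := by
    ext e; simp [and_comm]
  have h1 := Finset.add_sum_erase (Finset.univ.filter fun e : G.Dart => e.snd = d.fst) μ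
    (a := d.symm) (by simp [SimpleGraph.Dart.symm])
  rw [beliefParam, cavityParam, cavitySum, h, ← h1]
  ring

theorem sum_dart_fst_eq (f : V → G.Dart → ℝ) :
    ∑ d : G.Dart, f d.fst d = ∑ i, ∑ d : G.Dart with d.fst = i, f i d := by
  rw [← Finset.sum_fiberwise Finset.univ (fun d : G.Dart => d.fst)]
  refine Finset.sum_congr rfl fun i _ => Finset.sum_congr rfl fun d hd => ?_
  rw [(Finset.mem_filter.1 hd).2]

theorem sum_const_dart_fst (i : V) (r : ℝ) :
    ∑ d : G.Dart with d.fst = i, r = G.degree i * r := by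
  rw [Finset.sum_const, SimpleGraph.dart_fst_fiber_card_eq_degree, nsmul_eq_mul]

/-- The differential of the Bethe free energy vanishes. -/
theorem sum_bethe_linear_eq_zero (P : Potential G) (μ : G.Dart → ℝ)
    (ξ : (V → ℝ) × (G.edgeSet → ℝ)) :
    - ∑ i, P.h i * ξ.1 i
      + - (∑ e, (P.J e * ξ.2 e + P.a (edgeDart e).symm * ξ.1 (edgeDart e).fst +
          P.a (edgeDart e) * ξ.1 (edgeDart e).snd))
      + ∑ e, (P.J e * ξ.2 e + cavityParam P μ (edgeDart e) * ξ.1 (edgeDart e).fst +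
          cavityParam P μ (edgeDart e).symm * ξ.1 (edgeDart e).snd)
      + ∑ i, (1 - (G.degree i : ℝ)) * (beliefParam P μ i * ξ.1 i) = 0 := by
  -- The pair terms cancel, and the two endpoint terms of an edge become one term for each of its
  -- darts.
  have h1 : ∑ e : G.edgeSet, (P.J e * ξ.2 e + cavityParam P μ (edgeDart e) * ξ.1 (edgeDart e).fst +
        cavityParam P μ (edgeDart e).symm * ξ.1 (edgeDart e).snd) -
      ∑ e, (P.J e * ξ.2 e + P.a (edgeDart e).symm * ξ.1 (edgeDart e).fst +
        P.a (edgeDart e) * ξ.1 (edgeDart e).snd) =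
      ∑ d : G.Dart, (beliefParam P μ d.fst - μ d.symm) * ξ.1 d.fst := by
    rw [← sum_edge_eq_sum_dart, ← Finset.sum_sub_distrib]
    refine Finset.sum_congr rfl fun e _ => ?_
    rw [beliefParam_fst, beliefParam_fst, SimpleGraph.Dart.symm_symm]
    change _ = _ + _ * ξ.1 (edgeDart e).snd
    ring
  -- The messages subtracted at `i` add up to `beliefParam P μ i - P.h i`, and the degree term is
  -- cancelled by the counting number `1 - degree`.
  have h2 : ∑ d : G.Dart, (beliefParam P μ d.fst - μ d.symm) * ξ.1 d.fst =
      ∑ i, (G.degree i * beliefParam P μ i - (beliefParam P μ i - P.h i)) * ξ.1 i := by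
    rw [sum_dart_fst_eq fun i d => (beliefParam P μ i - μ d.symm) * ξ.1 i]
    refine Finset.sum_congr rfl fun i _ => ?_
    rw [← Finset.sum_mul, Finset.sum_sub_distrib, sum_const_dart_fst]
    congr 2
    rw [beliefParam, add_sub_cancel_left]
    refine Finset.sum_bij' (fun d _ => d.symm) (fun d _ => d.symm) ?_ ?_ ?_ ?_ ?_ <;>
      simp +contextual [SimpleGraph.Dart.symm]
  rw [add_assoc (-∑ i, P.h i * ξ.1 i), neg_add_eq_sub (∑ e : G.edgeSet, _), h1, h2,
    ← Finset.sum_neg_distrib, ← Finset.sum_add_distrib, ← Finset.sum_add_distrib]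
  exact Finset.sum_eq_zero fun i _ => by ring

/-- The inverse of the covariance matrix of the statistics at the endpoints of `d`, as a quadratic
form. -/
noncomputable def edgeForm (v : V → ℝ) (c : G.Dart → ℝ) (d : G.Dart) (x y : ℝ) : ℝ :=
  (v d.snd * x ^ 2 - 2 * c d * x * y + v d.fst * y ^ 2) / dartDet v c d

/-- The edge form is the sum, over both darts of the edge, of the source value times the cavity
variation. -/
theorem dotProduct_betheMatrix_mulVec {v : V → ℝ} {c : G.Dart → ℝ} (h : IsCovariance v c)
    (ξ : V → ℝ) :
    ξ ⬝ᵥ (betheMatrix v c *ᵥ ξ) =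
      ∑ e : G.edgeSet, edgeForm v c (edgeDart e) (ξ (edgeDart e).fst) (ξ (edgeDart e).snd) +
        ∑ i, (1 - (G.degree i : ℝ)) * (ξ i ^ 2 / v i) := by
  have h1 : ∑ e : G.edgeSet, edgeForm v c (edgeDart e) (ξ (edgeDart e).fst) (ξ (edgeDart e).snd) =
      ∑ d : G.Dart, ξ d.fst * cavityVariation v c ξ d := by
    rw [← sum_edge_eq_sum_dart]
    refine Finset.sum_congr rfl fun e _ => ?_
    rw [cavityVariation, cavityVariation, h.dartDet_symm, h.symm]
    simp only [SimpleGraph.Dart.symm, Prod.fst_swap, Prod.snd_swap, edgeForm]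
    ring
  rw [h1, sum_dart_fst_eq fun i d => ξ i * cavityVariation v c ξ d, ← Finset.sum_add_distrib]
  refine Finset.sum_congr rfl fun i _ => ?_
  rw [betheMatrix_mulVec, Finset.sum_sub_distrib, sum_const_dart_fst, ← Finset.mul_sum]
  ring

/-- Second order expansions of the Legendre transforms at the beliefs of `μ`, with the vertex
variances `v` and the edge covariances `c`. -/
structure HasBetheExpansion (I : Family V) (P : Potential G) (μ : G.Dart → ℝ) (v : V → ℝ)
    (c : G.Dart → ℝ) : Prop where
  mem_nhds : pseudomarginals G I ∈ 𝓝 (beliefPoint I P μ)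
  vertex : ∀ i, HasQuadraticExpansion (I.vertexLegendre i) ((beliefPoint I P μ).1 i)
    (fun x => beliefParam P μ i * x) (fun x => x ^ 2 / v i / 2)
  edge : ∀ e : G.edgeSet, ∃ k A B : ℝ, 0 < k ∧
    HasQuadraticExpansion (I.edgeLegendre (edgeDart e).fst (edgeDart e).snd)
      ((beliefPoint I P μ).2 e, (beliefPoint I P μ).1 (edgeDart e).fst,
        (beliefPoint I P μ).1 (edgeDart e).snd)
      (fun x => P.J e * x.1 + cavityParam P μ (edgeDart e) * x.2.1 +
        cavityParam P μ (edgeDart e).symm * x.2.2)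
      (fun x => (edgeForm v c (edgeDart e) x.2.1 x.2.2 +
        k * (x.1 - A * x.2.1 - B * x.2.2) ^ 2) / 2)

/-- The second order term of the Bethe free energy. -/
noncomputable def betheForm (v : V → ℝ) (c : G.Dart → ℝ) (k A B : G.edgeSet → ℝ)
    (ξ : (V → ℝ) × (G.edgeSet → ℝ)) : ℝ :=
  (ξ.1 ⬝ᵥ (betheMatrix v c *ᵥ ξ.1) + ∑ e, k e * (ξ.2 e - A e * ξ.1 (edgeDart e).fst -
    B e * ξ.1 (edgeDart e).snd) ^ 2) / 2

theorem betheForm_smul (v : V → ℝ) (c : G.Dart → ℝ) (k A B : G.edgeSet → ℝ) (t : ℝ)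
    (ξ : (V → ℝ) × (G.edgeSet → ℝ)) :
    betheForm v c k A B (t • ξ) = t ^ 2 * betheForm v c k A B ξ := by
  simp only [betheForm, Prod.smul_fst, Prod.smul_snd, mulVec_smul, smul_dotProduct,
    dotProduct_smul, smul_eq_mul, Pi.smul_apply]
  rw [mul_div_assoc', mul_add, Finset.mul_sum]
  congr 2
  · ring
  · exact Finset.sum_congr rfl fun e _ => by ring

theorem continuous_betheForm (v : V → ℝ) (c : G.Dart → ℝ) (k A B : G.edgeSet → ℝ) :
    Continuous (betheForm v c k A B) := by
  unfold betheForm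
  simp only [dotProduct, mulVec]
  fun_prop

/-- If the vertex component vanishes, only the squares of the pair components are left. -/
theorem betheForm_pos {v : V → ℝ} {c : G.Dart → ℝ} (h : (betheMatrix v c).PosDef)
    {k : G.edgeSet → ℝ} (hk : ∀ e, 0 < k e) (A B : G.edgeSet → ℝ)
    {ξ : (V → ℝ) × (G.edgeSet → ℝ)} (hξ : ξ ≠ 0) : 0 < betheForm v c k A B ξ := by
  refine half_pos ?_
  rcases eq_or_ne ξ.1 0 with h0 | h0
  · have h2 : ξ.2 ≠ 0 := fun h2 => hξ (Prod.ext h0 h2)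
    obtain ⟨e, he⟩ := Function.ne_iff.1 h2
    simp only [h0, zero_dotProduct, zero_add, Pi.zero_apply, mul_zero, sub_zero]
    refine Finset.sum_pos' (fun e _ => mul_nonneg (hk e).le (sq_nonneg _))
      ⟨e, Finset.mem_univ e, mul_pos (hk e) (by simpa [sq_pos_iff] using he)⟩
  · have h1 := h.dotProduct_mulVec_pos h0
    rw [star_trivial] at h1
    exact add_pos_of_pos_of_nonneg h1
      (Finset.sum_nonneg fun e _ => mul_nonneg (hk e).le (sq_nonneg _))

namespace HasBetheExpansion

variable {I : Family V} {P : Potential G} {μ : G.Dart → ℝ} {v : V → ℝ} {c : G.Dart → ℝ}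

theorem hasQuadraticExpansion (h : HasBetheExpansion I P μ v c) (hcov : IsCovariance v c) :
    ∃ k A B : G.edgeSet → ℝ, (∀ e, 0 < k e) ∧
      HasQuadraticExpansion (bethe I P) (beliefPoint I P μ) (fun _ => 0)
        (betheForm v c k A B) := by
  choose k A B hk hedge using h.edge
  refine ⟨k, A, B, hk, ?_⟩
  have h1 : HasQuadraticExpansion
      (fun η : (V → ℝ) × (G.edgeSet → ℝ) => - ∑ i, P.h i * η.1 i) (beliefPoint I P μ)
      (fun ξ => - ∑ i, P.h i * ξ.1 i) (fun _ => 0) :=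
    .of_affine fun ξ => by simp only [Prod.fst_add, Pi.add_apply, mul_add,
      Finset.sum_add_distrib]; ring
  have h2 : HasQuadraticExpansion
      (fun η : (V → ℝ) × (G.edgeSet → ℝ) => - ∑ e, (P.J e * η.2 e +
        P.a (edgeDart e).symm * η.1 (edgeDart e).fst + P.a (edgeDart e) * η.1 (edgeDart e).snd))
      (beliefPoint I P μ)
      (fun ξ => - ∑ e, (P.J e * ξ.2 e + P.a (edgeDart e).symm * ξ.1 (edgeDart e).fst +
        P.a (edgeDart e) * ξ.1 (edgeDart e).snd)) (fun _ => 0) :=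
    .of_affine fun ξ => by simp only [Prod.fst_add, Prod.snd_add, Pi.add_apply, mul_add,
      Finset.sum_add_distrib]; ring
  have h3 := HasQuadraticExpansion.sum (s := Finset.univ) fun (e : G.edgeSet) _ =>
    HasQuadraticExpansion.comp (E := (V → ℝ) × (G.edgeSet → ℝ)) (x := beliefPoint I P μ)
      (((ContinuousLinearMap.proj (R := ℝ) (φ := fun _ => ℝ) e).comp
          (ContinuousLinearMap.snd ℝ _ _)).prod
        (((ContinuousLinearMap.proj (R := ℝ) (φ := fun _ => ℝ) (edgeDart e).fst).comp
          (ContinuousLinearMap.fst ℝ _ _)).prod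
        ((ContinuousLinearMap.proj (R := ℝ) (φ := fun _ => ℝ) (edgeDart e).snd).comp
          (ContinuousLinearMap.fst ℝ _ _)))) (hedge e)
  have h4 := HasQuadraticExpansion.sum (s := Finset.univ) fun (i : V) _ =>
    (HasQuadraticExpansion.comp (E := (V → ℝ) × (G.edgeSet → ℝ)) (x := beliefPoint I P μ)
      ((ContinuousLinearMap.proj (R := ℝ) (φ := fun _ => ℝ) i).comp
        (ContinuousLinearMap.fst ℝ _ _)) (h.vertex i)).const_mul (1 - (G.degree i : ℝ))
  -- The summed linear terms are exactly those that cancel at a fixed point.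
  refine ((((h1.add h2).add h3).add h4).congr_coeff (sum_bethe_linear_eq_zero P μ) fun ξ => ?_)
  rw [betheForm, dotProduct_betheMatrix_mulVec hcov]
  simp only [ContinuousLinearMap.prod_apply, ContinuousLinearMap.comp_apply,
    ContinuousLinearMap.proj_apply, ContinuousLinearMap.coe_fst', ContinuousLinearMap.coe_snd',
    add_zero, zero_add, ← Finset.sum_div, Finset.sum_add_distrib, mul_div_assoc']
  ring

/-- A nondegenerate fixed point is a local minimum of the Bethe free energy if it is locally stable,
and a saddle point otherwise. -/
theorem localMin_or_saddle {D : Set ℝ} {g : G.Dart → ℝ → ℝ}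
    (h : HasBetheExpansion I P μ v c) (hcov : IsCovariance v c)
    (hup : HasMonotoneUpdate I P D g)
    (hw : ∀ d, HasDerivAt (g d) (c d / v d.snd) (cavityParam P μ d)) (hμ : IsUpdate I P μ μ)
    (hnd : IsNondegenerate I P μ) :
    (IsLocallyStable I P μ → IsBetheLocalMin I P (beliefPoint I P μ)) ∧
      (¬ IsLocallyStable I P μ → IsBetheSaddle I P (beliefPoint I P μ)) := by
  obtain ⟨k, A, B, hk, hexp⟩ := h.hasQuadraticExpansion hcov
  have hmem := mem_of_mem_nhds h.mem_nhds
  have hw0 : ∀ d : G.Dart, 0 ≤ c d / v d.snd := fun d =>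
    div_nonneg (hcov.nonneg d) (hcov.pos _).le
  rcases hcov.posDef_or_exists_eigenvector (hup.eq_zero_of_isNondegenerate hμ hw hnd) with
    hpd | ⟨x, r, hr, hx, hx0, hA⟩
  · obtain ⟨u, hu⟩ := hcov.exists_update_lt hpd
    obtain ⟨C, hC, hle⟩ := exists_mul_norm_sq_le (continuous_betheForm v c k A B)
      (betheForm_smul v c k A B) fun ξ hξ => betheForm_pos hpd hk A B hξ
    exact ⟨fun _ => ⟨hmem, (hexp.isLocalMin hC hle).on _⟩,
      fun hst => absurd (hup.isLocallyStable hμ hw hw0 hu) hst⟩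
  · obtain ⟨u, hu, hu0, hlt⟩ := hcov.exists_lt_update hr hx hx0 hA
    have hst := hup.not_isLocallyStable hμ hw hu hu0 hlt
    refine ⟨fun hst' => absurd hst' hst, fun _ => ⟨hmem, ?_, fun hmin => ?_, fun hmax => ?_⟩⟩
    · obtain ⟨C, hC⟩ := exists_abs_le_mul_norm_sq (continuous_betheForm v c k A B)
        (betheForm_smul v c k A B)
      exact hexp.hasFDerivAt C hC
    -- The pair components minimize the form over the given vertex components: all squares vanish
    -- and `r * (x ⬝ᵥ x) / 2` is left.
    · refine hexp.not_isLocalMin (v := (x, fun e => A e * x (edgeDart e).fst +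
        B e * x (edgeDart e).snd)) ?_ (fun t => betheForm_smul v c k A B t _)
        (hmin.isLocalMin h.mem_nhds)
      have h1 : 0 < x ⬝ᵥ x := (Finset.sum_nonneg fun i _ => mul_self_nonneg (x i)).lt_of_ne'
        (dotProduct_self_eq_zero.not.2 hx0)
      simp only [betheForm, hA, dotProduct_smul, smul_eq_mul]
      have h2 := mul_neg_of_neg_of_pos hr h1
      have h3 : ∑ e, k e * (A e * x (edgeDart e).fst + B e * x (edgeDart e).snd -
          A e * x (edgeDart e).fst - B e * x (edgeDart e).snd) ^ 2 = 0 :=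
        Finset.sum_eq_zero fun e _ => by ring
      rw [h3]
      linarith
    -- A nonzero message vector guarantees an edge, so a direction along the pair variables is
    -- available and has positive curvature.
    · obtain ⟨d, -⟩ := Function.ne_iff.1 hu0
      refine hexp.not_isLocalMax (v := (0, fun _ => 1)) ?_ (fun t => betheForm_smul v c k A B t _)
        (hmax.isLocalMax h.mem_nhds)
      simp only [betheForm, zero_dotProduct, zero_add, Pi.zero_apply, mul_zero, sub_zero, one_pow,
        mul_one]
      exact half_pos (Finset.sum_pos (fun e _ => hk e) ⟨dartEdge d, Finset.mem_univ _⟩)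

end HasBetheExpansion

end BetheExpansion

/-! ### Gibbs' inequality and Legendre transforms. -/

section ExponentialFamily

/-- Gibbs' inequality. -/
theorem log_integral_exp_add_le {α : Type*} [MeasurableSpace α] {ρ : Measure α} [NeZero ρ]
    {f g : α → ℝ} (hf : Integrable (fun x => Real.exp (f x)) ρ)
    (hg : Integrable (fun x => Real.exp (g x)) ρ)
    (hfg : Integrable (fun x => (g x - f x) * Real.exp (f x)) ρ) :
    Real.log (∫ x, Real.exp (f x) ∂ρ) +
        (∫ x, (g x - f x) * Real.exp (f x) ∂ρ) / ∫ x, Real.exp (f x) ∂ρ ≤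
      Real.log (∫ x, Real.exp (g x) ∂ρ) := by
  have hZ := integral_exp_pos hf
  set m := (∫ x, (g x - f x) * Real.exp (f x) ∂ρ) / ∫ x, Real.exp (f x) ∂ρ with hm
  -- `m` is the mean of `g - f` under the normalized density `exp f`. In `1 + t ≤ exp t` with `t = g
  -- - f - m`, the linear term thus integrates to zero.
  have h1 : ∫ x, Real.exp m * ((g x - f x) * Real.exp (f x) + (1 - m) * Real.exp (f x)) ∂ρ =
      Real.exp m * ∫ x, Real.exp (f x) ∂ρ := by
    rw [integral_const_mul, integral_add hfg (hf.const_mul _), integral_const_mul]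
    congr 1
    rw [hm]
    field_simp
    ring
  have h2 : Real.exp m * ∫ x, Real.exp (f x) ∂ρ ≤ ∫ x, Real.exp (g x) ∂ρ := by
    rw [← h1]
    refine integral_mono ((hfg.add (hf.const_mul _)).const_mul _) hg fun x => ?_
    have h3 := Real.add_one_le_exp (g x - f x - m)
    calc Real.exp m * ((g x - f x) * Real.exp (f x) + (1 - m) * Real.exp (f x))
        = Real.exp m * Real.exp (f x) * (g x - f x - m + 1) := by ring
      _ ≤ Real.exp m * Real.exp (f x) * Real.exp (g x - f x - m) := by gcongr
      _ = Real.exp (g x) := by rw [← Real.exp_add, ← Real.exp_add]; ring_nf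
  calc _ = Real.log (Real.exp m * ∫ x, Real.exp (f x) ∂ρ) := by
        rw [Real.log_mul (Real.exp_pos m).ne' hZ.ne', Real.log_exp, add_comm]
    _ ≤ _ := Real.log_le_log (by positivity) h2

namespace Family

variable {V : Type*} {I : Family V} {i j : V}

theorem integrable_of_mem_vertexParam {θ : ℝ} (hθ : θ ∈ I.vertexParam i) :
    Integrable (fun x => Real.exp (θ * I.φ i x)) I.ν := by
  unfold vertexParam at hθ
  have h := interior_subset hθ
  exact h

theorem integrable_of_mem_edgeParam {θ : ℝ × ℝ × ℝ} (hθ : θ ∈ I.edgeParam i j) :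
    Integrable (I.edgeDensity i j θ) (I.ν.prod I.ν) := by
  unfold edgeParam at hθ
  have h := interior_subset hθ
  exact h

/-- Gibbs' inequality says that the log-partition function lies above its tangent at `θ`, so the
supremum is attained there. -/
theorem vertexLegendre_vertexMean [NeZero I.ν] {θ : ℝ} (hθ : θ ∈ I.vertexParam i)
    (hint : Integrable (fun x => I.φ i x * Real.exp (θ * I.φ i x)) I.ν) :
    I.vertexLegendre i (I.vertexMean i θ) = θ * I.vertexMean i θ - I.vertexLogPart i θ := by
  refine IsGreatest.csSup_eq ⟨⟨θ, hθ, rfl⟩, ?_⟩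
  rintro _ ⟨θ', hθ', rfl⟩
  have h0 : Integrable (fun x => (θ' * I.φ i x - θ * I.φ i x) * Real.exp (θ * I.φ i x)) I.ν :=
    (hint.const_mul (θ' - θ)).congr (.of_forall fun x => by ring)
  have h := log_integral_exp_add_le (integrable_of_mem_vertexParam hθ)
    (integrable_of_mem_vertexParam hθ') h0
  have h1 : ∫ x, (θ' * I.φ i x - θ * I.φ i x) * Real.exp (θ * I.φ i x) ∂I.ν =
      (θ' - θ) * ∫ x, I.φ i x * Real.exp (θ * I.φ i x) ∂I.ν := by
    rw [← integral_const_mul]; exact integral_congr_ae (.of_forall fun x => by ring)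
  rw [h1, mul_div_assoc] at h
  change _ + _ * I.vertexMean i θ ≤ _ at h
  simp only [vertexLogPart]
  linarith

theorem edgeLegendre_edgeMean [NeZero (I.ν.prod I.ν)] {θ : ℝ × ℝ × ℝ} (hθ : θ ∈ I.edgeParam i j)
    (h1 : Integrable (fun p => I.ψ i j p.1 p.2 * I.edgeDensity i j θ p) (I.ν.prod I.ν))
    (h2 : Integrable (fun p => I.φ i p.1 * I.edgeDensity i j θ p) (I.ν.prod I.ν))
    (h3 : Integrable (fun p => I.φ j p.2 * I.edgeDensity i j θ p) (I.ν.prod I.ν)) :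
    I.edgeLegendre i j (I.edgeMean i j θ) = θ.1 * (I.edgeMean i j θ).1 +
      θ.2.1 * (I.edgeMean i j θ).2.1 + θ.2.2 * (I.edgeMean i j θ).2.2 - I.edgeLogPart i j θ := by
  refine IsGreatest.csSup_eq ⟨⟨θ, hθ, rfl⟩, ?_⟩
  rintro _ ⟨θ', hθ', rfl⟩
  have h12 : Integrable (fun p => (θ'.1 - θ.1) * (I.ψ i j p.1 p.2 * I.edgeDensity i j θ p) +
      (θ'.2.1 - θ.2.1) * (I.φ i p.1 * I.edgeDensity i j θ p)) (I.ν.prod I.ν) :=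
    (h1.const_mul _).add (h2.const_mul _)
  have heq : ∀ p : ℝ × ℝ, (θ'.1 - θ.1) * (I.ψ i j p.1 p.2 * I.edgeDensity i j θ p) +
      (θ'.2.1 - θ.2.1) * (I.φ i p.1 * I.edgeDensity i j θ p) +
      (θ'.2.2 - θ.2.2) * (I.φ j p.2 * I.edgeDensity i j θ p) =
      ((θ'.1 * I.ψ i j p.1 p.2 + θ'.2.1 * I.φ i p.1 + θ'.2.2 * I.φ j p.2) -
        (θ.1 * I.ψ i j p.1 p.2 + θ.2.1 * I.φ i p.1 + θ.2.2 * I.φ j p.2)) *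
          I.edgeDensity i j θ p := fun p => by ring
  have h := log_integral_exp_add_le (integrable_of_mem_edgeParam hθ)
    (integrable_of_mem_edgeParam hθ')
    ((h12.add (h3.const_mul (θ'.2.2 - θ.2.2))).congr (.of_forall heq))
  have heq' := integral_congr_ae (μ := I.ν.prod I.ν) (.of_forall heq)
  rw [integral_add h12 (h3.const_mul _), integral_add (h1.const_mul _) (h2.const_mul _),
    integral_const_mul, integral_const_mul, integral_const_mul] at heq'
  simp only [edgeDensity] at heq'
  rw [← heq'] at h
  simp only [edgeLogPart, edgeMean, edgeDensity]
  rw [add_div, add_div, mul_div_assoc, mul_div_assoc, mul_div_assoc] at h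
  linarith

end Family

end ExponentialFamily

/-! ### Beliefs and updates in natural parameters. -/

section Beliefs

variable {V : Type*} [Fintype V] [DecidableEq V] {G : SimpleGraph V} [DecidableRel G.Adj]
  {I : Family V} {P : Potential G} {μ μ' : G.Dart → ℝ}

theorem cavity_eq_exp (d : G.Dart) (x : ℝ) :
    cavity I P μ d x = Real.exp ((P.h d.fst + cavitySum μ d) * I.φ d.fst x) := by
  rw [cavity, vertexFactor, add_mul, Real.exp_add, cavitySum, Finset.sum_mul, Real.exp_sum]
  congr 1
  refine Finset.prod_congr rfl fun e he => ?_
  rw [message, (Finset.mem_filter.1 he).2.1]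

theorem vertexBelief_eq_exp (i : V) (x : ℝ) :
    vertexBelief I P μ i x = Real.exp (beliefParam P μ i * I.φ i x) := by
  rw [vertexBelief, vertexFactor, beliefParam, add_mul, Real.exp_add, Finset.sum_mul, Real.exp_sum]
  congr 1
  refine Finset.prod_congr rfl fun e he => ?_
  rw [message, (Finset.mem_filter.1 he).2]

/-- The natural parameter of the belief at the edge of `d`. -/
def edgeBeliefParam (P : Potential G) (μ : G.Dart → ℝ) (d : G.Dart) : ℝ × ℝ × ℝ :=
  (P.J (dartEdge d), cavityParam P μ d, cavityParam P μ d.symm)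

theorem edgeBelief_eq (d : G.Dart) :
    edgeBelief I P μ d = I.edgeDensity d.fst d.snd (edgeBeliefParam P μ d) := by
  funext p
  rw [edgeBelief, cavity_eq_exp, cavity_eq_exp, edgeFactor, Family.edgeDensity, ← Real.exp_add,
    ← Real.exp_add, edgeBeliefParam, cavityParam, cavityParam, SimpleGraph.Dart.symm_symm]
  simp only [SimpleGraph.Dart.symm, Prod.fst_swap]
  ring_nf

theorem isUpdate_iff_integral : IsUpdate I P μ μ' ↔ ∀ d : G.Dart, ∃ ω : ℝ, 0 < ω ∧ ∀ᵐ y ∂I.ν,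
    Real.exp (μ' d * I.φ d.snd y) = ω * (Real.exp (P.a d * I.φ d.snd y) *
      ∫ x, Real.exp (P.J (dartEdge d) * I.ψ d.fst d.snd x y +
        cavityParam P μ d * I.φ d.fst x) ∂I.ν) := by
  refine forall_congr' fun d => exists_congr fun ω => and_congr_right fun _ => ?_
  refine eventually_congr (.of_forall fun y => ?_)
  rw [message, ← integral_const_mul (Real.exp _)]
  refine Eq.congr rfl (congrArg (ω * ·) (integral_congr_ae (.of_forall fun x => ?_)))
  simp only
  rw [edgeFactor, cavity_eq_exp, ← Real.exp_add, ← Real.exp_add, cavityParam]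
  ring_nf

theorem beliefPoint_fst (i : V) :
    (beliefPoint I P μ).1 i = I.vertexMean i (beliefParam P μ i) := by
  simp only [beliefPoint, vertexBelief_eq_exp, Family.vertexMean]

theorem beliefPoint_snd (e : G.edgeSet) :
    (beliefPoint I P μ).2 e = (I.edgeMean (edgeDart e).fst (edgeDart e).snd
      (edgeBeliefParam P μ (edgeDart e))).1 := by
  simp only [beliefPoint, edgeBelief_eq, Family.edgeMean]

/-- Expansions at all vertices and edges give the expansion of the Bethe free energy, if the means
of the edge beliefs are those of the vertex beliefs. -/
theorem HasBetheExpansion.of_local {v : V → ℝ} {c : G.Dart → ℝ}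
    (hcons : ∀ d : G.Dart, (I.edgeMean d.fst d.snd (edgeBeliefParam P μ d)).2 =
      (I.vertexMean d.fst (beliefParam P μ d.fst), I.vertexMean d.snd (beliefParam P μ d.snd)))
    (hvd : ∀ i, I.vertexDual i ∈ 𝓝 (I.vertexMean i (beliefParam P μ i)))
    (hed : ∀ d : G.Dart, I.edgeDual d.fst d.snd ∈
      𝓝 (I.edgeMean d.fst d.snd (edgeBeliefParam P μ d)))
    (hv : ∀ i, HasQuadraticExpansion (I.vertexLegendre i) (I.vertexMean i (beliefParam P μ i))
      (fun x => beliefParam P μ i * x) (fun x => x ^ 2 / v i / 2))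
    (he : ∀ d : G.Dart, ∃ k A B : ℝ, 0 < k ∧ HasQuadraticExpansion (I.edgeLegendre d.fst d.snd)
      (I.edgeMean d.fst d.snd (edgeBeliefParam P μ d))
      (fun x => (edgeBeliefParam P μ d).1 * x.1 + (edgeBeliefParam P μ d).2.1 * x.2.1 +
        (edgeBeliefParam P μ d).2.2 * x.2.2)
      (fun x => (edgeForm v c d x.2.1 x.2.2 + k * (x.1 - A * x.2.1 - B * x.2.2) ^ 2) / 2)) :
    HasBetheExpansion I P μ v c := by
  have hpt : ∀ e : G.edgeSet, ((beliefPoint I P μ).2 e, (beliefPoint I P μ).1 (edgeDart e).fst,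
      (beliefPoint I P μ).1 (edgeDart e).snd) = I.edgeMean (edgeDart e).fst (edgeDart e).snd
        (edgeBeliefParam P μ (edgeDart e)) := fun e => by
    rw [beliefPoint_snd, beliefPoint_fst, beliefPoint_fst, ← hcons]
  refine ⟨?_, fun i => ?_, fun e => ?_⟩
  · have h1 : ∀ i, ∀ᶠ η in 𝓝 (beliefPoint I P μ), η.1 i ∈ I.vertexDual i := fun i => by
      have hc : ContinuousAt (fun η : (V → ℝ) × (G.edgeSet → ℝ) => η.1 i) (beliefPoint I P μ) := by
        fun_prop
      refine hc.eventually ?_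
      simp only [beliefPoint_fst]
      exact hvd i
    have h2 : ∀ e : G.edgeSet, ∀ᶠ η in 𝓝 (beliefPoint I P μ),
        (η.2 e, η.1 (edgeDart e).fst, η.1 (edgeDart e).snd) ∈
          I.edgeDual (edgeDart e).fst (edgeDart e).snd := fun e => by
      have hc : ContinuousAt (fun η : (V → ℝ) × (G.edgeSet → ℝ) =>
          (η.2 e, η.1 (edgeDart e).fst, η.1 (edgeDart e).snd)) (beliefPoint I P μ) := by
        fun_prop
      refine hc.eventually ?_
      simp only [hpt]
      exact hed _
    exact (eventually_all.2 h1).and (eventually_all.2 h2)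
  · rw [beliefPoint_fst]
    exact hv i
  · rw [hpt]
    obtain ⟨k, A, B, hk, h⟩ := he (edgeDart e)
    have hJ : (edgeBeliefParam P μ (edgeDart e)).1 = P.J e :=
      congrArg P.J ((dartEdge_eq_iff _ _).2 (Or.inl rfl))
    refine ⟨k, A, B, hk, h.congr_coeff (fun x => ?_) fun _ => rfl⟩
    rw [hJ]
    rfl

end Beliefs

/-! ### The binary family: means, entropies and messages. -/

section Binary

variable {V : Type*} {i j : V}

theorem ae_binary_iff {p : ℝ → Prop} : (∀ᵐ x ∂(binary V).ν, p x) ↔ p 1 ∧ p (-1) := by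
  simp only [binary, ae_add_measure_iff, ae_dirac_eq, eventually_pure]

theorem integrable_binary (f : ℝ → ℝ) : Integrable f (binary V).ν :=
  (integrable_dirac (by simp)).add_measure (integrable_dirac (by simp))

theorem integral_binary (f : ℝ → ℝ) : ∫ x, f x ∂(binary V).ν = f 1 + f (-1) := by
  unfold binary
  simp only
  rw [integral_add_measure (integrable_dirac (by simp)) (integrable_dirac (by simp)),
    integral_dirac, integral_dirac]

theorem binary_prod : (binary V).ν.prod (binary V).ν =
    (Measure.dirac ((1 : ℝ), (1 : ℝ)) + Measure.dirac (1, -1)) +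
      (Measure.dirac (-1, 1) + Measure.dirac (-1, -1)) := by
  simp only [binary, Measure.add_prod, Measure.prod_add, Measure.dirac_prod_dirac]
  abel

theorem integrable_binary_prod (f : ℝ × ℝ → ℝ) :
    Integrable f ((binary V).ν.prod (binary V).ν) := by
  rw [binary_prod]
  exact ((integrable_dirac (by simp)).add_measure (integrable_dirac (by simp))).add_measure
    ((integrable_dirac (by simp)).add_measure (integrable_dirac (by simp)))

theorem integral_binary_prod (f : ℝ × ℝ → ℝ) : ∫ p, f p ∂((binary V).ν.prod (binary V).ν) =
    f (1, 1) + f (1, -1) + f (-1, 1) + f (-1, -1) := by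
  have h : ∀ p : ℝ × ℝ, Integrable f (Measure.dirac p) := fun p => integrable_dirac (by simp)
  rw [binary_prod, integral_add_measure ((h _).add_measure (h _)) ((h _).add_measure (h _)),
    integral_add_measure (h _) (h _), integral_add_measure (h _) (h _), integral_dirac,
    integral_dirac, integral_dirac, integral_dirac]
  ring

instance : NeZero (binary V).ν := ⟨fun h => by
  have := integral_binary (V := V) fun _ => 1
  rw [h] at this
  norm_num at this⟩

instance : NeZero ((binary V).ν.prod (binary V).ν) := ⟨fun h => by
  have := integral_binary_prod (V := V) fun _ => 1
  rw [h] at this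
  norm_num at this⟩

theorem binary_vertexParam : (binary V).vertexParam i = univ := by
  simp [Family.vertexParam, integrable_binary]

theorem binary_edgeParam : (binary V).edgeParam i j = univ := by
  simp [Family.edgeParam, integrable_binary_prod]

theorem binary_vertexMean (θ : ℝ) : (binary V).vertexMean i θ =
    (Real.exp θ - Real.exp (-θ)) / (Real.exp θ + Real.exp (-θ)) := by
  rw [Family.vertexMean, integral_binary, integral_binary]
  simp [binary, sub_eq_add_neg]

theorem binary_vertexLogPart (θ : ℝ) : (binary V).vertexLogPart i θ =
    Real.log (Real.exp θ + Real.exp (-θ)) := by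
  rw [Family.vertexLogPart, integral_binary]
  simp [binary]

/-- The weight `exp (θ₀ s t + θ₁ s + θ₂ t)` of the state `(s, t)`. -/
noncomputable def binaryWeight (θ : ℝ × ℝ × ℝ) (s t : ℝ) : ℝ :=
  Real.exp (θ.1 * (s * t) + θ.2.1 * s + θ.2.2 * t)

/-- The sum of the weights of all states. -/
noncomputable def binaryPartition (θ : ℝ × ℝ × ℝ) : ℝ :=
  binaryWeight θ 1 1 + binaryWeight θ 1 (-1) + binaryWeight θ (-1) 1 + binaryWeight θ (-1) (-1)

theorem binaryWeight_pos (θ : ℝ × ℝ × ℝ) (s t : ℝ) : 0 < binaryWeight θ s t := Real.exp_pos _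

theorem binaryPartition_pos (θ : ℝ × ℝ × ℝ) : 0 < binaryPartition θ := by
  have := binaryWeight_pos θ
  unfold binaryPartition
  linarith [this 1 1, this 1 (-1), this (-1) 1, this (-1) (-1)]

theorem binary_edgeDensity (θ : ℝ × ℝ × ℝ) (p : ℝ × ℝ) :
    (binary V).edgeDensity i j θ p = binaryWeight θ p.1 p.2 := rfl

theorem binary_edgeLogPart (θ : ℝ × ℝ × ℝ) :
    (binary V).edgeLogPart i j θ = Real.log (binaryPartition θ) := by
  rw [Family.edgeLogPart, integral_binary_prod]
  rfl

theorem binary_edgeMean (θ : ℝ × ℝ × ℝ) : (binary V).edgeMean i j θ =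
    ((binaryWeight θ 1 1 - binaryWeight θ 1 (-1) - binaryWeight θ (-1) 1 +
        binaryWeight θ (-1) (-1)) / binaryPartition θ,
      (binaryWeight θ 1 1 + binaryWeight θ 1 (-1) - binaryWeight θ (-1) 1 -
        binaryWeight θ (-1) (-1)) / binaryPartition θ,
      (binaryWeight θ 1 1 - binaryWeight θ 1 (-1) + binaryWeight θ (-1) 1 -
        binaryWeight θ (-1) (-1)) / binaryPartition θ) := by
  simp only [Family.edgeMean, integral_binary_prod, binary_edgeDensity, binaryPartition]
  simp only [binary]
  refine Prod.ext ?_ (Prod.ext ?_ ?_) <;> simp only <;> congr 1 <;> ring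

/-- The probability of the state `(s, t)`, where `s, t = ±1`, as a function of the expectation
parameters. -/
noncomputable def binaryProb (s t : ℝ) (η : ℝ × ℝ × ℝ) : ℝ :=
  (1 + s * t * η.1 + s * η.2.1 + t * η.2.2) / 4

theorem continuous_binaryProb (s t : ℝ) : Continuous (binaryProb s t) := by
  unfold binaryProb; fun_prop

theorem binaryProb_edgeMean {s t : ℝ} (hs : s = 1 ∨ s = -1) (ht : t = 1 ∨ t = -1)
    (θ : ℝ × ℝ × ℝ) :
    binaryProb s t ((binary V).edgeMean i j θ) = binaryWeight θ s t / binaryPartition θ := by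
  have h := (binaryPartition_pos θ).ne'
  rw [binary_edgeMean]
  rcases hs with rfl | rfl <;> rcases ht with rfl | rfl <;> simp only [binaryProb] <;>
    field_simp <;> simp only [binaryPartition] <;> ring

/-- The logarithms of four positive probabilities are expanded in the characters `1, s, t, st`. The
last three coefficients form `θ`; the constant one only normalizes and becomes `r`. -/
theorem mem_binary_edgeDual {η : ℝ × ℝ × ℝ} (h1 : 0 < binaryProb 1 1 η)
    (h2 : 0 < binaryProb 1 (-1) η) (h3 : 0 < binaryProb (-1) 1 η)
    (h4 : 0 < binaryProb (-1) (-1) η) : η ∈ (binary V).edgeDual i j := by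
  set a := Real.log (binaryProb 1 1 η) with ha
  set b := Real.log (binaryProb 1 (-1) η) with hb
  set c := Real.log (binaryProb (-1) 1 η) with hc
  set d := Real.log (binaryProb (-1) (-1) η) with hd
  set θ : ℝ × ℝ × ℝ := ((a - b - c + d) / 4, (a + b - c - d) / 4, (a - b + c - d) / 4) with hθ
  set r := Real.exp (-(a + b + c + d) / 4)
  have hr : 0 < r := Real.exp_pos _
  have w1 : binaryWeight θ 1 1 = binaryProb 1 1 η * r := by
    rw [← Real.exp_log h1, ← ha, binaryWeight, ← Real.exp_add]; congr 1; simp only [hθ]; ring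
  have w2 : binaryWeight θ 1 (-1) = binaryProb 1 (-1) η * r := by
    rw [← Real.exp_log h2, ← hb, binaryWeight, ← Real.exp_add]; congr 1; simp only [hθ]; ring
  have w3 : binaryWeight θ (-1) 1 = binaryProb (-1) 1 η * r := by
    rw [← Real.exp_log h3, ← hc, binaryWeight, ← Real.exp_add]; congr 1; simp only [hθ]; ring
  have w4 : binaryWeight θ (-1) (-1) = binaryProb (-1) (-1) η * r := by
    rw [← Real.exp_log h4, ← hd, binaryWeight, ← Real.exp_add]; congr 1; simp only [hθ]; ring
  have hZ : binaryPartition θ = r := by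
    rw [binaryPartition, w1, w2, w3, w4]; simp only [binaryProb]; ring
  refine ⟨θ, by rw [binary_edgeParam]; trivial, ?_⟩
  rw [binary_edgeMean, w1, w2, w3, w4, hZ]
  refine Prod.ext ?_ (Prod.ext ?_ ?_) <;> simp only [binaryProb] <;> field_simp <;> ring

theorem binary_edgeDual_mem_nhds (θ : ℝ × ℝ × ℝ) :
    (binary V).edgeDual i j ∈ 𝓝 ((binary V).edgeMean i j θ) := by
  have h : ∀ s t : ℝ, s = 1 ∨ s = -1 → t = 1 ∨ t = -1 →
      ∀ᶠ η in 𝓝 ((binary V).edgeMean i j θ), 0 < binaryProb s t η := fun s t hs ht => by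
    refine (continuous_binaryProb s t).continuousAt.eventually (lt_mem_nhds ?_)
    rw [binaryProb_edgeMean hs ht]
    exact div_pos (binaryWeight_pos _ _ _) (binaryPartition_pos θ)
  filter_upwards [h 1 1 (by simp) (by simp), h 1 (-1) (by simp) (by simp),
    h (-1) 1 (by simp) (by simp), h (-1) (-1) (by simp) (by simp)] with η h1 h2 h3 h4
  exact mem_binary_edgeDual h1 h2 h3 h4

/-- `p log p` for the probability `p` of the state `(s, t)`. -/
noncomputable def binaryEntropyTerm (s t : ℝ) (η : ℝ × ℝ × ℝ) : ℝ :=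
  binaryProb s t η * Real.log (binaryProb s t η)

theorem log_binaryProb_edgeMean {s t : ℝ} (hs : s = 1 ∨ s = -1) (ht : t = 1 ∨ t = -1)
    (θ : ℝ × ℝ × ℝ) : Real.log (binaryProb s t ((binary V).edgeMean i j θ)) =
      θ.1 * (s * t) + θ.2.1 * s + θ.2.2 * t - Real.log (binaryPartition θ) := by
  rw [binaryProb_edgeMean hs ht, Real.log_div (binaryWeight_pos _ _ _).ne'
    (binaryPartition_pos θ).ne', binaryWeight, Real.log_exp]

/-- The log-probability of a state is affine in the statistics, so its mean is `⟨θ, η⟩` minus the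
log-partition function. -/
theorem binary_edgeLegendre {η : ℝ × ℝ × ℝ} (hη : η ∈ (binary V).edgeDual i j) :
    (binary V).edgeLegendre i j η = binaryEntropyTerm 1 1 η + binaryEntropyTerm 1 (-1) η +
      binaryEntropyTerm (-1) 1 η + binaryEntropyTerm (-1) (-1) η := by
  obtain ⟨θ, hθ, rfl⟩ := hη
  rw [Family.edgeLegendre_edgeMean hθ (integrable_binary_prod _) (integrable_binary_prod _)
    (integrable_binary_prod _), binary_edgeLogPart]
  simp only [binaryEntropyTerm]
  rw [log_binaryProb_edgeMean (by simp) (by simp), log_binaryProb_edgeMean (by simp) (by simp),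
    log_binaryProb_edgeMean (by simp) (by simp), log_binaryProb_edgeMean (by simp) (by simp)]
  simp only [binaryProb]
  ring

theorem hasQuadraticExpansion_binaryEntropyTerm {s t : ℝ} {η : ℝ × ℝ × ℝ}
    (h : 0 < binaryProb s t η) : HasQuadraticExpansion (binaryEntropyTerm s t) η
      (fun x => (Real.log (binaryProb s t η) + 1) * ((s * t * x.1 + s * x.2.1 + t * x.2.2) / 4))
      (fun x => (binaryProb s t η)⁻¹ / 2 * ((s * t * x.1 + s * x.2.1 + t * x.2.2) / 4) ^ 2) := by
  set A : ℝ × ℝ × ℝ →L[ℝ] ℝ := (4⁻¹ : ℝ) • ((s * t) • ContinuousLinearMap.fst ℝ ℝ (ℝ × ℝ) +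
    s • (ContinuousLinearMap.fst ℝ ℝ ℝ).comp (ContinuousLinearMap.snd ℝ ℝ (ℝ × ℝ)) +
    t • (ContinuousLinearMap.snd ℝ ℝ ℝ).comp (ContinuousLinearMap.snd ℝ ℝ (ℝ × ℝ))) with hA
  have hAx : ∀ x, A x = (s * t * x.1 + s * x.2.1 + t * x.2.2) / 4 := fun x => by
    simp [hA]; ring
  have h1 := (hasQuadraticExpansion_mul_log h).comp_affine (x := η) (B := binaryProb s t) A
    fun x => by rw [hAx]; simp only [binaryProb, Prod.fst_add, Prod.snd_add]; ring
  simp only [hAx] at h1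
  exact h1

/-- Elimination of the pair variable from the second order term of the entropy of a distribution on
four states. -/
theorem binary_complete_square {a b c d : ℝ} (ha : 0 < a) (hb : 0 < b) (hc : 0 < c) (hd : 0 < d)
    (hsum : a + b + c + d = 1) : ∃ k A B : ℝ, 0 < k ∧ ∀ z x y : ℝ,
      a⁻¹ / 2 * ((z + x + y) / 4) ^ 2 + b⁻¹ / 2 * ((-z + x - y) / 4) ^ 2 +
          c⁻¹ / 2 * ((-z - x + y) / 4) ^ 2 + d⁻¹ / 2 * ((z - x - y) / 4) ^ 2 =
        ((4 * (a + c) * (b + d) * x ^ 2 - 2 * (4 * (a * d - b * c)) * x * y +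
          4 * (a + b) * (c + d) * y ^ 2) /
            (4 * (a + b) * (c + d) * (4 * (a + c) * (b + d)) - (4 * (a * d - b * c)) ^ 2) +
          k * (z - A * x - B * y) ^ 2) / 2 := by
  -- `k` is read off from `z ^ 2`, and `A`, `B` from the cross terms `z * x` and `z * y`.
  refine ⟨(a⁻¹ + b⁻¹ + c⁻¹ + d⁻¹) / 16,
    (-a⁻¹ + b⁻¹ - c⁻¹ + d⁻¹) / (a⁻¹ + b⁻¹ + c⁻¹ + d⁻¹),
    (-a⁻¹ - b⁻¹ + c⁻¹ + d⁻¹) / (a⁻¹ + b⁻¹ + c⁻¹ + d⁻¹), by positivity, fun z x y => ?_⟩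
  have hdet : 4 * (a + b) * (c + d) * (4 * (a + c) * (b + d)) - (4 * (a * d - b * c)) ^ 2 =
      16 * (b * c * d + a * c * d + a * b * d + a * b * c) := by
    linear_combination 16 * (b * c * d + a * c * d + a * b * d + a * b * c) * hsum
  have hinv : a⁻¹ + b⁻¹ + c⁻¹ + d⁻¹ =
      (b * c * d + a * c * d + a * b * d + a * b * c) / (a * b * c * d) := by
    field_simp
  have hS : 0 < b * c * d + a * c * d + a * b * d + a * b * c := by positivity
  rw [hdet, hinv]
  field_simp
  ring

theorem one_sub_sq_fst_eq (η : ℝ × ℝ × ℝ) : 1 - η.2.1 ^ 2 =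
    4 * (binaryProb 1 1 η + binaryProb 1 (-1) η) *
      (binaryProb (-1) 1 η + binaryProb (-1) (-1) η) := by
  simp only [binaryProb]; ring

theorem one_sub_sq_snd_eq (η : ℝ × ℝ × ℝ) : 1 - η.2.2 ^ 2 =
    4 * (binaryProb 1 1 η + binaryProb (-1) 1 η) *
      (binaryProb 1 (-1) η + binaryProb (-1) (-1) η) := by
  simp only [binaryProb]; ring

theorem pair_sub_mul_eq (η : ℝ × ℝ × ℝ) : η.1 - η.2.1 * η.2.2 =
    4 * (binaryProb 1 1 η * binaryProb (-1) (-1) η -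
      binaryProb 1 (-1) η * binaryProb (-1) 1 η) := by
  simp only [binaryProb]; ring

theorem binary_edge_hasQuadraticExpansion (θ η : ℝ × ℝ × ℝ)
    (hη : η = (binary V).edgeMean i j θ) : ∃ k A B : ℝ, 0 < k ∧
      HasQuadraticExpansion ((binary V).edgeLegendre i j) η
        (fun x => θ.1 * x.1 + θ.2.1 * x.2.1 + θ.2.2 * x.2.2)
        (fun x => (((1 - η.2.2 ^ 2) * x.2.1 ^ 2 - 2 * (η.1 - η.2.1 * η.2.2) * x.2.1 * x.2.2 +
            (1 - η.2.1 ^ 2) * x.2.2 ^ 2) /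
              ((1 - η.2.1 ^ 2) * (1 - η.2.2 ^ 2) - (η.1 - η.2.1 * η.2.2) ^ 2) +
          k * (x.1 - A * x.2.1 - B * x.2.2) ^ 2) / 2) := by
  have hpos : ∀ s t : ℝ, s = 1 ∨ s = -1 → t = 1 ∨ t = -1 → 0 < binaryProb s t η :=
    fun s t hs ht => by
      rw [hη, binaryProb_edgeMean hs ht]
      exact div_pos (binaryWeight_pos _ _ _) (binaryPartition_pos θ)
  have hlog : ∀ s t : ℝ, s = 1 ∨ s = -1 → t = 1 ∨ t = -1 → Real.log (binaryProb s t η) =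
      θ.1 * (s * t) + θ.2.1 * s + θ.2.2 * t - Real.log (binaryPartition θ) :=
    fun s t hs ht => by rw [hη, log_binaryProb_edgeMean hs ht]
  have h1 := hpos 1 1 (by simp) (by simp)
  have h2 := hpos 1 (-1) (by simp) (by simp)
  have h3 := hpos (-1) 1 (by simp) (by simp)
  have h4 := hpos (-1) (-1) (by simp) (by simp)
  have hexp := ((((hasQuadraticExpansion_binaryEntropyTerm h1).add
    (hasQuadraticExpansion_binaryEntropyTerm h2)).add
    (hasQuadraticExpansion_binaryEntropyTerm h3)).add
    (hasQuadraticExpansion_binaryEntropyTerm h4)).congr_of_eventuallyEq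
    (g := (binary V).edgeLegendre i j) (by
      have hnhds := binary_edgeDual_mem_nhds (V := V) (i := i) (j := j) θ
      rw [← hη] at hnhds
      filter_upwards [hnhds] with η' hη'
      exact binary_edgeLegendre hη')
  obtain ⟨k, A, B, hk, hsq⟩ := binary_complete_square h1 h2 h3 h4
    (by simp only [binaryProb]; ring)
  -- In the linear term the constants `1 - log Z` drop out, because the four probability variations
  -- sum to zero.
  refine ⟨k, A, B, hk, hexp.congr_coeff (fun x => ?_) (fun x => ?_)⟩
  · rw [hlog _ _ (by simp) (by simp), hlog _ _ (by simp) (by simp), hlog _ _ (by simp) (by simp),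
      hlog _ _ (by simp) (by simp)]
    ring
  · rw [one_sub_sq_fst_eq, one_sub_sq_snd_eq, pair_sub_mul_eq, ← hsq]
    ring

theorem binary_vertexDual : (binary V).vertexDual i = Ioo (-1) 1 := by
  ext η
  constructor
  · rintro ⟨θ, -, rfl⟩
    rw [binary_vertexMean]
    have h1 := Real.exp_pos θ
    have h2 := Real.exp_pos (-θ)
    constructor
    · rw [lt_div_iff₀ (by positivity)]; linarith
    · rw [div_lt_iff₀ (by positivity)]; linarith
  · rintro ⟨h1, h2⟩
    have h3 : 0 < 1 + η := by linarith
    have h4 : 0 < 1 - η := by linarith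
    refine ⟨(Real.log (1 + η) - Real.log (1 - η)) / 2, by rw [binary_vertexParam]; trivial, ?_⟩
    -- The parameter is the inverse hyperbolic tangent of `η`, and `r` is `1 / √(1 - η ^ 2)`.
    set r := Real.exp (-(Real.log (1 + η) + Real.log (1 - η)) / 2)
    have hr : 0 < r := Real.exp_pos _
    have e1 : Real.exp ((Real.log (1 + η) - Real.log (1 - η)) / 2) = (1 + η) * r := by
      nth_rewrite 2 [← Real.exp_log h3]
      rw [← Real.exp_add]; congr 1; ring
    have e2 : Real.exp (-((Real.log (1 + η) - Real.log (1 - η)) / 2)) = (1 - η) * r := by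
      nth_rewrite 2 [← Real.exp_log h4]
      rw [← Real.exp_add]; congr 1; ring
    rw [binary_vertexMean, e1, e2]
    field_simp
    ring

theorem binary_vertexLegendre {η : ℝ} (hη : η ∈ (binary V).vertexDual i) :
    (binary V).vertexLegendre i η = (2⁻¹ + 2⁻¹ * η) * Real.log (2⁻¹ + 2⁻¹ * η) +
      (2⁻¹ + -2⁻¹ * η) * Real.log (2⁻¹ + -2⁻¹ * η) := by
  obtain ⟨θ, hθ, rfl⟩ := hη
  have h1 := Real.exp_pos θ
  have h2 := Real.exp_pos (-θ)
  have e1 : 2⁻¹ + 2⁻¹ * (binary V).vertexMean i θ =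
      Real.exp θ / (Real.exp θ + Real.exp (-θ)) := by
    rw [binary_vertexMean]; field_simp; ring
  have e2 : 2⁻¹ + -2⁻¹ * (binary V).vertexMean i θ =
      Real.exp (-θ) / (Real.exp θ + Real.exp (-θ)) := by
    rw [binary_vertexMean]; field_simp; ring
  rw [Family.vertexLegendre_vertexMean hθ (integrable_binary _), binary_vertexLogPart]
  nth_rewrite 2 [e1]
  nth_rewrite 2 [e2]
  rw [Real.log_div h1.ne' (by positivity), Real.log_div h2.ne' (by positivity), Real.log_exp,
    Real.log_exp]
  ring

theorem binary_vertex_hasQuadraticExpansion (θ η : ℝ) (hη : η = (binary V).vertexMean i θ) :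
    HasQuadraticExpansion ((binary V).vertexLegendre i) η (fun x => θ * x)
      (fun x => x ^ 2 / (1 - η ^ 2) / 2) := by
  have h1 := Real.exp_pos θ
  have h2 := Real.exp_pos (-θ)
  have e1 : 2⁻¹ + 2⁻¹ * η = Real.exp θ / (Real.exp θ + Real.exp (-θ)) := by
    rw [hη, binary_vertexMean]; field_simp; ring
  have e2 : 2⁻¹ + -2⁻¹ * η = Real.exp (-θ) / (Real.exp θ + Real.exp (-θ)) := by
    rw [hη, binary_vertexMean]; field_simp; ring
  have p1 : 0 < 2⁻¹ + 2⁻¹ * η := by rw [e1]; positivity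
  have p2 : 0 < 2⁻¹ + -2⁻¹ * η := by rw [e2]; positivity
  have hexp : ∀ r : ℝ, 0 < 2⁻¹ + r * η → HasQuadraticExpansion
      (fun η => (2⁻¹ + r * η) * Real.log (2⁻¹ + r * η)) η
      (fun x => (Real.log (2⁻¹ + r * η) + 1) * (r * x))
      (fun x => (2⁻¹ + r * η)⁻¹ / 2 * (r * x) ^ 2) := fun r hr =>
    (hasQuadraticExpansion_mul_log hr).comp_affine (x := η) (B := fun η => 2⁻¹ + r * η)
      (r • ContinuousLinearMap.id ℝ ℝ) fun x => by simp; ring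
  refine (((hexp _ p1).add (hexp _ p2)).congr_of_eventuallyEq
    (g := (binary V).vertexLegendre i) ?_).congr_coeff (fun x => ?_) fun x => ?_
  · have hmem : (binary V).vertexDual i ∈ 𝓝 η := by
      rw [binary_vertexDual]
      exact Ioo_mem_nhds (by linarith) (by linarith)
    filter_upwards [hmem] with η' hη'
    exact binary_vertexLegendre hη'
  · rw [e1, e2, Real.log_div h1.ne' (by positivity), Real.log_div h2.ne' (by positivity),
      Real.log_exp, Real.log_exp]
    ring
  · have h3 : 1 - η ^ 2 = 4 * (2⁻¹ + 2⁻¹ * η) * (2⁻¹ + -2⁻¹ * η) := by ring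
    rw [h3]
    have h4 : (2⁻¹ + 2⁻¹ * η) + (2⁻¹ + -2⁻¹ * η) = 1 := by ring
    generalize 2⁻¹ + 2⁻¹ * η = p at *
    generalize 2⁻¹ + -2⁻¹ * η = q at *
    field_simp
    linear_combination 4 * x ^ 2 * h4

/-- The dependence of the message on the cavity parameter in the binary model. -/
noncomputable def binaryMessage (J θ : ℝ) : ℝ :=
  (Real.log (Real.exp (J + θ) + Real.exp (-(J + θ))) -
    Real.log (Real.exp (θ - J) + Real.exp (-(θ - J)))) / 2

/-- The derivative is half the difference of two hyperbolic tangents. Over a common denominator its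
sign is that of `J`, and it matches the covariance ratio in `binary_covariance_div`. -/
theorem hasDerivAt_binaryMessage (J θ : ℝ) : HasDerivAt (binaryMessage J)
    ((Real.exp (2 * J) - Real.exp (-(2 * J))) /
      ((Real.exp (J + θ) + Real.exp (-(J + θ))) * (Real.exp (θ - J) + Real.exp (-(θ - J))))) θ := by
  have h1 : ∀ θ, HasDerivAt (fun θ => Real.exp θ + Real.exp (-θ)) (Real.exp θ - Real.exp (-θ)) θ :=
    fun θ => by
      refine ((Real.hasDerivAt_exp θ).add (hasDerivAt_id' θ).neg.exp).congr_deriv ?_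
      simp [sub_eq_add_neg]
  have h2 : ∀ θ, HasDerivAt (fun θ => Real.log (Real.exp θ + Real.exp (-θ)))
      ((Real.exp θ - Real.exp (-θ)) / (Real.exp θ + Real.exp (-θ))) θ := fun θ =>
    (h1 θ).log (by positivity)
  have h3 := ((HasDerivAt.comp_const_add J θ (h2 (J + θ))).sub
    (HasDerivAt.comp_sub_const θ J (h2 (θ - J)))).div_const 2
  refine h3.congr_deriv ?_
  have e1 : Real.exp (2 * J) = Real.exp (J + θ) * Real.exp (-(θ - J)) := by
    rw [← Real.exp_add]; congr 1; ring
  have e2 : Real.exp (-(2 * J)) = Real.exp (-(J + θ)) * Real.exp (θ - J) := by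
    rw [← Real.exp_add]; congr 1; ring
  rw [e1, e2]
  have p1 := Real.exp_pos (J + θ)
  have p2 := Real.exp_pos (-(J + θ))
  have p3 := Real.exp_pos (θ - J)
  have p4 := Real.exp_pos (-(θ - J))
  field_simp
  ring

theorem monotone_binaryMessage {J : ℝ} (hJ : 0 ≤ J) : Monotone (binaryMessage J) := by
  refine monotone_of_deriv_nonneg (fun θ => (hasDerivAt_binaryMessage J θ).differentiableAt)
    fun θ => ?_
  rw [(hasDerivAt_binaryMessage J θ).deriv]
  have : Real.exp (-(2 * J)) ≤ Real.exp (2 * J) := Real.exp_le_exp.2 (by linarith)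
  exact div_nonneg (by linarith) (by positivity)

/-- The first vertex marginal of an edge distribution. -/
theorem binary_edgeMean_fst (θ : ℝ × ℝ × ℝ) : ((binary V).edgeMean i j θ).2.1 =
    (binary V).vertexMean i (θ.2.1 + binaryMessage θ.1 θ.2.2) := by
  set u := Real.exp (θ.1 + θ.2.2) + Real.exp (-(θ.1 + θ.2.2)) with hu
  set w := Real.exp (θ.2.2 - θ.1) + Real.exp (-(θ.2.2 - θ.1)) with hw
  have hu0 : 0 < u := by positivity
  have hw0 : 0 < w := by positivity
  -- Summing out the second spin multiplies the two weights of the first by `u` and `w`; `r` is the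
  -- common factor making the multipliers reciprocal.
  set r := Real.exp (-(Real.log u + Real.log w) / 2)
  have hr : 0 < r := Real.exp_pos _
  have e1 : Real.exp (θ.2.1 + binaryMessage θ.1 θ.2.2) = Real.exp θ.2.1 * u * r := by
    nth_rewrite 1 [← Real.exp_log hu0]
    rw [← Real.exp_add, ← Real.exp_add, binaryMessage]; congr 1; ring
  have e2 : Real.exp (-(θ.2.1 + binaryMessage θ.1 θ.2.2)) = Real.exp (-θ.2.1) * w * r := by
    nth_rewrite 1 [← Real.exp_log hw0]
    rw [← Real.exp_add, ← Real.exp_add, binaryMessage]; congr 1; ring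
  have f1 : binaryWeight θ 1 1 + binaryWeight θ 1 (-1) = Real.exp θ.2.1 * u := by
    rw [hu, mul_add, ← Real.exp_add, ← Real.exp_add, binaryWeight, binaryWeight]
    congr 2 <;> ring
  have f2 : binaryWeight θ (-1) 1 + binaryWeight θ (-1) (-1) = Real.exp (-θ.2.1) * w := by
    rw [hw, mul_add, ← Real.exp_add, ← Real.exp_add, binaryWeight, binaryWeight]
    congr 2 <;> ring
  have hZ : binaryPartition θ = Real.exp θ.2.1 * u + Real.exp (-θ.2.1) * w := by
    rw [← f1, ← f2, binaryPartition]; ring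
  rw [binary_edgeMean, binary_vertexMean, e1, e2]
  simp only
  rw [sub_sub, f1, f2, hZ]
  field_simp

theorem binaryWeight_swap (θ : ℝ × ℝ × ℝ) (s t : ℝ) :
    binaryWeight (θ.1, θ.2.2, θ.2.1) s t = binaryWeight θ t s := by
  simp only [binaryWeight]; congr 1; ring

theorem binary_edgeMean_swap (θ : ℝ × ℝ × ℝ) : (binary V).edgeMean j i (θ.1, θ.2.2, θ.2.1) =
    (((binary V).edgeMean i j θ).1, ((binary V).edgeMean i j θ).2.2,
      ((binary V).edgeMean i j θ).2.1) := by
  simp only [binary_edgeMean, binaryPartition, binaryWeight_swap]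
  refine Prod.ext ?_ (Prod.ext ?_ ?_) <;> simp only <;> congr 1 <;> ring

/-- The covariance is proportional to the weights of equal spins multiplied together minus those of
opposite spins. The fields cancel, leaving `exp (2 θ₀) - exp (-2 θ₀)`. -/
theorem binary_covariance_nonneg {θ : ℝ × ℝ × ℝ} (hθ : 0 ≤ θ.1) :
    0 ≤ ((binary V).edgeMean i j θ).1 -
      ((binary V).edgeMean i j θ).2.1 * ((binary V).edgeMean i j θ).2.2 := by
  rw [pair_sub_mul_eq, binaryProb_edgeMean (by simp) (by simp),
    binaryProb_edgeMean (by simp) (by simp), binaryProb_edgeMean (by simp) (by simp),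
    binaryProb_edgeMean (by simp) (by simp), div_mul_div_comm, div_mul_div_comm, ← sub_div]
  have hZ := binaryPartition_pos θ
  refine mul_nonneg zero_le_four (div_nonneg (sub_nonneg.2 ?_) (by positivity))
  simp only [binaryWeight, ← Real.exp_add]
  exact Real.exp_le_exp.2 (by linarith)

/-- The covariance determinant is `16` times the total mass times the sum of the triple products of
the state probabilities, all of which are positive. -/
theorem binary_covariance_sq_lt (θ : ℝ × ℝ × ℝ) :
    (((binary V).edgeMean i j θ).1 -
      ((binary V).edgeMean i j θ).2.1 * ((binary V).edgeMean i j θ).2.2) ^ 2 <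
      (1 - ((binary V).edgeMean i j θ).2.1 ^ 2) * (1 - ((binary V).edgeMean i j θ).2.2 ^ 2) := by
  have hpos : ∀ s t : ℝ, s = 1 ∨ s = -1 → t = 1 ∨ t = -1 →
      0 < binaryProb s t ((binary V).edgeMean i j θ) := fun s t hs ht => by
    rw [binaryProb_edgeMean hs ht]
    exact div_pos (binaryWeight_pos _ _ _) (binaryPartition_pos θ)
  have h1 := hpos 1 1 (by simp) (by simp)
  have h2 := hpos 1 (-1) (by simp) (by simp)
  have h3 := hpos (-1) 1 (by simp) (by simp)
  have h4 := hpos (-1) (-1) (by simp) (by simp)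
  rw [pair_sub_mul_eq, one_sub_sq_fst_eq, one_sub_sq_snd_eq, ← sub_pos]
  generalize binaryProb 1 1 _ = a at *
  generalize binaryProb 1 (-1) _ = b at *
  generalize binaryProb (-1) 1 _ = c at *
  generalize binaryProb (-1) (-1) _ = d at *
  have : 0 < 16 * (a + b + c + d) * (b * c * d + a * c * d + a * b * d + a * b * c) := by
    positivity
  linarith

/-- The derivative of the message is the ratio of a covariance and a variance. -/
theorem binary_covariance_div (θ : ℝ × ℝ × ℝ) :
    (((binary V).edgeMean i j θ).1 -
      ((binary V).edgeMean i j θ).2.1 * ((binary V).edgeMean i j θ).2.2) /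
      (1 - ((binary V).edgeMean i j θ).2.2 ^ 2) =
    (Real.exp (2 * θ.1) - Real.exp (-(2 * θ.1))) /
      ((Real.exp (θ.1 + θ.2.1) + Real.exp (-(θ.1 + θ.2.1))) *
        (Real.exp (θ.2.1 - θ.1) + Real.exp (-(θ.2.1 - θ.1)))) := by
  have hZ := binaryPartition_pos θ
  have e1 : Real.exp (2 * θ.1) = binaryWeight θ 1 1 * binaryWeight θ (-1) (-1) := by
    simp only [binaryWeight, ← Real.exp_add]; congr 1; ring
  have e2 : Real.exp (-(2 * θ.1)) = binaryWeight θ 1 (-1) * binaryWeight θ (-1) 1 := by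
    simp only [binaryWeight, ← Real.exp_add]; congr 1; ring
  have e3 : Real.exp (θ.1 + θ.2.1) + Real.exp (-(θ.1 + θ.2.1)) =
      (binaryWeight θ 1 1 + binaryWeight θ (-1) 1) * Real.exp (-θ.2.2) := by
    simp only [binaryWeight, add_mul, ← Real.exp_add]; congr 2 <;> ring
  have e4 : Real.exp (θ.2.1 - θ.1) + Real.exp (-(θ.2.1 - θ.1)) =
      (binaryWeight θ 1 (-1) + binaryWeight θ (-1) (-1)) * Real.exp θ.2.2 := by
    simp only [binaryWeight, add_mul, ← Real.exp_add]; congr 2 <;> ring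
  have e5 : Real.exp (-θ.2.2) * Real.exp θ.2.2 = 1 := by rw [← Real.exp_add]; simp
  rw [pair_sub_mul_eq, one_sub_sq_snd_eq, binaryProb_edgeMean (by simp) (by simp),
    binaryProb_edgeMean (by simp) (by simp), binaryProb_edgeMean (by simp) (by simp),
    binaryProb_edgeMean (by simp) (by simp), e1, e2, e3, e4, mul_mul_mul_comm, e5]
  have h1 := binaryWeight_pos θ 1 1
  have h2 := binaryWeight_pos θ 1 (-1)
  have h3 := binaryWeight_pos θ (-1) 1
  have h4 := binaryWeight_pos θ (-1) (-1)
  field_simp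

end Binary

/-! ### The dichotomy for the attractive binary model. -/

section BinaryLBP

theorem dartEdge_symm {V : Type*} {G : SimpleGraph V} (d : G.Dart) : dartEdge d.symm = dartEdge d :=
  Subtype.ext (SimpleGraph.Dart.edge_symm d)

variable {V : Type*} [Fintype V] [DecidableEq V] {G : SimpleGraph V} [DecidableRel G.Adj]
  {P : Potential G} {μ : G.Dart → ℝ}

/-- An update consists of two equations, at `y = ±1`; subtracting their logarithms eliminates `ω`.
-/
theorem binary_isUpdate_iff (μ μ' : G.Dart → ℝ) : IsUpdate (binary V) P μ μ' ↔
    ∀ d, cavityParam P μ d ∈ univ ∧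
      μ' d = P.a d + binaryMessage (P.J (dartEdge d)) (cavityParam P μ d) := by
  rw [isUpdate_iff_integral]
  refine forall_congr' fun d => ?_
  simp only [ae_binary_iff, integral_binary, mem_univ, true_and]
  simp only [binary, binaryMessage]
  generalize P.J (dartEdge d) = J
  generalize cavityParam P μ d = θ
  have e1 : Real.exp (J * (1 * 1) + θ * 1) + Real.exp (J * (-1 * 1) + θ * -1) =
      Real.exp (J + θ) + Real.exp (-(J + θ)) := by ring_nf
  have e2 : Real.exp (J * (1 * -1) + θ * 1) + Real.exp (J * (-1 * -1) + θ * -1) =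
      Real.exp (θ - J) + Real.exp (-(θ - J)) := by ring_nf
  rw [e1, e2]
  set u := Real.exp (J + θ) + Real.exp (-(J + θ))
  set w := Real.exp (θ - J) + Real.exp (-(θ - J))
  have hu : 0 < u := by positivity
  have hw : 0 < w := by positivity
  constructor
  · rintro ⟨ω, hω, h1, h2⟩
    have l1 := congrArg Real.log h1
    have l2 := congrArg Real.log h2
    rw [Real.log_exp, Real.log_mul hω.ne' (by positivity),
      Real.log_mul (Real.exp_pos _).ne' (by positivity), Real.log_exp] at l1 l2
    linarith
  · intro h
    refine ⟨Real.exp (-(Real.log u + Real.log w) / 2), Real.exp_pos _, ?_, ?_⟩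
    · nth_rewrite 2 [← Real.exp_log hu]
      rw [← Real.exp_add, ← Real.exp_add, h]; congr 1; ring
    · nth_rewrite 2 [← Real.exp_log hw]
      rw [← Real.exp_add, ← Real.exp_add, h]; congr 1; ring

theorem binary_hasMonotoneUpdate (hP : P.Attractive) :
    HasMonotoneUpdate (binary V) P univ fun d => binaryMessage (P.J (dartEdge d)) where
  isOpen := isOpen_univ
  ordConnected := ordConnected_univ
  isUpdate_iff := binary_isUpdate_iff
  monotoneOn _ := (monotone_binaryMessage (hP _)).monotoneOn _

theorem edgeBeliefParam_symm (P : Potential G) (μ : G.Dart → ℝ) (d : G.Dart) :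
    edgeBeliefParam P μ d.symm = ((edgeBeliefParam P μ d).1, (edgeBeliefParam P μ d).2.2,
      (edgeBeliefParam P μ d).2.1) := by
  simp only [edgeBeliefParam, dartEdge_symm, SimpleGraph.Dart.symm_symm]

/-- A nondegenerate fixed point of the attractive binary model is a local minimum of the Bethe free
energy if it is locally stable, and a saddle point otherwise. -/
theorem binary_localMin_or_saddle (hP : P.Attractive) (hμ : IsUpdate (binary V) P μ μ)
    (hnd : IsNondegenerate (binary V) P μ) :
    (IsLocallyStable (binary V) P μ → IsBetheLocalMin (binary V) P (beliefPoint (binary V) P μ)) ∧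
      (¬ IsLocallyStable (binary V) P μ →
        IsBetheSaddle (binary V) P (beliefPoint (binary V) P μ)) := by
  -- Local consistency of the beliefs at `d.fst` is the fixed-point equation of the reversed dart.
  have hfst : ∀ d : G.Dart, ((binary V).edgeMean d.fst d.snd (edgeBeliefParam P μ d)).2.1 =
      (binary V).vertexMean d.fst (beliefParam P μ d.fst) := fun d => by
    have h1 := ((binary_isUpdate_iff μ μ).1 hμ d.symm).2
    rw [dartEdge_symm] at h1
    rw [binary_edgeMean_fst, beliefParam_fst, h1]
    simp only [edgeBeliefParam]
    congr 1
    ring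
  have hsnd : ∀ d : G.Dart, ((binary V).edgeMean d.fst d.snd (edgeBeliefParam P μ d)).2.2 =
      (binary V).vertexMean d.snd (beliefParam P μ d.snd) := fun d => by
    have h1 := hfst d.symm
    rw [edgeBeliefParam_symm] at h1
    simp only [SimpleGraph.Dart.symm, Prod.fst_swap, Prod.snd_swap] at h1
    rw [binary_edgeMean_swap] at h1
    exact h1
  set v : V → ℝ := fun i => 1 - (binary V).vertexMean i (beliefParam P μ i) ^ 2 with hv
  set c : G.Dart → ℝ := fun d => ((binary V).edgeMean d.fst d.snd (edgeBeliefParam P μ d)).1 -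
    ((binary V).edgeMean d.fst d.snd (edgeBeliefParam P μ d)).2.1 *
      ((binary V).edgeMean d.fst d.snd (edgeBeliefParam P μ d)).2.2 with hc
  have hvmem : ∀ i, (binary V).vertexMean i (beliefParam P μ i) ∈ Ioo (-1 : ℝ) 1 := fun i => by
    rw [← binary_vertexDual (V := V) (i := i)]
    exact ⟨_, by rw [binary_vertexParam]; trivial, rfl⟩
  have hcov : IsCovariance v c :=
    { pos := fun i => by
        have := hvmem i
        simp only [hv]
        nlinarith [this.1, this.2]
      nonneg := fun d => binary_covariance_nonneg (hP _)
      symm := fun d => by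
        simp only [hc, edgeBeliefParam_symm]
        simp only [SimpleGraph.Dart.symm, Prod.fst_swap, Prod.snd_swap, binary_edgeMean_swap]
        rw [mul_comm]
      lt := fun d => by
        simp only [hv, hc]
        rw [← hfst, ← hsnd]
        exact binary_covariance_sq_lt _ }
  refine HasBetheExpansion.localMin_or_saddle (.of_local (fun d => Prod.ext (hfst d) (hsnd d))
    (fun i => ?_) (fun d => binary_edgeDual_mem_nhds _)
    (fun i => binary_vertex_hasQuadraticExpansion _ _ rfl) fun d => ?_) hcov
    (binary_hasMonotoneUpdate hP) (fun d => ?_) hμ hnd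
  · rw [binary_vertexDual]
    exact isOpen_Ioo.mem_nhds (hvmem i)
  · obtain ⟨k, A, B, hk, h⟩ := binary_edge_hasQuadraticExpansion (V := V) (i := d.fst) (j := d.snd)
      (edgeBeliefParam P μ d) _ rfl
    refine ⟨k, A, B, hk, h.congr_coeff (fun _ => rfl) fun x => ?_⟩
    simp only [edgeForm, dartDet, hc]
    rw [← hfst, ← hsnd]
  · refine (hasDerivAt_binaryMessage _ _).congr_deriv ?_
    simp only [hc]
    rw [← hsnd, binary_covariance_div]
    rfl

end BinaryLBP

/-! ### Gaussian integrals and shears of the plane. -/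

section GaussianMoments

theorem integrable_exp_mul_sq_iff {θ : ℝ} :
    Integrable (fun x : ℝ => Real.exp (θ * x ^ 2)) ↔ θ < 0 := by
  simpa using integrable_exp_neg_mul_sq_iff (b := -θ)

theorem integral_exp_mul_sq (θ : ℝ) : ∫ x : ℝ, Real.exp (θ * x ^ 2) = √(Real.pi / -θ) := by
  simpa using integral_gaussian (-θ)

theorem integrable_mul_exp_mul_sq {θ : ℝ} (hθ : θ < 0) :
    Integrable fun x : ℝ => x * Real.exp (θ * x ^ 2) := by
  simpa using integrable_mul_exp_neg_mul_sq (neg_pos.2 hθ)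

theorem integrable_sq_mul_exp_mul_sq {θ : ℝ} (hθ : θ < 0) :
    Integrable fun x : ℝ => x ^ 2 * Real.exp (θ * x ^ 2) := by
  simpa using integrable_rpow_mul_exp_neg_mul_sq (neg_pos.2 hθ) (s := 2) (by norm_num)

theorem hasDerivAt_exp_mul_sq (θ x : ℝ) :
    HasDerivAt (fun x : ℝ => Real.exp (θ * x ^ 2)) (2 * θ * (x * Real.exp (θ * x ^ 2))) x := by
  refine (((hasDerivAt_pow 2 x).const_mul θ).exp).congr_deriv ?_
  push_cast
  ring

theorem integral_mul_exp_mul_sq {θ : ℝ} (hθ : θ < 0) :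
    ∫ x : ℝ, x * Real.exp (θ * x ^ 2) = 0 := by
  have h := integral_eq_zero_of_hasDerivAt_of_integrable (hasDerivAt_exp_mul_sq θ)
    ((integrable_mul_exp_mul_sq hθ).const_mul _) (integrable_exp_mul_sq_iff.2 hθ)
  rw [integral_const_mul] at h
  exact (mul_eq_zero.1 h).resolve_left (by linarith)

theorem integral_sq_mul_exp_mul_sq {θ : ℝ} (hθ : θ < 0) :
    ∫ x : ℝ, x ^ 2 * Real.exp (θ * x ^ 2) = √(Real.pi / -θ) / (-2 * θ) := by
  have hderiv : ∀ x : ℝ, HasDerivAt (fun x : ℝ => x * Real.exp (θ * x ^ 2))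
      (Real.exp (θ * x ^ 2) + 2 * θ * (x ^ 2 * Real.exp (θ * x ^ 2))) x := fun x => by
    refine ((hasDerivAt_id' x).mul (hasDerivAt_exp_mul_sq θ x)).congr_deriv ?_
    ring
  have h1 := integrable_exp_mul_sq_iff.2 hθ
  have h2 := (integrable_sq_mul_exp_mul_sq hθ).const_mul (2 * θ)
  -- Integration by parts: the integral of the derivative of `x * exp (θ * x ^ 2)` vanishes.
  have h := integral_eq_zero_of_hasDerivAt_of_integrable hderiv (h1.add h2)
    (integrable_mul_exp_mul_sq hθ)
  rw [integral_add h1 h2, integral_const_mul, integral_exp_mul_sq] at h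
  rw [eq_div_iff (by linarith)]
  linarith

theorem integral_exp_linear_add_sq {θ : ℝ} (hθ : θ < 0) (J a y : ℝ) :
    ∫ x : ℝ, Real.exp (J * ((x - a) * y) + θ * (x - a) ^ 2) =
      Real.exp (-J ^ 2 / (4 * θ) * y ^ 2) * √(Real.pi / -θ) := by
  have h : ∀ x : ℝ, Real.exp (J * ((x - a) * y) + θ * (x - a) ^ 2) =
      Real.exp (-J ^ 2 / (4 * θ) * y ^ 2) *
        Real.exp (θ * (x - (a - J * y / (2 * θ))) ^ 2) := fun x => by
    rw [← Real.exp_add]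
    congr 1
    have := hθ.ne
    field_simp
    ring
  simp only [h]
  rw [integral_const_mul,
    integral_sub_right_eq_self (fun x => Real.exp (θ * x ^ 2)) (a - J * y / (2 * θ)),
    integral_exp_mul_sq]

/-- After centering, the integrand plus its reflection dominates `exp (θ * x ^ 2)`, since one of the
two linear terms is nonnegative at each point. -/
theorem neg_of_integrable_exp_linear_add_sq {θ J a y : ℝ}
    (h : Integrable fun x : ℝ => Real.exp (J * ((x - a) * y) + θ * (x - a) ^ 2)) : θ < 0 := by
  have h1 := h.comp_add_right a
  have h2 := h1.comp_neg
  refine integrable_exp_mul_sq_iff.1 ((h1.add h2).mono' (by fun_prop) (.of_forall fun x => ?_))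
  simp only [add_sub_cancel_right, Pi.add_apply, Real.norm_eq_abs, Real.abs_exp, neg_sq]
  rcases le_total 0 (J * (x * y)) with hx | hx
  · have := Real.exp_le_exp.2 (by linarith : θ * x ^ 2 ≤ J * (x * y) + θ * x ^ 2)
    linarith [Real.exp_pos (J * (-x * y) + θ * x ^ 2)]
  · have := Real.exp_le_exp.2 (by linarith : θ * x ^ 2 ≤ J * (-x * y) + θ * x ^ 2)
    linarith [Real.exp_pos (J * (x * y) + θ * x ^ 2)]

/-- A shear of the plane followed by a translation. -/
def planeShear (s a b : ℝ) : ℝ × ℝ ≃ₜ ℝ × ℝ where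
  toFun p := (p.1 + a, p.2 + (s * p.1 + b))
  invFun q := (q.1 - a, q.2 - (s * (q.1 - a) + b))
  left_inv p := by simp
  right_inv q := by simp
  continuous_toFun := by fun_prop
  continuous_invFun := by fun_prop

theorem measurePreserving_planeShear (s a b : ℝ) :
    MeasurePreserving (planeShear s a b) ((volume : Measure ℝ).prod volume)
      ((volume : Measure ℝ).prod volume) :=
  (measurePreserving_add_right volume a).skew_product
    (g := fun x y : ℝ => y + (s * x + b)) (by fun_prop)
    (.of_forall fun x => map_add_right_eq_self volume (s * x + b))

end GaussianMoments

/-! ### The fixed-mean Gaussian family: means and entropies. -/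

section FixedMeanGaussian

variable {V : Type*} {i j : V} {m : V → ℝ}

instance : NeZero (fixedMeanGaussian m).ν := inferInstanceAs (NeZero (volume : Measure ℝ))

instance : NeZero ((fixedMeanGaussian m).ν.prod (fixedMeanGaussian m).ν) :=
  inferInstanceAs (NeZero (volume : Measure (ℝ × ℝ)))

theorem gaussian_integrable_vertex_iff {θ : ℝ} :
    Integrable (fun x => Real.exp (θ * (fixedMeanGaussian m).φ i x)) (fixedMeanGaussian m).ν ↔
      θ < 0 := by
  rw [← integrable_exp_mul_sq_iff]
  refine ⟨fun h => ?_, fun h => h.comp_sub_right (m i)⟩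
  simpa [fixedMeanGaussian] using Integrable.comp_add_right (μ := (volume : Measure ℝ)) h (m i)

theorem gaussian_vertexParam : (fixedMeanGaussian m).vertexParam i = Iio 0 := by
  simp only [Family.vertexParam, gaussian_integrable_vertex_iff]
  exact interior_Iio

theorem gaussian_vertexIntegrable {θ : ℝ} (hθ : θ < 0) :
    Integrable (fun x => (fixedMeanGaussian m).φ i x *
      Real.exp (θ * (fixedMeanGaussian m).φ i x)) (fixedMeanGaussian m).ν :=
  (integrable_sq_mul_exp_mul_sq hθ).comp_sub_right (m i)

theorem gaussian_integral_vertex (θ : ℝ) :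
    ∫ x, Real.exp (θ * (fixedMeanGaussian m).φ i x) ∂(fixedMeanGaussian m).ν =
      √(Real.pi / -θ) := by
  rw [← integral_exp_mul_sq]
  exact integral_sub_right_eq_self (μ := volume) (fun x => Real.exp (θ * x ^ 2)) (m i)

theorem gaussian_vertexMean {θ : ℝ} (hθ : θ < 0) :
    (fixedMeanGaussian m).vertexMean i θ = -1 / (2 * θ) := by
  have h : ∫ x, (fixedMeanGaussian m).φ i x * Real.exp (θ * (fixedMeanGaussian m).φ i x)
      ∂(fixedMeanGaussian m).ν = √(Real.pi / -θ) / (-2 * θ) := by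
    rw [← integral_sq_mul_exp_mul_sq hθ]
    exact integral_sub_right_eq_self (μ := volume) (fun x => x ^ 2 * Real.exp (θ * x ^ 2)) (m i)
  have hpos : 0 < √(Real.pi / -θ) := Real.sqrt_pos.2 (div_pos Real.pi_pos (neg_pos.2 hθ))
  have := hθ.ne
  rw [Family.vertexMean, h, gaussian_integral_vertex]
  generalize √(Real.pi / -θ) = r at hpos
  field_simp

theorem gaussian_vertexMean_inv {η : ℝ} (hη : 0 < η) :
    (fixedMeanGaussian m).vertexMean i (-1 / (2 * η)) = η := by
  rw [gaussian_vertexMean (div_neg_of_neg_of_pos (by norm_num) (by positivity))]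
  field_simp

theorem gaussian_vertexDual : (fixedMeanGaussian m).vertexDual i = Ioi 0 := by
  ext η
  rw [Family.vertexDual, gaussian_vertexParam]
  constructor
  · rintro ⟨θ, hθ : θ < 0, rfl⟩
    rw [gaussian_vertexMean hθ]
    exact mem_Ioi.2 (div_pos_of_neg_of_neg (by norm_num) (by linarith))
  · intro (hη : 0 < η)
    exact ⟨-1 / (2 * η), mem_Iio.2 (div_neg_of_neg_of_pos (by norm_num) (by positivity)),
      gaussian_vertexMean_inv hη⟩

theorem gaussian_vertexLegendre {η : ℝ} (hη : 0 < η) :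
    (fixedMeanGaussian m).vertexLegendre i η =
      (-2⁻¹ - 2⁻¹ * Real.log (2 * Real.pi)) + -2⁻¹ * Real.log η := by
  have hθ : -1 / (2 * η) < 0 := div_neg_of_neg_of_pos (by norm_num) (by positivity)
  have h := Family.vertexLegendre_vertexMean (I := fixedMeanGaussian m) (i := i)
    (θ := -1 / (2 * η)) (by rw [gaussian_vertexParam]; exact hθ) (gaussian_vertexIntegrable hθ)
  have e : Real.pi / -(-1 / (2 * η)) = 2 * Real.pi * η := by field_simp
  rw [gaussian_vertexMean_inv hη, Family.vertexLogPart, gaussian_integral_vertex, e,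
    Real.log_sqrt (by positivity), Real.log_mul (by positivity) hη.ne'] at h
  rw [h]
  field_simp
  ring

theorem gaussian_vertex_hasQuadraticExpansion {θ η : ℝ} (hθ : θ < 0) (hη : η = -1 / (2 * θ)) :
    HasQuadraticExpansion ((fixedMeanGaussian m).vertexLegendre i) η (fun x => θ * x)
      (fun x => x ^ 2 / (2 * η ^ 2) / 2) := by
  have hη0 : 0 < η := by rw [hη]; exact div_pos_of_neg_of_neg (by norm_num) (by linarith)
  have hconst : HasQuadraticExpansion (fun _ : ℝ => -2⁻¹ - 2⁻¹ * Real.log (2 * Real.pi)) η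
      (fun _ => 0) (fun _ => 0) := .of_affine fun _ => by simp
  refine ((hconst.add ((hasQuadraticExpansion_log hη0).const_mul (-2⁻¹))).congr_of_eventuallyEq
    (g := (fixedMeanGaussian m).vertexLegendre i) ?_).congr_coeff (fun x => ?_) fun x => ?_
  · filter_upwards [lt_mem_nhds hη0] with y hy
    exact gaussian_vertexLegendre hy
  · have := hθ.ne
    rw [hη]
    field_simp
    ring
  · field_simp
    ring

/-- Natural parameters of the Gaussian edge family. -/
def gaussianEdgeParam : Set (ℝ × ℝ × ℝ) := {θ | θ.2.2 < 0 ∧ θ.1 ^ 2 < 4 * θ.2.1 * θ.2.2}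

theorem isOpen_gaussianEdgeParam : IsOpen gaussianEdgeParam := by
  have h1 : IsOpen {θ : ℝ × ℝ × ℝ | θ.2.2 < 0} := isOpen_lt (by fun_prop) continuous_const
  have h2 : IsOpen {θ : ℝ × ℝ × ℝ | θ.1 ^ 2 < 4 * θ.2.1 * θ.2.2} :=
    isOpen_lt (by fun_prop) (by fun_prop)
  exact h1.inter h2

/-- The natural parameter of the first marginal. -/
noncomputable def gaussianMarginalParam (θ : ℝ × ℝ × ℝ) : ℝ := θ.2.1 - θ.1 ^ 2 / (4 * θ.2.2)

theorem gaussianMarginalParam_neg_iff {θ : ℝ × ℝ × ℝ} (h : θ.2.2 < 0) :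
    gaussianMarginalParam θ < 0 ↔ θ.1 ^ 2 < 4 * θ.2.1 * θ.2.2 := by
  rw [gaussianMarginalParam, sub_neg, lt_div_iff_of_neg (by linarith)]
  constructor <;> intro h <;> linarith

/-- Completing the square in the second variable decouples the density; the shear preserves Lebesgue
measure, so edge integrals reduce to one-dimensional ones. -/
theorem edgeDensity_planeShear {θ : ℝ × ℝ × ℝ} (h : θ.2.2 < 0) (p : ℝ × ℝ) :
    (fixedMeanGaussian m).edgeDensity i j θ
        (planeShear (-θ.1 / (2 * θ.2.2)) (m i) (m j) p) =
      Real.exp (gaussianMarginalParam θ * p.1 ^ 2) * Real.exp (θ.2.2 * p.2 ^ 2) := by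
  rw [← Real.exp_add]
  simp only [Family.edgeDensity, fixedMeanGaussian, planeShear, Homeomorph.homeomorph_mk_coe,
    Equiv.coe_fn_mk, gaussianMarginalParam]
  congr 1
  have := h.ne
  field_simp
  ring

/-- Integrals with respect to the edge family in sheared coordinates. -/
theorem gaussian_integral_edge {θ : ℝ × ℝ × ℝ} (h : θ.2.2 < 0) (f : ℝ × ℝ → ℝ) :
    ∫ p, f p * (fixedMeanGaussian m).edgeDensity i j θ p
        ∂((fixedMeanGaussian m).ν.prod (fixedMeanGaussian m).ν) =
      ∫ p : ℝ × ℝ, f (planeShear (-θ.1 / (2 * θ.2.2)) (m i) (m j) p) *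
        (Real.exp (gaussianMarginalParam θ * p.1 ^ 2) * Real.exp (θ.2.2 * p.2 ^ 2))
        ∂((volume : Measure ℝ).prod volume) := by
  simp only [← edgeDensity_planeShear (m := m) (i := i) (j := j) h]
  exact ((measurePreserving_planeShear _ _ _).integral_comp
    (planeShear _ _ _).measurableEmbedding
    (fun p => f p * (fixedMeanGaussian m).edgeDensity i j θ p)).symm

theorem gaussian_integrable_edge_iff {θ : ℝ × ℝ × ℝ} (h : θ.2.2 < 0) (f : ℝ × ℝ → ℝ) :
    Integrable (fun p => f p * (fixedMeanGaussian m).edgeDensity i j θ p)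
        ((fixedMeanGaussian m).ν.prod (fixedMeanGaussian m).ν) ↔
      Integrable (fun p : ℝ × ℝ => f (planeShear (-θ.1 / (2 * θ.2.2)) (m i) (m j) p) *
        (Real.exp (gaussianMarginalParam θ * p.1 ^ 2) * Real.exp (θ.2.2 * p.2 ^ 2)))
        ((volume : Measure ℝ).prod volume) := by
  simp only [← edgeDensity_planeShear (m := m) (i := i) (j := j) h]
  exact ((measurePreserving_planeShear _ _ _).integrable_comp_emb
    (planeShear _ _ _).measurableEmbedding
    (g := fun p => f p * (fixedMeanGaussian m).edgeDensity i j θ p)).symm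

theorem integrable_gaussian_prod {α τ : ℝ} (hα : α < 0) (hτ : τ < 0) :
    Integrable (fun p : ℝ × ℝ => Real.exp (α * p.1 ^ 2) * Real.exp (τ * p.2 ^ 2))
      ((volume : Measure ℝ).prod volume) :=
  (integrable_exp_mul_sq_iff.2 hα).mul_prod (integrable_exp_mul_sq_iff.2 hτ)

theorem gaussian_moment_fst {α τ : ℝ} (hα : α < 0) (hτ : τ < 0) :
    Integrable (fun p : ℝ × ℝ => p.1 ^ 2 * (Real.exp (α * p.1 ^ 2) * Real.exp (τ * p.2 ^ 2)))
        ((volume : Measure ℝ).prod volume) ∧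
      ∫ p : ℝ × ℝ, p.1 ^ 2 * (Real.exp (α * p.1 ^ 2) * Real.exp (τ * p.2 ^ 2))
        ∂((volume : Measure ℝ).prod volume) =
        √(Real.pi / -α) * √(Real.pi / -τ) / (-2 * α) := by
  simp only [← mul_assoc]
  refine ⟨(integrable_sq_mul_exp_mul_sq hα).mul_prod (integrable_exp_mul_sq_iff.2 hτ), ?_⟩
  rw [integral_prod_mul (fun x : ℝ => x ^ 2 * Real.exp (α * x ^ 2))
    (fun y : ℝ => Real.exp (τ * y ^ 2)), integral_sq_mul_exp_mul_sq hα, integral_exp_mul_sq]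
  ring

theorem gaussian_moment_pair {α τ : ℝ} (hα : α < 0) (hτ : τ < 0) (s : ℝ) :
    Integrable (fun p : ℝ × ℝ => p.1 * (p.2 + s * p.1) *
        (Real.exp (α * p.1 ^ 2) * Real.exp (τ * p.2 ^ 2))) ((volume : Measure ℝ).prod volume) ∧
      ∫ p : ℝ × ℝ, p.1 * (p.2 + s * p.1) * (Real.exp (α * p.1 ^ 2) * Real.exp (τ * p.2 ^ 2))
        ∂((volume : Measure ℝ).prod volume) =
        √(Real.pi / -α) * √(Real.pi / -τ) * (s / (-2 * α)) := by
  obtain ⟨h1, h1'⟩ := gaussian_moment_fst hα hτ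
  have h2 := (integrable_mul_exp_mul_sq hα).mul_prod (integrable_mul_exp_mul_sq hτ)
  have h2' := integral_prod_mul (μ := volume) (ν := volume)
    (fun x : ℝ => x * Real.exp (α * x ^ 2)) (fun y : ℝ => y * Real.exp (τ * y ^ 2))
  rw [integral_mul_exp_mul_sq hα, zero_mul] at h2'
  have heq : ∀ p : ℝ × ℝ,
      p.1 * (p.2 + s * p.1) * (Real.exp (α * p.1 ^ 2) * Real.exp (τ * p.2 ^ 2)) =
      p.1 * Real.exp (α * p.1 ^ 2) * (p.2 * Real.exp (τ * p.2 ^ 2)) +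
        s * (p.1 ^ 2 * (Real.exp (α * p.1 ^ 2) * Real.exp (τ * p.2 ^ 2))) := fun p => by ring
  simp only [heq]
  refine ⟨h2.add (h1.const_mul s), ?_⟩
  rw [integral_add h2 (h1.const_mul s), h2', integral_const_mul, h1']
  ring

theorem gaussian_moment_snd {α τ : ℝ} (hα : α < 0) (hτ : τ < 0) (s : ℝ) :
    Integrable (fun p : ℝ × ℝ => (p.2 + s * p.1) ^ 2 *
        (Real.exp (α * p.1 ^ 2) * Real.exp (τ * p.2 ^ 2))) ((volume : Measure ℝ).prod volume) ∧
      ∫ p : ℝ × ℝ, (p.2 + s * p.1) ^ 2 * (Real.exp (α * p.1 ^ 2) * Real.exp (τ * p.2 ^ 2))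
        ∂((volume : Measure ℝ).prod volume) =
        √(Real.pi / -α) * √(Real.pi / -τ) * (1 / (-2 * τ) + s ^ 2 / (-2 * α)) := by
  -- The slope `s / 2` fits because `(p₂ + s p₁) ^ 2 = p₂ ^ 2 + 2 s p₁ (p₂ + (s / 2) p₁)`.
  obtain ⟨h1, h1'⟩ := gaussian_moment_pair hα hτ (s / 2)
  have h2 := (integrable_exp_mul_sq_iff.2 hα).mul_prod (integrable_sq_mul_exp_mul_sq hτ)
  have h2' := integral_prod_mul (μ := volume) (ν := volume)
    (fun x : ℝ => Real.exp (α * x ^ 2)) (fun y : ℝ => y ^ 2 * Real.exp (τ * y ^ 2))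
  rw [integral_exp_mul_sq, integral_sq_mul_exp_mul_sq hτ] at h2'
  have heq : ∀ p : ℝ × ℝ,
      (p.2 + s * p.1) ^ 2 * (Real.exp (α * p.1 ^ 2) * Real.exp (τ * p.2 ^ 2)) =
      Real.exp (α * p.1 ^ 2) * (p.2 ^ 2 * Real.exp (τ * p.2 ^ 2)) +
        2 * s * (p.1 * (p.2 + s / 2 * p.1) *
          (Real.exp (α * p.1 ^ 2) * Real.exp (τ * p.2 ^ 2))) := fun p => by ring
  simp only [heq]
  refine ⟨h2.add (h1.const_mul (2 * s)), ?_⟩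
  rw [integral_add h2 (h1.const_mul (2 * s)), h2', integral_const_mul, h1']
  ring

theorem gaussian_integrable_edgeDensity {θ : ℝ × ℝ × ℝ} (hθ : θ ∈ gaussianEdgeParam) :
    Integrable ((fixedMeanGaussian m).edgeDensity i j θ)
      ((fixedMeanGaussian m).ν.prod (fixedMeanGaussian m).ν) := by
  have hα := (gaussianMarginalParam_neg_iff hθ.1).2 hθ.2
  have h := (gaussian_integrable_edge_iff (m := m) (i := i) (j := j) hθ.1 fun _ => 1).2
    (by simpa using integrable_gaussian_prod hα hθ.1)
  simpa using h

theorem gaussianEdgeParam_subset : gaussianEdgeParam ⊆ (fixedMeanGaussian m).edgeParam i j :=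
  interior_maximal (fun _ hθ => gaussian_integrable_edgeDensity hθ) isOpen_gaussianEdgeParam

theorem gaussian_integral_edgeDensity {θ : ℝ × ℝ × ℝ} (h : θ.2.2 < 0) :
    ∫ p, (fixedMeanGaussian m).edgeDensity i j θ p
      ∂((fixedMeanGaussian m).ν.prod (fixedMeanGaussian m).ν) =
      √(Real.pi / -gaussianMarginalParam θ) * √(Real.pi / -θ.2.2) := by
  have h1 := gaussian_integral_edge (m := m) (i := i) (j := j) h fun _ => 1
  simp only [one_mul] at h1
  rw [h1, integral_prod_mul (fun x : ℝ => Real.exp (gaussianMarginalParam θ * x ^ 2))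
    (fun y : ℝ => Real.exp (θ.2.2 * y ^ 2)), integral_exp_mul_sq, integral_exp_mul_sq]

theorem pair_planeShear (s : ℝ) (p : ℝ × ℝ) :
    (fixedMeanGaussian m).ψ i j (planeShear s (m i) (m j) p).1 (planeShear s (m i) (m j) p).2 =
      p.1 * (p.2 + s * p.1) := by
  simp only [fixedMeanGaussian, planeShear, Homeomorph.homeomorph_mk_coe, Equiv.coe_fn_mk]
  ring

theorem fst_planeShear (s : ℝ) (p : ℝ × ℝ) :
    (fixedMeanGaussian m).φ i (planeShear s (m i) (m j) p).1 = p.1 ^ 2 := by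
  simp only [fixedMeanGaussian, planeShear, Homeomorph.homeomorph_mk_coe, Equiv.coe_fn_mk]
  ring

theorem snd_planeShear (s : ℝ) (p : ℝ × ℝ) :
    (fixedMeanGaussian m).φ j (planeShear s (m i) (m j) p).2 = (p.2 + s * p.1) ^ 2 := by
  simp only [fixedMeanGaussian, planeShear, Homeomorph.homeomorph_mk_coe, Equiv.coe_fn_mk]
  ring

theorem gaussian_integrable_edge_stat {θ : ℝ × ℝ × ℝ} (hθ : θ ∈ gaussianEdgeParam) :
    Integrable (fun p : ℝ × ℝ => (fixedMeanGaussian m).ψ i j p.1 p.2 *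
        (fixedMeanGaussian m).edgeDensity i j θ p)
        ((fixedMeanGaussian m).ν.prod (fixedMeanGaussian m).ν) ∧
      Integrable (fun p : ℝ × ℝ => (fixedMeanGaussian m).φ i p.1 *
        (fixedMeanGaussian m).edgeDensity i j θ p)
        ((fixedMeanGaussian m).ν.prod (fixedMeanGaussian m).ν) ∧
      Integrable (fun p : ℝ × ℝ => (fixedMeanGaussian m).φ j p.2 *
        (fixedMeanGaussian m).edgeDensity i j θ p)
        ((fixedMeanGaussian m).ν.prod (fixedMeanGaussian m).ν) := by
  have hα := (gaussianMarginalParam_neg_iff hθ.1).2 hθ.2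
  refine ⟨(gaussian_integrable_edge_iff hθ.1 fun p => (fixedMeanGaussian m).ψ i j p.1 p.2).2 ?_,
    (gaussian_integrable_edge_iff hθ.1 fun p => (fixedMeanGaussian m).φ i p.1).2 ?_,
    (gaussian_integrable_edge_iff hθ.1 fun p => (fixedMeanGaussian m).φ j p.2).2 ?_⟩
  · simp only [pair_planeShear]
    exact (gaussian_moment_pair hα hθ.1 _).1
  · simp only [fst_planeShear]
    exact (gaussian_moment_fst hα hθ.1).1
  · simp only [snd_planeShear]
    exact (gaussian_moment_snd hα hθ.1 _).1

/-- The determinant of the precision matrix. -/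
def gaussianPrecision (θ : ℝ × ℝ × ℝ) : ℝ := 4 * θ.2.1 * θ.2.2 - θ.1 ^ 2

/-- The covariance matrix is the inverse of the precision matrix, which has diagonal `-2 θ₁, -2 θ₂`
and off-diagonal entry `-θ₀`. -/
theorem gaussian_edgeMean {θ : ℝ × ℝ × ℝ} (hθ : θ ∈ gaussianEdgeParam) :
    (fixedMeanGaussian m).edgeMean i j θ = (θ.1 / gaussianPrecision θ,
      -2 * θ.2.2 / gaussianPrecision θ, -2 * θ.2.1 / gaussianPrecision θ) := by
  have hα := (gaussianMarginalParam_neg_iff hθ.1).2 hθ.2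
  have hτ := hθ.1
  have hΔ : gaussianPrecision θ = 4 * gaussianMarginalParam θ * θ.2.2 := by
    have := hτ.ne
    rw [gaussianPrecision, gaussianMarginalParam]; field_simp
  have e1 := gaussian_integral_edge (m := m) (i := i) (j := j) hτ
    fun p => (fixedMeanGaussian m).ψ i j p.1 p.2
  have e2 := gaussian_integral_edge (m := m) (i := i) (j := j) hτ
    fun p => (fixedMeanGaussian m).φ i p.1
  have e3 := gaussian_integral_edge (m := m) (i := i) (j := j) hτ
    fun p => (fixedMeanGaussian m).φ j p.2
  simp only [pair_planeShear] at e1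
  simp only [fst_planeShear] at e2
  simp only [snd_planeShear] at e3
  rw [(gaussian_moment_pair hα hτ _).2] at e1
  rw [(gaussian_moment_fst hα hτ).2] at e2
  rw [(gaussian_moment_snd hα hτ _).2] at e3
  have hr1 : 0 < √(Real.pi / -gaussianMarginalParam θ) :=
    Real.sqrt_pos.2 (div_pos Real.pi_pos (neg_pos.2 hα))
  have hr2 : 0 < √(Real.pi / -θ.2.2) := Real.sqrt_pos.2 (div_pos Real.pi_pos (neg_pos.2 hτ))
  have h21 : θ.2.1 = gaussianMarginalParam θ + θ.1 ^ 2 / (4 * θ.2.2) := by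
    rw [gaussianMarginalParam]; ring
  simp only [Family.edgeMean]
  rw [e1, e2, e3, gaussian_integral_edgeDensity hτ, hΔ, h21]
  generalize √(Real.pi / -gaussianMarginalParam θ) = r at *
  generalize √(Real.pi / -θ.2.2) = r' at *
  generalize gaussianMarginalParam θ = α at *
  have := hα.ne
  have := hτ.ne
  refine Prod.ext ?_ (Prod.ext ?_ ?_) <;> simp only <;> field_simp <;> ring

/-- The determinant of the covariance matrix. -/
def gaussianDet (η : ℝ × ℝ × ℝ) : ℝ := η.2.1 * η.2.2 - η.1 ^ 2

/-- The natural parameter as a function of the expectation parameters. -/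
noncomputable def gaussianEdgeInv (η : ℝ × ℝ × ℝ) : ℝ × ℝ × ℝ :=
  (η.1 / gaussianDet η, -η.2.2 / (2 * gaussianDet η), -η.2.1 / (2 * gaussianDet η))

theorem gaussianPrecision_edgeInv {η : ℝ × ℝ × ℝ} (h : 0 < gaussianDet η) :
    gaussianPrecision (gaussianEdgeInv η) = 1 / gaussianDet η := by
  have e : η.2.1 * η.2.2 - η.1 ^ 2 = gaussianDet η := rfl
  simp only [gaussianPrecision, gaussianEdgeInv]
  field_simp
  linarith

theorem gaussianEdgeInv_mem {η : ℝ × ℝ × ℝ} (h0 : 0 < η.2.1) (h : 0 < gaussianDet η) :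
    gaussianEdgeInv η ∈ gaussianEdgeParam := by
  have h1 := gaussianPrecision_edgeInv h
  have h2 : 0 < gaussianPrecision (gaussianEdgeInv η) := by rw [h1]; positivity
  exact ⟨div_neg_of_neg_of_pos (neg_lt_zero.2 h0) (by positivity), sub_pos.1 h2⟩

theorem gaussian_edgeMean_edgeInv {η : ℝ × ℝ × ℝ} (h0 : 0 < η.2.1) (h : 0 < gaussianDet η) :
    (fixedMeanGaussian m).edgeMean i j (gaussianEdgeInv η) = η := by
  rw [gaussian_edgeMean (gaussianEdgeInv_mem h0 h), gaussianPrecision_edgeInv h]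
  simp only [gaussianEdgeInv]
  refine Prod.ext ?_ (Prod.ext ?_ ?_) <;> simp only <;> field_simp

theorem gaussian_edgeLegendre {η : ℝ × ℝ × ℝ} (h0 : 0 < η.2.1) (h : 0 < gaussianDet η) :
    (fixedMeanGaussian m).edgeLegendre i j η =
      (-1 - Real.log (2 * Real.pi)) + -2⁻¹ * Real.log (gaussianDet η) := by
  have hθ := gaussianEdgeInv_mem h0 h
  have hα := (gaussianMarginalParam_neg_iff hθ.1).2 hθ.2
  obtain ⟨h1, h2, h3⟩ := gaussian_integrable_edge_stat (m := m) (i := i) (j := j) hθ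
  have hL := Family.edgeLegendre_edgeMean (gaussianEdgeParam_subset hθ) h1 h2 h3
  have e : Real.pi / -gaussianMarginalParam (gaussianEdgeInv η) *
      (Real.pi / -(gaussianEdgeInv η).2.2) = (2 * Real.pi) ^ 2 * gaussianDet η := by
    have hp := gaussianPrecision_edgeInv h
    have hτ := hθ.1.ne
    have hΔ : gaussianPrecision (gaussianEdgeInv η) =
        4 * gaussianMarginalParam (gaussianEdgeInv η) * (gaussianEdgeInv η).2.2 := by
      rw [gaussianPrecision, gaussianMarginalParam]; field_simp
    rw [hp] at hΔ
    have := hα.ne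
    rw [div_mul_div_comm, neg_mul_neg, div_eq_iff (mul_ne_zero this hτ)]
    field_simp at hΔ
    linear_combination Real.pi ^ 2 * hΔ
  rw [gaussian_edgeMean_edgeInv h0 h, Family.edgeLogPart, gaussian_integral_edgeDensity hθ.1,
    ← Real.sqrt_mul (div_pos Real.pi_pos (neg_pos.2 hα)).le, e, Real.log_sqrt (by positivity),
    Real.log_mul (by positivity) h.ne', Real.log_pow] at hL
  rw [hL]
  -- The pairing is minus half the trace of precision times covariance, the 2 × 2 identity.
  have e2 : (gaussianEdgeInv η).1 * η.1 + (gaussianEdgeInv η).2.1 * η.2.1 +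
      (gaussianEdgeInv η).2.2 * η.2.2 = -1 := by
    have e3 : gaussianDet η = η.2.1 * η.2.2 - η.1 ^ 2 := rfl
    simp only [gaussianEdgeInv]
    field_simp
    linarith
  rw [e2]
  push_cast
  ring

theorem continuous_gaussianDet : Continuous gaussianDet := by
  unfold gaussianDet; fun_prop

theorem gaussian_edge_eventually {η : ℝ × ℝ × ℝ} (h0 : 0 < η.2.1) (h : 0 < gaussianDet η) :
    ∀ᶠ y in 𝓝 η, 0 < y.2.1 ∧ 0 < gaussianDet y := by
  have hc : ContinuousAt (fun y : ℝ × ℝ × ℝ => y.2.1) η := by fun_prop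
  exact (hc.eventually (lt_mem_nhds h0)).and
    (continuous_gaussianDet.continuousAt.eventually (lt_mem_nhds h))

theorem gaussian_edgeDual_mem_nhds {η : ℝ × ℝ × ℝ} (h0 : 0 < η.2.1) (h : 0 < gaussianDet η) :
    (fixedMeanGaussian m).edgeDual i j ∈ 𝓝 η := by
  filter_upwards [gaussian_edge_eventually h0 h] with y hy
  exact ⟨_, gaussianEdgeParam_subset (gaussianEdgeInv_mem hy.1 hy.2),
    gaussian_edgeMean_edgeInv hy.1 hy.2⟩

/-- The vertex statistics are squares of centered Gaussians, whose variances are `2 η_i ^ 2` and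
covariance `2 η_ij ^ 2`. The entropy is the logarithm of a quadratic polynomial, whence the use of
`comp_quadratic`. -/
theorem gaussian_edge_hasQuadraticExpansion {η : ℝ × ℝ × ℝ} (h0 : 0 < η.2.1)
    (h : 0 < gaussianDet η) : ∃ k A B : ℝ, 0 < k ∧
      HasQuadraticExpansion ((fixedMeanGaussian m).edgeLegendre i j) η
        (fun x => (gaussianEdgeInv η).1 * x.1 + (gaussianEdgeInv η).2.1 * x.2.1 +
          (gaussianEdgeInv η).2.2 * x.2.2)
        (fun x => ((2 * η.2.2 ^ 2 * x.2.1 ^ 2 - 2 * (2 * η.1 ^ 2) * x.2.1 * x.2.2 +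
            2 * η.2.1 ^ 2 * x.2.2 ^ 2) /
              (2 * η.2.1 ^ 2 * (2 * η.2.2 ^ 2) - (2 * η.1 ^ 2) ^ 2) +
          k * (x.1 - A * x.2.1 - B * x.2.2) ^ 2) / 2) := by
  set L : ℝ × ℝ × ℝ →L[ℝ] ℝ := η.2.2 • (ContinuousLinearMap.fst ℝ ℝ ℝ).comp
      (ContinuousLinearMap.snd ℝ ℝ (ℝ × ℝ)) +
    η.2.1 • (ContinuousLinearMap.snd ℝ ℝ ℝ).comp (ContinuousLinearMap.snd ℝ ℝ (ℝ × ℝ)) -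
    (2 * η.1) • ContinuousLinearMap.fst ℝ ℝ (ℝ × ℝ) with hL
  have hLx : ∀ x, L x = η.2.2 * x.2.1 + η.2.1 * x.2.2 - 2 * η.1 * x.1 := fun x => by
    simp [hL]
  have hR : ∀ x : ℝ × ℝ × ℝ, |x.2.1 * x.2.2 - x.1 ^ 2| ≤ 2 * ‖x‖ ^ 2 := fun x => by
    have h1 : |x.1| ≤ ‖x‖ := norm_fst_le x
    have h2 : |x.2.1| ≤ ‖x‖ := (norm_fst_le x.2).trans (norm_snd_le x)
    have h3 : |x.2.2| ≤ ‖x‖ := (norm_snd_le x.2).trans (norm_snd_le x)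
    calc |x.2.1 * x.2.2 - x.1 ^ 2| ≤ |x.2.1 * x.2.2| + |x.1 ^ 2| := abs_sub _ _
      _ = |x.2.1| * |x.2.2| + |x.1| ^ 2 := by rw [abs_mul, abs_pow]
      _ ≤ ‖x‖ * ‖x‖ + ‖x‖ ^ 2 := by gcongr
      _ = 2 * ‖x‖ ^ 2 := by ring
  have hexp := (hasQuadraticExpansion_log h).comp_quadratic (x := η) (B := gaussianDet) L
    (fun x => by rw [hLx]; simp only [gaussianDet, Prod.fst_add, Prod.snd_add]; ring) hR
  have hconst : HasQuadraticExpansion (fun _ : ℝ × ℝ × ℝ => -1 - Real.log (2 * Real.pi)) η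
      (fun _ => 0) (fun _ => 0) := .of_affine fun _ => by simp
  have hdet : gaussianDet η = η.2.1 * η.2.2 - η.1 ^ 2 := rfl
  have hsum : 0 < η.2.1 * η.2.2 + η.1 ^ 2 := by nlinarith [sq_nonneg η.1]
  -- These constants complete the square in the pair variable.
  refine ⟨(η.2.1 * η.2.2 + η.1 ^ 2) / gaussianDet η ^ 2,
    η.1 * η.2.2 / (η.2.1 * η.2.2 + η.1 ^ 2), η.1 * η.2.1 / (η.2.1 * η.2.2 + η.1 ^ 2),
    by positivity, ((hconst.add (hexp.const_mul (-2⁻¹))).congr_of_eventuallyEq ?_).congr_coeff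
      (fun x => ?_) fun x => ?_⟩
  · filter_upwards [gaussian_edge_eventually h0 h] with y hy
    exact gaussian_edgeLegendre hy.1 hy.2
  · rw [hLx]
    simp only [gaussianEdgeInv]
    field_simp
    ring
  · have hden : 2 * η.2.1 ^ 2 * (2 * η.2.2 ^ 2) - (2 * η.1 ^ 2) ^ 2 =
        4 * gaussianDet η * (η.2.1 * η.2.2 + η.1 ^ 2) := by rw [hdet]; ring
    rw [hLx, hden]
    have hS : η.2.1 * η.2.2 = gaussianDet η + η.1 ^ 2 := by rw [hdet]; ring
    have hS' := hsum.ne'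
    rw [hS] at hS' ⊢
    field_simp
    rw [hdet]
    ring

end FixedMeanGaussian

/-! ### The dichotomy for the fixed-mean Gaussian model. -/

section GaussianLBP

variable {V : Type*} [Fintype V] [DecidableEq V] {G : SimpleGraph V} [DecidableRel G.Adj]
  {P : Potential G} {μ : G.Dart → ℝ} {m : V → ℝ}

/-- The dependence of the message on the cavity parameter in the Gaussian model. -/
noncomputable def gaussianMessage (J θ : ℝ) : ℝ := -J ^ 2 / (4 * θ)

theorem hasDerivAt_gaussianMessage (J : ℝ) {θ : ℝ} (hθ : θ < 0) :
    HasDerivAt (gaussianMessage J) (J ^ 2 / (4 * θ ^ 2)) θ := by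
  have := hθ.ne
  refine ((hasDerivAt_const θ (-J ^ 2)).div ((hasDerivAt_id' θ).const_mul 4)
    (by simpa using this)).congr_deriv ?_
  field_simp
  ring

/-- Only `J ^ 2` occurs, so the sign of the interaction is irrelevant. -/
theorem monotoneOn_gaussianMessage (J : ℝ) : MonotoneOn (gaussianMessage J) (Iio 0) := by
  intro x hx y hy hxy
  have hx : x < 0 := hx
  have hy : y < 0 := hy
  simp only [gaussianMessage]
  rw [← neg_div_neg_eq (-J ^ 2) (4 * x), ← neg_div_neg_eq (-J ^ 2) (4 * y)]
  exact div_le_div_of_nonneg_left (by simpa using sq_nonneg J) (by linarith) (by linarith)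

theorem gaussian_isUpdate_iff (μ μ' : G.Dart → ℝ) : IsUpdate (fixedMeanGaussian m) P μ μ' ↔
    ∀ d, cavityParam P μ d ∈ Iio 0 ∧
      μ' d = P.a d + gaussianMessage (P.J (dartEdge d)) (cavityParam P μ d) := by
  rw [isUpdate_iff_integral]
  refine forall_congr' fun d => ?_
  simp only [fixedMeanGaussian, mem_Iio]
  generalize P.J (dartEdge d) = J
  generalize cavityParam P μ d = θ
  constructor
  · rintro ⟨ω, hω, h⟩
    -- A divergent integral has the default value `0`, which cannot equal an exponential.
    have hθ : θ < 0 := by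
      obtain ⟨y, hy⟩ := h.exists
      refine neg_of_integrable_exp_linear_add_sq (J := J) (a := m d.fst) (y := y - m d.snd) ?_
      by_contra hni
      rw [integral_undef hni, mul_zero, mul_zero] at hy
      exact (Real.exp_pos _).ne' hy
    refine ⟨hθ, ?_⟩
    simp only [integral_exp_linear_add_sq hθ] at h
    -- Continuity upgrades the almost-everywhere identity to all `y`; evaluating at the mean fixes
    -- `ω`, and one unit away it fixes the exponent.
    have hall := (Continuous.ae_eq_iff_eq (volume : Measure ℝ) (by fun_prop) (by fun_prop)).1 h
    have hr : 0 < √(Real.pi / -θ) := Real.sqrt_pos.2 (div_pos Real.pi_pos (neg_pos.2 hθ))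
    have h0 := congrFun hall (m d.snd)
    have h1 := congrFun hall (m d.snd + 1)
    simp only [sub_self, add_sub_cancel_left, ne_eq, OfNat.ofNat_ne_zero, not_false_eq_true,
      zero_pow, mul_zero, Real.exp_zero, one_mul, one_pow, mul_one] at h0 h1
    have h2 : Real.exp (μ' d) = Real.exp (P.a d) * Real.exp (-J ^ 2 / (4 * θ)) := by
      rw [h1]
      linear_combination -Real.exp (P.a d) * Real.exp (-J ^ 2 / (4 * θ)) * h0
    rw [← Real.exp_add] at h2
    exact Real.exp_injective h2
  · rintro ⟨hθ, h⟩
    have hr : 0 < √(Real.pi / -θ) := Real.sqrt_pos.2 (div_pos Real.pi_pos (neg_pos.2 hθ))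
    refine ⟨(√(Real.pi / -θ))⁻¹, inv_pos.2 hr, .of_forall fun y => ?_⟩
    rw [integral_exp_linear_add_sq hθ, h, gaussianMessage, add_mul, Real.exp_add]
    generalize √(Real.pi / -θ) = r at hr ⊢
    field_simp

theorem gaussian_hasMonotoneUpdate :
    HasMonotoneUpdate (fixedMeanGaussian m) P (Iio 0)
      fun d => gaussianMessage (P.J (dartEdge d)) where
  isOpen := isOpen_Iio
  ordConnected := ordConnected_Iio
  isUpdate_iff := gaussian_isUpdate_iff
  monotoneOn _ := monotoneOn_gaussianMessage _

/-- A nondegenerate fixed point of the fixed-mean Gaussian model is a local minimum of the Bethe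
free energy if it is locally stable, and a saddle point otherwise. -/
theorem gaussian_localMin_or_saddle (hμ : IsFixedPoint (fixedMeanGaussian m) P μ)
    (hnd : IsNondegenerate (fixedMeanGaussian m) P μ) :
    (IsLocallyStable (fixedMeanGaussian m) P μ →
        IsBetheLocalMin (fixedMeanGaussian m) P (beliefPoint (fixedMeanGaussian m) P μ)) ∧
      (¬ IsLocallyStable (fixedMeanGaussian m) P μ →
        IsBetheSaddle (fixedMeanGaussian m) P (beliefPoint (fixedMeanGaussian m) P μ)) := by
  have hup := (gaussian_isUpdate_iff μ μ).1 hμ.1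
  have hβ : ∀ i, beliefParam P μ i < 0 := fun i => by
    have h := hμ.2.1 i
    simp only [funext fun x => vertexBelief_eq_exp (I := fixedMeanGaussian m) (P := P) (μ := μ)
      i x] at h
    exact gaussian_integrable_vertex_iff.1 h
  have hcav : ∀ d, cavityParam P μ d < 0 := fun d => (hup d).1
  -- The fixed-point equation of the reversed dart again expresses local consistency. With
  -- normalizability of the vertex beliefs it puts the edge parameters into `gaussianEdgeParam`.
  have hmarg : ∀ d, gaussianMarginalParam (edgeBeliefParam P μ d) = beliefParam P μ d.fst :=
    fun d => by
      have h1 := (hup d.symm).2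
      rw [dartEdge_symm, gaussianMessage] at h1
      rw [beliefParam_fst, h1, gaussianMarginalParam]
      simp only [edgeBeliefParam]
      ring
  have hmem : ∀ d, edgeBeliefParam P μ d ∈ gaussianEdgeParam := fun d =>
    ⟨hcav d.symm, (gaussianMarginalParam_neg_iff (hcav d.symm)).1 (by rw [hmarg]; exact hβ _)⟩
  set η : G.Dart → ℝ × ℝ × ℝ := fun d =>
    (fixedMeanGaussian m).edgeMean d.fst d.snd (edgeBeliefParam P μ d) with hη
  have hηeq : ∀ d, η d = _ := fun d => gaussian_edgeMean (hmem d)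
  have hprec : ∀ d, 0 < gaussianPrecision (edgeBeliefParam P μ d) := fun d => sub_pos.2 (hmem d).2
  have hfst : ∀ d, (η d).2.1 =
      (fixedMeanGaussian m).vertexMean d.fst (beliefParam P μ d.fst) := fun d => by
    rw [gaussian_vertexMean (hβ _), ← hmarg, hηeq]
    have h1 := hprec d
    have h2 : (edgeBeliefParam P μ d).2.2 ≠ 0 := (hcav d.symm).ne
    have h3 : gaussianPrecision (edgeBeliefParam P μ d) =
        4 * gaussianMarginalParam (edgeBeliefParam P μ d) * (edgeBeliefParam P μ d).2.2 := by
      rw [gaussianPrecision, gaussianMarginalParam]; field_simp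
    have h4 : gaussianMarginalParam (edgeBeliefParam P μ d) ≠ 0 := by
      rw [hmarg]; exact (hβ _).ne
    simp only
    rw [h3]
    field_simp
    ring
  have hsymm : ∀ d, η d.symm = ((η d).1, (η d).2.2, (η d).2.1) := fun d => by
    rw [hηeq, hηeq, edgeBeliefParam_symm]
    simp only [gaussianPrecision]
    refine Prod.ext ?_ (Prod.ext ?_ ?_) <;> simp only <;> ring
  have hsnd : ∀ d, (η d).2.2 =
      (fixedMeanGaussian m).vertexMean d.snd (beliefParam P μ d.snd) := fun d => by
    have h1 := hfst d.symm
    rw [hsymm] at h1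
    exact h1
  have hvpos : ∀ i, 0 < (fixedMeanGaussian m).vertexMean i (beliefParam P μ i) := fun i => by
    rw [gaussian_vertexMean (hβ i)]
    exact div_pos_of_neg_of_neg (by norm_num) (by linarith [hβ i])
  have hpos : ∀ d, 0 < (η d).2.1 := fun d => by rw [hfst]; exact hvpos _
  have hdet : ∀ d, gaussianDet (η d) = 1 / gaussianPrecision (edgeBeliefParam P μ d) := fun d => by
    have h1 := hprec d
    have h2 : gaussianPrecision (edgeBeliefParam P μ d) = 4 * (edgeBeliefParam P μ d).2.1 *
      (edgeBeliefParam P μ d).2.2 - (edgeBeliefParam P μ d).1 ^ 2 := rfl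
    rw [hηeq]
    simp only [gaussianDet]
    field_simp
    linarith
  have hdetpos : ∀ d, 0 < gaussianDet (η d) := fun d => by
    rw [hdet]; exact one_div_pos.2 (hprec d)
  have hinv : ∀ d, gaussianEdgeInv (η d) = edgeBeliefParam P μ d := fun d => by
    have h1 := hprec d
    rw [gaussianEdgeInv, hdet, hηeq]
    refine Prod.ext ?_ (Prod.ext ?_ ?_) <;> simp only <;> field_simp
  set v : V → ℝ := fun i => 2 * (fixedMeanGaussian m).vertexMean i (beliefParam P μ i) ^ 2 with hv
  set c : G.Dart → ℝ := fun d => 2 * (η d).1 ^ 2 with hc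
  have hcov : IsCovariance v c :=
    { pos := fun i => by have := hvpos i; positivity
      nonneg := fun d => by positivity
      symm := fun d => by simp only [hc, hsymm]
      lt := fun d => by
        have h1 := hdetpos d
        simp only [hv, hc]
        rw [← hfst, ← hsnd]
        simp only [gaussianDet] at h1
        have h2 : (η d).1 ^ 2 < (η d).2.1 * (η d).2.2 := by linarith
        have h3 := pow_lt_pow_left₀ h2 (sq_nonneg _) two_ne_zero
        nlinarith }
  refine HasBetheExpansion.localMin_or_saddle (.of_local (fun d => Prod.ext (hfst d) (hsnd d))
    (fun i => ?_) (fun d => gaussian_edgeDual_mem_nhds (hpos d) (hdetpos d))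
    (fun i => gaussian_vertex_hasQuadraticExpansion (hβ i) (gaussian_vertexMean (hβ i)))
    fun d => ?_) hcov gaussian_hasMonotoneUpdate (fun d => ?_) hμ.1 hnd
  · rw [gaussian_vertexDual]
    exact isOpen_Ioi.mem_nhds (hvpos i)
  · obtain ⟨k, A, B, hk, h⟩ := gaussian_edge_hasQuadraticExpansion (m := m) (i := d.fst)
      (j := d.snd) (hpos d) (hdetpos d)
    rw [hinv] at h
    refine ⟨k, A, B, hk, h.congr_coeff (fun _ => rfl) fun x => ?_⟩
    simp only [edgeForm, dartDet, hc]
    rw [hfst, hsnd]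
  · refine (hasDerivAt_gaussianMessage _ (hcav d)).congr_deriv ?_
    have h1 := (hprec d).ne'
    have h2 := (hcav d).ne
    have h3 : c d / v d.snd = 2 * (η d).1 ^ 2 / (2 * (η d).2.2 ^ 2) := by simp only [hv, hc, hsnd]
    rw [h3, hηeq]
    simp only [edgeBeliefParam] at h1 ⊢
    field_simp
    ring

end GaussianLBP

end PairwiseLBP

/-! ### The dichotomy applied at each `t ≠ t₀`. -/

theorem theorem10 {V : Type*} [Fintype V] [DecidableEq V] (G : SimpleGraph V) [DecidableRel G.Adj]
    (I : PairwiseLBP.Family V) (P : ℝ → PairwiseLBP.Potential G) (μ : ℝ → G.Dart → ℝ)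
    (t₀ t₁ : ℝ) (ht₀ : 0 < t₀) (ht₁ : t₀ < t₁)
    (hmodel : (I = PairwiseLBP.binary V ∧ ∀ t ∈ Set.Ico 0 t₁, (P t).Attractive) ∨
      ∃ m : V → ℝ, I = PairwiseLBP.fixedMeanGaussian m)
    (hJ : ContinuousOn (fun t => (P t).J) (Set.Ico 0 t₁))
    (ha : ContinuousOn (fun t => (P t).a) (Set.Ico 0 t₁))
    (hh : ContinuousOn (fun t => (P t).h) (Set.Ico 0 t₁))
    (hμ : ContinuousOn μ (Set.Ico 0 t₁))
    (hfix : ∀ t ∈ Set.Ico 0 t₁, PairwiseLBP.IsFixedPoint I (P t) (μ t))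
    (hnondeg : ∀ t ∈ Set.Ico 0 t₁, t ≠ t₀ → PairwiseLBP.IsNondegenerate I (P t) (μ t))
    (hstable : ∀ t ∈ Set.Ico 0 t₀, PairwiseLBP.IsLocallyStable I (P t) (μ t))
    (hunstable : ∀ t ∈ Set.Ioo t₀ t₁, ¬ PairwiseLBP.IsLocallyStable I (P t) (μ t)) :
    (∀ t ∈ Set.Ico 0 t₀,
      PairwiseLBP.IsBetheLocalMin I (P t) (PairwiseLBP.beliefPoint I (P t) (μ t))) ∧
    ∀ t ∈ Set.Ioo t₀ t₁,
      PairwiseLBP.IsBetheSaddle I (P t) (PairwiseLBP.beliefPoint I (P t) (μ t)) := by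
  refine ⟨fun t ht => ?_, fun t ht => ?_⟩
  · have ht' : t ∈ Set.Ico 0 t₁ := ⟨ht.1, ht.2.trans ht₁⟩
    have hnd := hnondeg t ht' ht.2.ne
    rcases hmodel with ⟨rfl, hatt⟩ | ⟨m, rfl⟩
    · exact (PairwiseLBP.binary_localMin_or_saddle (hatt t ht') (hfix t ht').1 hnd).1 (hstable t ht)
    · exact (PairwiseLBP.gaussian_localMin_or_saddle (hfix t ht') hnd).1 (hstable t ht)
  · have ht' : t ∈ Set.Ico 0 t₁ := ⟨(ht₀.trans ht.1).le, ht.2⟩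
    have hnd := hnondeg t ht' ht.1.ne'
    rcases hmodel with ⟨rfl, hatt⟩ | ⟨m, rfl⟩
    · exact (PairwiseLBP.binary_localMin_or_saddle (hatt t ht') (hfix t ht').1 hnd).2
        (hunstable t ht)
    · exact (PairwiseLBP.gaussian_localMin_or_saddle (hfix t ht') hnd).2 (hunstable t ht)
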